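/- For a set $K$ of positive integers, a $K$-decomposition of the complete graph $K_v$ is a collection of complete subgraphs of $K_v$ (called blocks), each with number of vertices in $K$, such that every edge of $K_v$ lies in exactly one block. Let $D(18,\{3,4\})$ denote the minimum number of blocks in a $\{3,4\}$-decomposition of $K_{18}$, that is, in a decomposition of the edges of $K_{18}$ into copies of $K_3$ and $K_4$. **Theorem.** Decompositions of $K_{18}$ into copies of $K_3$ and $K_4$ exist, and $D(18,\{3,4\})=33$. The minimum is attained by a decomposition with $15$ copies of $K_3$ and $18$ copies of $K_4$, and every decomposition of $K_{18}$ into copies of $K_3$ and $K_4$ with the minimum number of blocks has exactly $15$ copies of $K_3$ and $18$ copies of $K_4$. -/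

import Mathlib

/-- `B` is a decomposition of the simple graph `G` into complete subgraphs whose orders lie in `K`:
every block `b ∈ B` is (the vertex set of) a clique of `G` with `b.card ∈ K`, and every edge of `G`
lies in exactly one block.  (For orders at least two a complete subgraph is determined by its vertex
set, and no block can be repeated, so a finite set of vertex sets is the right data.) -/
structure IsCliqueDecomposition {V : Type*} (G : SimpleGraph V) (K : Set ℕ)
    (B : Finset (Finset V)) : Prop where
  isClique : ∀ b ∈ B, G.IsClique (b : Set V)
  card_mem : ∀ b ∈ B, b.card ∈ K
  existsUnique_block : ∀ x y : V, G.Adj x y → ∃! b : Finset V, b ∈ B ∧ x ∈ b ∧ y ∈ b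

/-- The numbers of blocks occurring among the decompositions of the complete graph `K_v`, on the
vertex set `Fin v`, into complete graphs with orders in `K`. -/
def decompositionSizes (v : ℕ) (K : Set ℕ) : Set ℕ :=
  {n | ∃ B : Finset (Finset (Fin v)),
    IsCliqueDecomposition (⊤ : SimpleGraph (Fin v)) K B ∧ B.card = n}

/-- `D(v, K)`: the minimum number of blocks in a decomposition of `K_v` into complete graphs with
orders in `K` (meaningful when such a decomposition exists). -/
noncomputable def minDecomposition (v : ℕ) (K : Set ℕ) : ℕ :=
  sInf (decompositionSizes v K)

/-- The number of blocks of `B` with exactly `k` vertices. -/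
def numBlocks {V : Type*} (B : Finset (Finset V)) (k : ℕ) : ℕ :=
  (B.filter fun b => b.card = k).card

open Finset

/-! Let `t` and `q` be the numbers of triangles and quadruples. Counting edges gives `3t + 6q =
153`, so `t + 2q = 51` and the number of blocks is `51 - q`. Minimising the number of blocks means
maximising `q`, and `q` determines `t`. A decomposition with `q = 18`, `t = 15` is written down
explicitly, so everything rests on `q ≤ 18` (`numBlocks_four_le`).

A point in `a` triangles and `b` quadruples satisfies `2a + 3b = 17`, so `(a, b)` is `(1, 5)`, `(4,
3)` or `(7, 1)`. Call the point special if `a > 1` and rich if `a = 7`; let there be `s` special and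
`r` rich points. Then `t = 6 + s + r`, and `q ≥ 19` forces `s + r` to be odd and at most 7. Sort the
blocks by their number of special points. Counting blocks, incidences with special points, and pairs
of special points (`counting`) leaves a short list of distributions (`count_cases`).

Local arguments dispose of the distribution with a rich point (`not_rich`) and of all but one of
those with seven special points (`four_le_of_quad`, `classCount_four_three`, `not_two_triangles`).
They compare the number of special points with what the few blocks through one point must or can
contain.

Six distributions remain, all without rich points: one with `s = 1`, one with `s = 3`, three with `s
= 5` and one with `s = 7`. After relabelling, the special points are `0, …, s - 1`
(`exists_isModel`), and a verified search excludes each distribution. A certificate tree branches on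
triangles and a few quadruples, discarding branches equivalent under symmetries of the blocks placed
so far (`refuted_of_survivors`). At a leaf all triangles are known, so every pair still uncovered
must lie in a quadruple, and an exact-cover search shows that this is impossible (`search_sound`).
-/

/-- Two blocks of a clique decomposition that share two points are equal. -/
theorem IsCliqueDecomposition.eq_of_mem {V : Type*} {K : Set ℕ} {B : Finset (Finset V)}
    (h : IsCliqueDecomposition (⊤ : SimpleGraph V) K B) {b c : Finset V} (hb : b ∈ B) (hc : c ∈ B)
    {x y : V} (hxy : x ≠ y) (hxb : x ∈ b) (hyb : y ∈ b) (hxc : x ∈ c) (hyc : y ∈ c) : b = c :=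
  (h.existsUnique_block x y (by simpa using hxy)).unique ⟨hb, hxb, hyb⟩ ⟨hc, hxc, hyc⟩

theorem IsCliqueDecomposition.exists_mem {V : Type*} {K : Set ℕ} {B : Finset (Finset V)}
    (h : IsCliqueDecomposition (⊤ : SimpleGraph V) K B) {x y : V} (hxy : x ≠ y) :
    ∃ b ∈ B, x ∈ b ∧ y ∈ b :=
  let ⟨b, hb, _⟩ := h.existsUnique_block x y (by simpa using hxy)
  ⟨b, hb.1, hb.2⟩

theorem IsCliqueDecomposition.card_eq {V : Type*} {B : Finset (Finset V)}
    (h : IsCliqueDecomposition (⊤ : SimpleGraph V) {3, 4} B) {b : Finset V} (hb : b ∈ B) :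
    b.card = 3 ∨ b.card = 4 := by
  simpa using h.card_mem b hb

/-! ### Exact cover of the remaining pairs by quadruples. -/

namespace PairSearch

/-! Exact-cover search on bit masks. The 153 pairs of points are numbered; bit `155 * e + f` of a
state says that the quadruple consisting of the disjoint pairs `e` and `f` may still be a block, and
bit `155 * e + 153` that the pair `e` is in none of the blocks placed so far. -/

def pairList : List (ℕ × ℕ) :=
  (List.range 18).flatMap fun a =>
    ((List.range 18).filter fun b => Nat.blt a b).map fun b => (a, b)

def packed (w : ℕ) (l : List ℕ) : ℕ :=
  l.foldr (fun x m => Nat.lor x (Nat.shiftLeft m w)) 0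

def firstEnds : ℕ := packed 5 (pairList.map Prod.fst)

def secondEnds : ℕ := packed 5 (pairList.map Prod.snd)

def fstEnd (e : ℕ) : ℕ := Nat.land (Nat.shiftRight firstEnds (Nat.mul e 5)) 31

def sndEnd (e : ℕ) : ℕ := Nat.land (Nat.shiftRight secondEnds (Nat.mul e 5)) 31

def incident (e a : ℕ) : Bool := cond (Nat.beq (fstEnd e) a) true (Nat.beq (sndEnd e) a)

def star (a : ℕ) : ℕ := packed 1 ((List.range 153).map fun e => cond (incident e a) 1 0)

def low : ℕ := 2 ^ 153 - 1

/-- One bit more than `low`: the mask of a point of the pair `e` also has to contain bit 153 of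
field `e`, the mark of an uncovered pair. -/
def high : ℕ := 2 ^ 154 - 1

/-- The mask of all bits that involve the point `a`. -/
def pointMask (a : ℕ) : ℕ :=
  packed 155 ((List.range 153).map fun e => cond (incident e a) high (star a))

def candidates : ℕ :=
  packed 155 ((List.range 153).map fun e =>
    Nat.xor low (Nat.lor (star (fstEnd e)) (star (sndEnd e))))

def ones : ℕ := packed 155 ((List.range 153).map fun _ => 1)

def tops : ℕ := Nat.shiftLeft ones 153

def fulls : ℕ := Nat.mul ones low

def start : ℕ := Nat.lor candidates tops

def pointMasks : List ℕ :=
  [pointMask 0, pointMask 1, pointMask 2, pointMask 3, pointMask 4, pointMask 5, pointMask 6,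
    pointMask 7, pointMask 8, pointMask 9, pointMask 10, pointMask 11, pointMask 12, pointMask 13,
    pointMask 14, pointMask 15, pointMask 16, pointMask 17]

/-- In the executed definitions, recursors, `cond` and the bare binary functions on `Nat` are chosen
because they evaluate well under kernel reduction. -/
noncomputable def nth (l : List ℕ) : ℕ → ℕ :=
  l.rec (fun _ => 0) fun x _ ih n => Nat.rec x (fun m _ => ih m) n

noncomputable def mask (a : ℕ) : ℕ := nth pointMasks a

def atLeastTwo (p q r s : ℕ) : ℕ :=
  Nat.lor (Nat.land (Nat.lor p q) (Nat.lor r s)) (Nat.lor (Nat.land p q) (Nat.land r s))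

/-- Two blocks sharing two points coincide, so candidates with at least two of the four points die,
except the quadruple itself. The uncovered mark of a pair lies in the masks of exactly the two
points of the pair, so it is erased exactly when the pair is inside the new block. -/
def placeQuad (R p q r s : ℕ) : ℕ :=
  Nat.lor (Nat.land (Nat.land (Nat.land R p) q) (Nat.land r s))
    (Nat.xor R (Nat.land R (atLeastTwo p q r s)))

def placeTriangle (R p q r : ℕ) : ℕ :=
  Nat.xor R (Nat.land R (Nat.lor (Nat.land p q) (Nat.land r (Nat.lor p q))))

def forbidQuad (R p q r s : ℕ) : ℕ :=
  Nat.xor R (Nat.land (Nat.land (Nat.land R p) q) (Nat.land r s))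

/-! A heuristic for the pair to branch on: one with at most three candidates, if there is any. -/

def pairTable : ℕ :=
  (List.range 153).foldr
    (fun e m => Nat.lor m (Nat.shiftLeft e (Nat.mul 8 (Nat.mod (Nat.pow 2 (155 * e + 153)) 163)))) 0

def slotTable : ℕ :=
  (List.range 153).foldr
    (fun e m => Nat.lor m (Nat.shiftLeft e (Nat.mul 8 (Nat.mod (Nat.pow 2 e) 163)))) 0

/-- The number `x` is reduced to its lowest set bit, a power of two, which is hashed modulo 163.
Since 2 is a primitive root modulo 163 and 155 is prime to 162, the 153 powers entered in either
table have distinct residues. -/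
def lookup (t x : ℕ) : ℕ :=
  Nat.land
    (Nat.shiftRight t
      (Nat.mul 8 (Nat.mod (Nat.xor x (Nat.land x (Nat.sub x 1))) 163))) 255

/-- When the top bits of `Q` are clear, adding `2 ^ 153 - 1` to a field carries into bit 153 exactly
if the field is not zero. One addition thus tests all pairs at once. -/
def nonzero (Q T : ℕ) : ℕ := Nat.land (Nat.add Q fulls) T

/-- Clears the lowest set bit of every field simultaneously; the guard bits `tops` keep the
subtraction from borrowing across fields. -/
def dropLow (Q : ℕ) : ℕ := Nat.land Q (Nat.sub (Nat.lor Q tops) ones)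

/-- After `k` rounds a field is empty exactly if its pair had at most `k` candidates. The first
failing round therefore exhibits the uncovered pairs with the fewest candidates; if no round fails,
all uncovered pairs are returned. -/
noncomputable def scarce (n : ℕ) : ℕ → ℕ → ℕ :=
  n.rec (fun _ T => T) fun _ ih Q T =>
    cond (Nat.beq (nonzero Q T) T) (ih (dropLow Q) T) (Nat.xor (nonzero Q T) T)

noncomputable def pick (R : ℕ) : ℕ :=
  lookup pairTable (scarce 4 (Nat.xor R (Nat.land R tops)) (Nat.land R tops))

def bitAt (R i : ℕ) : Bool := Nat.beq (Nat.land (Nat.shiftRight R i) 1) 1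

/-- The choices made by `pick` and `lookup` are not trusted. This test provides all that soundness
needs of them: `e` and `f` number two disjoint pairs. -/
def valid (e f : ℕ) : Bool :=
  cond (Nat.blt f 153) (bitAt candidates (Nat.add (Nat.mul 155 e) f)) false

noncomputable def branch (ih : ℕ → Bool) (R p q r s : ℕ) : Bool :=
  cond (ih (placeQuad R p q r s)) (ih (forbidQuad R p q r s)) false

noncomputable def branchAt (ih : ℕ → Bool) (R e f : ℕ) : Bool :=
  cond (valid e f)
    (branch ih R (mask (fstEnd e)) (mask (sndEnd e)) (mask (fstEnd f)) (mask (sndEnd f))) false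

noncomputable def branchField (ih : ℕ → Bool) (R e x : ℕ) : Bool :=
  cond (Nat.beq x 0) (bitAt R (Nat.add (Nat.mul 155 e) 153)) (branchAt ih R e (lookup slotTable x))

noncomputable def branchPair (ih : ℕ → Bool) (R e : ℕ) : Bool :=
  branchField ih R e (Nat.land (Nat.shiftRight R (Nat.mul 155 e)) low)

noncomputable def search (n : ℕ) : ℕ → Bool :=
  n.rec (fun _ => false) fun _ ih R => branchPair ih R (pick R)

/-! ### Correctness -/

theorem packed_testBit {w : ℕ} (l : List ℕ) (hl : ∀ x ∈ l, x < 2 ^ w) (e : ℕ) {f : ℕ}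
    (hf : f < w) : (packed w l).testBit (w * e + f) = (l.getD e 0).testBit f := by
  induction l generalizing e with
  | nil => simp [packed]
  | cons x l ih =>
    have hx := hl x (by simp)
    have : packed w (x :: l) = x ||| (packed w l <<< w) := rfl
    rw [this, Nat.testBit_or, Nat.testBit_shiftLeft]
    cases e with
    | zero =>
      have : ¬ (w ≤ w * 0 + f) := by omega
      simp [hf]
    | succ e =>
      have h1 : x.testBit (w * (e + 1) + f) = false :=
        Nat.testBit_lt_two_pow (lt_of_lt_of_le hx (Nat.pow_le_pow_right (by norm_num)
          (by rw [mul_add]; omega)))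
      have h2 : w * (e + 1) + f - w = w * e + f := by rw [mul_add]; omega
      have h3 : w ≤ w * (e + 1) + f := by rw [mul_add]; omega
      rw [h1, h2, ih (fun y hy => hl y (by simp [hy]))]
      simp [h3]

theorem packed_range_testBit {w n : ℕ} (g : ℕ → ℕ) (hg : ∀ e < n, g e < 2 ^ w) (e : ℕ) {f : ℕ}
    (hf : f < w) : (packed w ((List.range n).map g)).testBit (w * e + f) =
      (decide (e < n) && (g e).testBit f) := by
  rw [packed_testBit _ (by simpa using hg) e hf]
  by_cases he : e < n <;> simp [List.getD, he]

theorem bitAt_eq (R i : ℕ) : bitAt R i = R.testBit i := by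
  rw [Nat.testBit_eq_decide_div_mod_eq, bitAt, Bool.eq_iff_iff]
  change (Nat.beq ((R >>> i) &&& 1) 1 = true) ↔ _
  simp [Nat.shiftRight_eq_div_pow]

theorem ends_facts : ∀ e < 153, fstEnd e < sndEnd e ∧ sndEnd e < 18 := by decide +kernel

theorem exists_pair_aux : ∀ a < 18, ∀ b < 18, a < b →
    ∃ e < 153, fstEnd e = a ∧ sndEnd e = b := by decide +kernel

/-- The two points of the pair with number `e`. -/
def ends (e : ℕ) : Finset (Fin 18) := univ.filter fun i => incident e i

theorem incident_iff (e a : ℕ) : incident e a = true ↔ fstEnd e = a ∨ sndEnd e = a := by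
  unfold incident
  cases h : Nat.beq (fstEnd e) a with
  | true => simp [Nat.eq_of_beq_eq_true h]
  | false =>
    have := Nat.ne_of_beq_eq_false h
    simp [this, Nat.beq_eq]

theorem mem_ends (e : ℕ) (i : Fin 18) : i ∈ ends e ↔ incident e i = true := by simp [ends]

theorem ends_eq {e : ℕ} {a b : Fin 18} (ha : fstEnd e = a) (hb : sndEnd e = b) :
    ends e = {a, b} := by
  ext i
  simp only [mem_ends, incident_iff, ha, hb, mem_insert, mem_singleton, Fin.ext_iff]
  tauto

theorem exists_ends {a b : Fin 18} (hab : a ≠ b) : ∃ e < 153, ends e = {a, b} := by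
  rcases lt_or_gt_of_ne hab with h | h
  · obtain ⟨e, he, h1, h2⟩ := exists_pair_aux a a.2 b b.2 h
    exact ⟨e, he, ends_eq h1 h2⟩
  · obtain ⟨e, he, h1, h2⟩ := exists_pair_aux b b.2 a a.2 h
    exact ⟨e, he, by rw [ends_eq h1 h2, pair_comm]⟩

theorem exists_of_lt {e : ℕ} (he : e < 153) : ∃ a b : Fin 18, a ≠ b ∧ fstEnd e = a ∧
    sndEnd e = b ∧ ends e = {a, b} := by
  obtain ⟨h1, h2⟩ := ends_facts e he
  exact ⟨⟨_, h1.trans h2⟩, ⟨_, h2⟩, by simp [Fin.ext_iff, h1.ne], rfl, rfl, ends_eq rfl rfl⟩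

theorem packed_one_lt {n : ℕ} (g : ℕ → ℕ) (hg : ∀ e < n, g e < 2) :
    packed 1 ((List.range n).map g) < 2 ^ n := by
  apply Nat.lt_pow_two_of_testBit
  intro i hi
  have := packed_range_testBit (w := 1) (n := n) g (by simpa using hg) i (f := 0) (by norm_num)
  simp only [one_mul, add_zero] at this
  rw [this]
  simp [hi]

theorem star_lt (a : ℕ) : star a < 2 ^ 153 :=
  packed_one_lt _ fun e _ => by cases incident e a <;> simp

theorem star_testBit (a f : ℕ) (hf : f < 153) : (star a).testBit f = incident f a := by
  have := packed_range_testBit (w := 1) (n := 153) (fun e => cond (incident e a) 1 0)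
    (fun e _ => by cases incident e a <;> simp) f (f := 0) (by norm_num)
  simp only [one_mul, add_zero] at this
  rw [star, this]
  cases incident f a <;> simp [hf]

theorem pointMask_testBit (a e f : ℕ) (hf : f < 155) : (pointMask a).testBit (155 * e + f) =
    (decide (e < 153) && (cond (incident e a) high (star a)).testBit f) := by
  apply packed_range_testBit _ _ _ hf
  intro e _
  cases incident e a
  · exact (star_lt a).trans (by norm_num)
  · norm_num [high]

theorem pointMask_low (a : Fin 18) {e f : ℕ} (he : e < 153) (hf : f < 153) :
    (pointMask a).testBit (155 * e + f) = true ↔ a ∈ ends e ∪ ends f := by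
  rw [pointMask_testBit _ _ _ (by omega), mem_union, mem_ends, mem_ends]
  cases h : incident e a
  · simp [he, star_testBit _ _ hf]
  · have : high.testBit f = true := by
      rw [high, Nat.testBit_two_pow_sub_one]; simp; omega
    simp [he, this]

theorem pointMask_high (a : Fin 18) {e : ℕ} (he : e < 153) :
    (pointMask a).testBit (155 * e + 153) = true ↔ a ∈ ends e := by
  rw [pointMask_testBit _ _ _ (by omega), mem_ends]
  cases h : incident e a
  · simp [Nat.testBit_lt_two_pow (star_lt a)]
  · have : high.testBit 153 = true := by
      rw [high, Nat.testBit_two_pow_sub_one]; simp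
    simp [he, this]

theorem mask_eq (a : Fin 18) : mask a = pointMask a := by
  fin_cases a <;> rfl

theorem low_lt : low < 2 ^ 153 := Nat.sub_lt (by positivity) one_pos

theorem xor_star_lt (a b : ℕ) : Nat.xor low (Nat.lor (star a) (star b)) < 2 ^ 153 :=
  have h : star a ||| star b < 2 ^ 153 := Nat.or_lt_two_pow (star_lt a) (star_lt b)
  Nat.xor_lt_two_pow (x := low) (y := star a ||| star b) low_lt h

theorem candidates_testBit (e : ℕ) {f : ℕ} (hf : f < 153) :
    candidates.testBit (155 * e + f) = true ↔ e < 153 ∧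
      incident f (fstEnd e) = false ∧ incident f (sndEnd e) = false := by
  rw [candidates, packed_range_testBit _ _ _ (by omega)]
  · change ((decide (e < 153) &&
      (low ^^^ (star (fstEnd e) ||| star (sndEnd e))).testBit f) = true) ↔ _
    rw [Nat.testBit_xor, Nat.testBit_or, star_testBit _ _ hf, star_testBit _ _ hf, low,
      Nat.testBit_two_pow_sub_one]
    simp [hf]
  · intro e _
    exact (xor_star_lt _ _).trans (Nat.pow_lt_pow_right one_lt_two (by norm_num))

theorem candidates_top (e : ℕ) : candidates.testBit (155 * e + 153) = false := by
  rw [candidates, packed_range_testBit _ _ _ (by omega)]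
  · rw [Nat.testBit_lt_two_pow (i := 153)]
    · simp
    · exact xor_star_lt _ _
  · intro e _
    exact (xor_star_lt _ _).trans (Nat.pow_lt_pow_right one_lt_two (by norm_num))

theorem tops_testBit {e : ℕ} (h : tops.testBit (155 * e + 153) = true) : e < 153 := by
  have h1 : tops = ones <<< 153 := rfl
  rw [h1, Nat.testBit_shiftLeft, ones, Nat.add_sub_cancel] at h
  have := packed_range_testBit (w := 155) (n := 153) (fun _ => 1) (by norm_num) e (f := 0)
    (by norm_num)
  rw [add_zero] at this
  rw [this] at h
  simp at h
  exact h

/-- The state `R` does not exclude any quadruple of `B`, and the pairs marked as uncovered are in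
none of the blocks of `L`. -/
structure Consistent (B : Finset (Finset (Fin 18))) (L : List (Finset (Fin 18))) (R : ℕ) :
    Prop where
  quad : ∀ q ∈ B, q.card = 4 → ∀ e < 153, ∀ f < 153, ends e ∪ ends f = q →
    R.testBit (155 * e + f) = true
  uncovered : ∀ e, R.testBit (155 * e + 153) = true → e < 153 ∧ ∀ b ∈ L, ¬ ends e ⊆ b

variable {B : Finset (Finset (Fin 18))} {L : List (Finset (Fin 18))} {R : ℕ}

theorem start_eq : start = candidates ||| tops := by
  delta start
  -- Abstracting the huge closed term keeps `rfl` from evaluating it.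
  generalize candidates = c
  rfl

theorem consistent_start (B : Finset (Finset (Fin 18))) : Consistent B [] start where
  quad q _ hq4 e he f hf h := by
    rw [start_eq, Nat.testBit_or, Bool.or_eq_true]
    left
    rw [candidates_testBit _ hf]
    refine ⟨he, ?_⟩
    obtain ⟨a, b, hab, h1, h2, h3⟩ := exists_of_lt he
    obtain ⟨c, d, hcd, h4, h5, h6⟩ := exists_of_lt hf
    have hdisj : Disjoint (ends e) (ends f) := by
      rw [← card_union_eq_card_add_card, h, hq4, h3, h6, card_pair hab, card_pair hcd]
    constructor
    · rw [h1, ← Bool.not_eq_true, ← mem_ends]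
      exact Finset.disjoint_left.1 hdisj (by simp [h3])
    · rw [h2, ← Bool.not_eq_true, ← mem_ends]
      exact Finset.disjoint_left.1 hdisj (by simp [h3])
  uncovered e h := by
    rw [start_eq, Nat.testBit_or, candidates_top, Bool.false_or] at h
    exact ⟨tops_testBit h, by simp⟩

theorem atLeastTwo_testBit (p q r s i : ℕ) : (atLeastTwo p q r s).testBit i =
    (((p.testBit i || q.testBit i) && (r.testBit i || s.testBit i)) ||
      (p.testBit i && q.testBit i || r.testBit i && s.testBit i)) := by
  change (((p ||| q) &&& (r ||| s)) ||| ((p &&& q) ||| (r &&& s))).testBit i = _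
  simp

theorem placeQuad_testBit (R p q r s i : ℕ) : (placeQuad R p q r s).testBit i =
    (R.testBit i && (p.testBit i && q.testBit i && r.testBit i && s.testBit i ||
      !(atLeastTwo p q r s).testBit i)) := by
  change ((((R &&& p) &&& q) &&& (r &&& s)) ||| (R ^^^ (R &&& atLeastTwo p q r s))).testBit i = _
  simp only [Nat.testBit_or, Nat.testBit_and, Nat.testBit_xor]
  cases R.testBit i <;> cases p.testBit i <;> cases q.testBit i <;> cases r.testBit i <;>
    cases s.testBit i <;> simp

theorem placeTriangle_testBit (R p q r i : ℕ) : (placeTriangle R p q r).testBit i =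
    (R.testBit i && !(p.testBit i && q.testBit i || r.testBit i && (p.testBit i || q.testBit i))) := by
  change (R ^^^ (R &&& ((p &&& q) ||| (r &&& (p ||| q))))).testBit i = _
  simp only [Nat.testBit_or, Nat.testBit_and, Nat.testBit_xor]
  cases R.testBit i <;> simp

theorem forbidQuad_testBit (R p q r s i : ℕ) : (forbidQuad R p q r s).testBit i =
    (R.testBit i && !(p.testBit i && q.testBit i && r.testBit i && s.testBit i)) := by
  change (R ^^^ (((R &&& p) &&& q) &&& (r &&& s))).testBit i = _
  simp only [Nat.testBit_and, Nat.testBit_xor]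
  cases R.testBit i <;> simp [Bool.and_assoc]

theorem Consistent.placeTriangle (hB : IsCliqueDecomposition ⊤ {3, 4} B) (h : Consistent B L R)
    {a b c : Fin 18} (hb : ({a, b, c} : Finset (Fin 18)) ∈ B)
    (hcard : ({a, b, c} : Finset (Fin 18)).card = 3) :
    Consistent B ({a, b, c} :: L)
      (placeTriangle R (pointMask a) (pointMask b) (pointMask c)) := by
  obtain ⟨hab, hac, hbc⟩ : a ≠ b ∧ a ≠ c ∧ b ≠ c := by
    refine ⟨?_, ?_, ?_⟩ <;> rintro rfl <;> revert hcard <;> simp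
    · exact fun h => absurd h (card_le_two.trans_lt (by norm_num)).ne
    · exact fun h => absurd h (card_le_two.trans_lt (by norm_num)).ne
    · exact fun h => absurd h (card_le_two.trans_lt (by norm_num)).ne
  constructor
  · intro q hq hq4 e he f hf hef
    have hne : q ≠ {a, b, c} := fun h => by rw [h, hcard] at hq4; omega
    have key : ∀ x y, x ∈ ({a, b, c} : Finset (Fin 18)) → y ∈ ({a, b, c} : Finset (Fin 18)) →
        x ≠ y → x ∈ q → y ∈ q → False := fun x y hx hy hxy hxq hyq =>
      hne (hB.eq_of_mem hq hb hxy hxq hyq hx hy)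
    rw [placeTriangle_testBit, h.quad q hq hq4 e he f hf hef, Bool.true_and, Bool.not_eq_true',
      ← Bool.not_eq_true]
    simp only [Bool.or_eq_true, Bool.and_eq_true, pointMask_low _ he hf, hef]
    rintro (⟨h1, h2⟩ | ⟨h1, h2 | h2⟩)
    · exact key a b (by simp) (by simp) hab h1 h2
    · exact key a c (by simp) (by simp) hac h2 h1
    · exact key b c (by simp) (by simp) hbc h2 h1
  · intro e he
    rw [placeTriangle_testBit, Bool.and_eq_true] at he
    obtain ⟨he153, hL⟩ := h.uncovered e he.1
    refine ⟨he153, ?_⟩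
    rintro d (_ | ⟨_, hd⟩)
    · have h2 := he.2
      rw [Bool.not_eq_true', ← Bool.not_eq_true] at h2
      simp only [Bool.or_eq_true, Bool.and_eq_true, pointMask_high _ he153] at h2
      obtain ⟨x, y, hxy, -, -, hends⟩ := exists_of_lt he153
      rw [hends] at h2 ⊢
      intro hsub
      have hx := hsub (mem_insert_self x {y})
      have hy := hsub (mem_insert_of_mem (mem_singleton_self y))
      simp only [mem_insert, mem_singleton] at hx hy h2
      apply h2
      rcases hx with rfl | rfl | rfl <;> rcases hy with rfl | rfl | rfl <;> simp_all
    · exact hL d hd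

theorem Consistent.placeQuad (hB : IsCliqueDecomposition ⊤ {3, 4} B) (h : Consistent B L R)
    {a b c d : Fin 18} (hb : ({a, b, c, d} : Finset (Fin 18)) ∈ B)
    (hab : a ≠ b) (hac : a ≠ c) (had : a ≠ d) (hbc : b ≠ c) (hbd : b ≠ d) (hcd : c ≠ d) :
    Consistent B ({a, b, c, d} :: L)
      (placeQuad R (pointMask a) (pointMask b) (pointMask c) (pointMask d)) := by
  constructor
  · intro q hq hq4 e he f hf hef
    rw [placeQuad_testBit, h.quad q hq hq4 e he f hf hef, Bool.true_and, Bool.or_eq_true]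
    by_cases hqe : q = {a, b, c, d}
    · left
      simp only [Bool.and_eq_true, pointMask_low _ he hf, hef, hqe]
      simp
    · right
      have key : ∀ x y, x ∈ ({a, b, c, d} : Finset (Fin 18)) →
          y ∈ ({a, b, c, d} : Finset (Fin 18)) →
          x ≠ y → x ∈ q → y ∈ q → False := fun x y hx hy hxy hxq hyq =>
        hqe (hB.eq_of_mem hq hb hxy hxq hyq hx hy)
      rw [atLeastTwo_testBit, Bool.not_eq_true', ← Bool.not_eq_true]
      simp only [Bool.or_eq_true, Bool.and_eq_true, pointMask_low _ he hf, hef]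
      rintro (⟨h1 | h1, h2 | h2⟩ | ⟨h1, h2⟩ | ⟨h1, h2⟩)
      · exact key a c (by simp) (by simp) hac h1 h2
      · exact key a d (by simp) (by simp) had h1 h2
      · exact key b c (by simp) (by simp) hbc h1 h2
      · exact key b d (by simp) (by simp) hbd h1 h2
      · exact key a b (by simp) (by simp) hab h1 h2
      · exact key c d (by simp) (by simp) hcd h1 h2
  · intro e he
    rw [placeQuad_testBit, Bool.and_eq_true] at he
    obtain ⟨he153, hL⟩ := h.uncovered e he.1
    refine ⟨he153, ?_⟩
    rintro t (_ | ⟨_, hd⟩)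
    · have h2 := he.2
      obtain ⟨x, y, hxy, -, -, hends⟩ := exists_of_lt he153
      simp only [atLeastTwo_testBit, Bool.or_eq_true, Bool.and_eq_true, Bool.not_eq_true',
        ← Bool.not_eq_true, pointMask_high _ he153, hends, mem_insert, mem_singleton] at h2
      rw [hends]
      intro hsub
      have hx := hsub (mem_insert_self x {y})
      have hy := hsub (mem_insert_of_mem (mem_singleton_self y))
      simp only [mem_insert, mem_singleton] at hx hy
      rcases hx with rfl | rfl | rfl | rfl <;> rcases hy with rfl | rfl | rfl | rfl <;>
        simp_all <;> grind
    · exact hL t hd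

theorem Consistent.forbidQuad (h : Consistent B L R) {a b c d : Fin 18}
    (hb : ({a, b, c, d} : Finset (Fin 18)) ∉ B)
    (hcard : ({a, b, c, d} : Finset (Fin 18)).card = 4) :
    Consistent B L
      (forbidQuad R (pointMask a) (pointMask b) (pointMask c) (pointMask d)) := by
  constructor
  · intro q hq hq4 e he f hf hef
    rw [forbidQuad_testBit, h.quad q hq hq4 e he f hf hef, Bool.true_and, Bool.not_eq_true',
      ← Bool.not_eq_true]
    simp only [Bool.and_eq_true, pointMask_low _ he hf, hef]
    rintro ⟨⟨⟨h1, h2⟩, h3⟩, h4⟩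
    refine hb ?_
    rw [eq_of_subset_of_card_le (s := {a, b, c, d}) (t := q) ?_ (by omega)]
    · exact hq
    · simp [insert_subset_iff, *]
  · intro e he
    rw [forbidQuad_testBit, Bool.and_eq_true] at he
    exact h.uncovered e he.1

/-- Since the placed blocks include every triangle of `B`, an uncovered pair lies in a quadruple of
`B`, and the bit of that quadruple is still set; an empty field at an uncovered pair is therefore a
contradiction. Otherwise the quadruple branched on belongs to `B` or does not, and `Consistent`
survives accordingly. The list `L'` grows along the search, while `L` is the fixed list known to
contain the triangles. -/
theorem search_sound (hB : IsCliqueDecomposition ⊤ {3, 4} B)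
    (hL : ∀ b ∈ B, b.card = 3 → b ∈ L) (n : ℕ) :
    ∀ L' R, (∀ b ∈ L, b ∈ L') → Consistent B L' R → search n R = true → False := by
  induction n with
  | zero => intro L' R _ _ h; simp [search] at h
  | succ n ih =>
    intro L' R hLL h hs
    change branchPair (search n) R (pick R) = true at hs
    -- Nothing about the heuristic is needed: the argument works for any `e`, and below for any `f`.
    generalize pick R = e at hs
    unfold branchPair branchField at hs
    change cond (Nat.beq ((R >>> (155 * e)) &&& low) 0) (bitAt R (155 * e + 153)) _ = true at hs
    cases hx : Nat.beq ((R >>> (155 * e)) &&& low) 0 with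
    | true =>
      rw [hx, cond_true, bitAt_eq] at hs
      obtain ⟨he, hcov⟩ := h.uncovered e hs
      obtain ⟨x, y, hxy, -, -, hends⟩ := exists_of_lt he
      obtain ⟨q, hq, hxq, hyq⟩ := hB.exists_mem hxy
      have hsub : ends e ⊆ q := by rw [hends]; simp [insert_subset_iff, *]
      have hq4 : q.card = 4 := (hB.card_eq hq).resolve_left fun h3 =>
        hcov q (hLL q (hL q hq h3)) hsub
      have hdiff : (q \ ends e).card = 2 := by
        rw [card_sdiff_of_subset hsub, hq4, hends, card_pair hxy]
      obtain ⟨u, v, huv, hd⟩ := card_eq_two.1 hdiff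
      obtain ⟨f, hf, hfe⟩ := exists_ends huv
      -- The other two points of the quadruple form the pair `f`, whose bit in field `e` cannot have
      -- been cleared.
      have := h.quad q hq hq4 e he f hf (by rw [hfe, ← hd, union_sdiff_of_subset hsub])
      have h0 : ((R >>> (155 * e)) &&& low) = 0 := Nat.eq_of_beq_eq_true hx
      have h1 : ((R >>> (155 * e)) &&& low).testBit f = true := by
        rw [Nat.testBit_and, Nat.testBit_shiftRight, this, low, Nat.testBit_two_pow_sub_one]
        simpa using hf
      rw [h0] at h1
      simp at h1
    | false =>
      rw [hx, cond_false] at hs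
      generalize lookup slotTable _ = f at hs
      unfold branchAt at hs
      cases hv : valid e f with
      | false => rw [hv] at hs; simp at hs
      | true =>
        rw [hv, cond_true] at hs
        unfold valid at hv
        cases hf' : Nat.blt f 153 with
        | false => rw [hf'] at hv; simp at hv
        | true =>
          have hf : f < 153 := by simpa [Nat.blt_eq] using hf'
          rw [hf', cond_true, bitAt_eq] at hv
          obtain ⟨he, h1, h2⟩ := (candidates_testBit e hf).1 hv
          obtain ⟨a, b, hab, ha, hb, -⟩ := exists_of_lt he
          obtain ⟨c, d, hcd, hc, hd, hends⟩ := exists_of_lt hf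
          rw [ha, ← Bool.not_eq_true, ← mem_ends, hends] at h1
          rw [hb, ← Bool.not_eq_true, ← mem_ends, hends] at h2
          simp only [mem_insert, mem_singleton, not_or] at h1 h2
          rw [ha, hb, hc, hd, mask_eq, mask_eq, mask_eq, mask_eq] at hs
          unfold branch at hs
          cases hp : search n (PairSearch.placeQuad R (pointMask a) (pointMask b) (pointMask c)
              (pointMask d)) with
          | false => rw [hp] at hs; simp at hs
          | true =>
            rw [hp, cond_true] at hs
            by_cases hmem : ({a, b, c, d} : Finset (Fin 18)) ∈ B
            · exact ih _ _ (fun b hb => List.mem_cons_of_mem _ (hLL b hb))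
                (h.placeQuad hB hmem hab h1.1 h1.2 h2.1 h2.2 hcd) hp
            · refine ih _ _ hLL (h.forbidQuad hmem ?_) hs
              rw [card_insert_of_notMem, card_insert_of_notMem, card_pair hcd] <;> simp [*]

end PairSearch

/-! ### Case distinctions on blocks, up to symmetry. -/

/-- The data of a case: the points `0, …, d - 1` lie in four triangles and the others in one; there
are `t` triangles; `τ` and `ρ` list the numbers of triangles and quadruples by their numbers of
points below `d`. -/
structure Spec where
  d : ℕ
  t : ℕ
  τ : List ℕ
  ρ : List ℕ

/-- The number of points of `b` below `d`. -/
def specials (d : ℕ) (b : Finset (Fin 18)) : ℕ := (b.filter fun x : Fin 18 => (x : ℕ) < d).card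

/-- `B` is a decomposition of the kind that `sp` describes. -/
structure IsModel (sp : Spec) (B : Finset (Finset (Fin 18))) : Prop where
  isDecomposition : IsCliqueDecomposition (⊤ : SimpleGraph (Fin 18)) {3, 4} B
  card_triangles : (B.filter fun b => b.card = 3).card = sp.t
  degree : ∀ x : Fin 18, (B.filter fun b => b.card = 3 ∧ x ∈ b).card = if (x : ℕ) < sp.d then 4 else 1
  triangles : ∀ j, (B.filter fun b => b.card = 3 ∧ specials sp.d b = j).card = sp.τ.getD j 0
  quads : ∀ j, (B.filter fun b => b.card = 4 ∧ specials sp.d b = j).card = sp.ρ.getD j 0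

namespace BlockSearch

/-! Case analysis on blocks up to symmetry. Sets of points are bit masks. -/

/-- Triangles, quadruples, and pairs that are covered by some quadruple. -/
structure State where
  T : List ℕ
  Q : List ℕ
  P : List ℕ

/-- A `split` only decides whether the pair lies in a triangle; if not, the pair goes to `P` and the
choice of its quadruple is postponed. `inner` asks for a further triangle consisting of special
points, `mixed` for a further quadruple with exactly two special points. -/
inductive Goal where
  | pair (u v : ℕ)
  | split (u v : ℕ)
  | triangle (u : ℕ)
  | inner
  | mixed

/-- Trees of case distinctions. -/
inductive Cert where
  | leaf
  | known
  | done
  | node (g : Goal) (gens : List (List (ℕ × ℕ))) (kids : Cert)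
  | kid (m : ℕ) (sub rest : Cert)

noncomputable def anyOf {α : Type} (p : α → Bool) (l : List α) : Bool :=
  l.rec false fun x _ r => cond (p x) true r

noncomputable def allOf {α : Type} (p : α → Bool) (l : List α) : Bool :=
  l.rec true fun x _ r => cond (p x) r false

noncomputable def filterBy {α : Type} (p : α → Bool) (l : List α) : List α :=
  l.rec [] fun x _ r => cond (p x) (x :: r) r

noncomputable def mapBy {α β : Type} (f : α → β) (l : List α) : List β :=
  l.rec [] fun x _ r => f x :: r

noncomputable def append {α : Type} (l l' : List α) : List α :=
  l.rec l' fun x _ r => x :: r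

def two (x : ℕ) : Bool := cond (Nat.beq (Nat.land x (Nat.sub x 1)) 0) false true

noncomputable def clash (m : ℕ) (l : List ℕ) : Bool := anyOf (fun b => two (Nat.land m b)) l

def bit (m i : ℕ) : ℕ := Nat.land (Nat.shiftRight m i) 1

noncomputable def spec (d m : ℕ) : ℕ := d.rec 0 fun i r => Nat.add (bit m i) r

noncomputable def deg (x : ℕ) (l : List ℕ) : ℕ := l.rec 0 fun m _ r => Nat.add (bit m x) r

noncomputable def classSize (d j : ℕ) (l : List ℕ) : ℕ :=
  l.rec 0 fun m _ r => cond (Nat.beq (spec d m) j) (Nat.add r 1) r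

def quota (d x : ℕ) : ℕ := cond (Nat.blt x d) 4 1

/-- The points that are in as many triangles as they can be. -/
noncomputable def full (d : ℕ) (l : List ℕ) : ℕ :=
  Nat.rec 0 (fun x r => cond (Nat.ble (quota d x) (deg x l)) (Nat.lor (Nat.pow 2 x) r) r) 18

def andNot (a b : Bool) : Bool := cond a false b

/-- A pair in `P` is covered by a quadruple, so no triangle may contain it. The argument `s` is the
set of points whose triangles are all placed. -/
noncomputable def okTriangle (sp : Spec) (st : State) (s m : ℕ) : Bool :=
  andNot (clash m st.T) (andNot (clash m st.Q) (andNot (clash m st.P)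
    (cond (Nat.beq (Nat.land m s) 0)
      (Nat.blt (classSize sp.d (spec sp.d m) st.T) (PairSearch.nth sp.τ (spec sp.d m))) false)))

/-- `P` is not consulted, because the new quadruple may be the one promised there. -/
noncomputable def okQuad (sp : Spec) (st : State) (m : ℕ) : Bool :=
  andNot (clash m st.T) (andNot (clash m st.Q)
    (Nat.blt (classSize sp.d (spec sp.d m) st.Q) (PairSearch.nth sp.ρ (spec sp.d m))))

def pairMask (u v : ℕ) : ℕ := Nat.lor (Nat.pow 2 u) (Nat.pow 2 v)

noncomputable def free (st : State) (u v : ℕ) : Bool :=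
  andNot (clash (pairMask u v) st.T) (andNot (clash (pairMask u v) st.Q) true)

noncomputable def neighbours (st : State) (u : ℕ) (l : List ℕ) : List ℕ :=
  filterBy (fun x => andNot (Nat.beq u x) (free st u x)) l

noncomputable def addOne (m : ℕ) (l : List ℕ) : List ℕ := mapBy (fun x => Nat.lor m (Nat.pow 2 x)) l

noncomputable def addTwo (m : ℕ) (l : List ℕ) : List ℕ :=
  l.rec [] fun x l r => append (addOne (Nat.lor m (Nat.pow 2 x)) l) r

noncomputable def addThree (m : ℕ) (l : List ℕ) : List ℕ :=
  l.rec [] fun x l r => append (addTwo (Nat.lor m (Nat.pow 2 x)) l) r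

noncomputable def addMixed (l l' : List ℕ) : List ℕ :=
  (addTwo 0 l).rec [] fun m _ r => append (addTwo m l') r

def points : List ℕ := List.range 18

noncomputable def triangleOptions (sp : Spec) (st : State) (l : List ℕ) : List (ℕ × ℕ) :=
  mapBy (fun m => (3, m)) (filterBy (okTriangle sp st (full sp.d st.T)) l)

noncomputable def quadOptions (sp : Spec) (st : State) (l : List ℕ) : List (ℕ × ℕ) :=
  mapBy (fun m => (4, m)) (filterBy (okQuad sp st) l)

/-- The first component is the code read by `extend`: 3 for a triangle, 4 for a quadruple, 2 for a
pair to be put into `P`. -/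
noncomputable def options (sp : Spec) (st : State) (g : Goal) : List (ℕ × ℕ) :=
  g.rec
    (fun u v => append
      (triangleOptions sp st (addOne (pairMask u v) (neighbours st u (neighbours st v points))))
      (quadOptions sp st (addTwo (pairMask u v) (neighbours st u (neighbours st v points)))))
    (fun u v => (2, pairMask u v) ::
      triangleOptions sp st (addOne (pairMask u v) (neighbours st u (neighbours st v points))))
    (fun u => triangleOptions sp st (addTwo (Nat.pow 2 u) (neighbours st u points)))
    (triangleOptions sp st (addThree 0 (List.range sp.d)))
    (quadOptions sp st (addMixed (List.range sp.d)
      (filterBy (fun x => Nat.ble sp.d x) points)))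

noncomputable def applicable (sp : Spec) (st : State) (g : Goal) : Bool :=
  g.rec
    (fun u v => cond (Nat.blt u v) (cond (Nat.blt v 18) (free st u v) false) false)
    (fun u v => cond (Nat.blt u v) (cond (Nat.blt v 18) (free st u v) false) false)
    (fun u => cond (Nat.blt u 18) (Nat.blt (deg u st.T) (quota sp.d u)) false)
    (Nat.blt (classSize sp.d 3 st.T) (PairSearch.nth sp.τ 3))
    (Nat.blt (classSize sp.d 2 st.Q) (PairSearch.nth sp.ρ 2))

def swapMask (a b m : ℕ) : ℕ :=
  cond (Nat.beq (bit m a) (bit m b)) m (Nat.xor m (pairMask a b))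

noncomputable def act (g : List (ℕ × ℕ)) : ℕ → ℕ :=
  g.rec (fun m => m) fun s _ ih m => ih (swapMask s.1 s.2 m)

def validSwap (d : ℕ) (s : ℕ × ℕ) : Bool :=
  cond (Nat.blt s.1 18) (cond (Nat.blt s.2 18)
    (cond (Nat.blt s.1 d) (Nat.blt s.2 d) (Nat.ble d s.2)) false) false

noncomputable def subset (l l' : List ℕ) : Bool := allOf (fun x => anyOf (Nat.beq x) l') l

/-- It is enough that every set of the state is the image of a set of the state: the image of a
decomposition containing the state then contains the state again. -/
noncomputable def validGen (d : ℕ) (st : State) (g : List (ℕ × ℕ)) : Bool :=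
  cond (allOf (validSwap d) g) (cond (subset st.T (mapBy (act g) st.T))
    (cond (subset st.Q (mapBy (act g) st.Q)) (subset st.P (mapBy (act g) st.P)) false) false) false

noncomputable def memOption (k m : ℕ) (l : List (ℕ × ℕ)) : Bool :=
  anyOf (fun o => cond (Nat.beq m o.2) (Nat.beq k o.1) false) l

/-- An option may be dropped if a single generator moves it to an option with smaller mask. Masks
decrease, so the descent ends at a survivor, and neither the group nor its orbits have to be
computed. Surviving equivalent options cost time only. -/
noncomputable def reducible (gens : List (List (ℕ × ℕ))) (l : List (ℕ × ℕ)) (o : ℕ × ℕ) : Bool :=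
  anyOf (fun g => cond (Nat.blt (act g o.2) o.2) (memOption o.1 (act g o.2) l) false) gens

noncomputable def survivors (gens : List (List (ℕ × ℕ))) (l : List (ℕ × ℕ)) : List (ℕ × ℕ) :=
  filterBy (fun o => andNot (reducible gens l o) true) l

def extend (st : State) (k m : ℕ) : State :=
  cond (Nat.beq k 3) ⟨m :: st.T, st.Q, st.P⟩
    (cond (Nat.beq k 4) ⟨st.T, m :: st.Q, st.P⟩ ⟨st.T, st.Q, m :: st.P⟩)

noncomputable def bitsOf (m : ℕ) : List ℕ := filterBy (fun i => Nat.beq (bit m i) 1) points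

noncomputable def placeTriangles (l : List ℕ) : ℕ :=
  l.rec PairSearch.start fun m _ R => PairSearch.placeTriangle R
    (PairSearch.mask (PairSearch.nth (bitsOf m) 0)) (PairSearch.mask (PairSearch.nth (bitsOf m) 1))
    (PairSearch.mask (PairSearch.nth (bitsOf m) 2))

noncomputable def placeQuads (R : ℕ) (l : List ℕ) : ℕ :=
  l.rec R fun m _ R => PairSearch.placeQuad R
    (PairSearch.mask (PairSearch.nth (bitsOf m) 0)) (PairSearch.mask (PairSearch.nth (bitsOf m) 1))
    (PairSearch.mask (PairSearch.nth (bitsOf m) 2)) (PairSearch.mask (PairSearch.nth (bitsOf m) 3))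

/-- Only a state with all its triangles placed may be handed to the exact-cover search. The number
10000 is fuel; running out of it counts as failure. The pairs in `P` are not needed here. -/
noncomputable def leafCheck (sp : Spec) (st : State) : Bool :=
  cond (Nat.beq st.T.length sp.t)
    (PairSearch.search 10000 (placeQuads (placeTriangles st.T) st.Q)) false

noncomputable def sameList (l : List ℕ) : List ℕ → Bool :=
  l.rec (fun l' => l'.rec true fun _ _ _ => false) fun x _ ih l' =>
    l'.rec false fun y t _ => cond (Nat.beq x y) (ih t) false

noncomputable def sameState (st st' : State) : Bool :=
  cond (sameList st.T st'.T) (cond (sameList st.Q st'.Q) (sameList st.P st'.P) false) false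

/-- Checks a case distinction (if `o = none`) or a list of its branches, where the states `hyps` need
no further treatment. -/
noncomputable def check (sp : Spec) (hyps : List State) (c : Cert) :
    State → Option (List (ℕ × ℕ)) → Bool :=
  c.rec
    (fun st o => o.rec (leafCheck sp st) fun _ => false)
    (fun st o => o.rec (anyOf (sameState st) hyps) fun _ => false)
    (fun _ o => o.rec false fun l => l.rec true fun _ _ _ => false)
    (fun g gens _ ih st o => o.rec
      (cond (applicable sp st g) (cond (allOf (validGen sp.d st) gens)
        (ih st (some (survivors gens (options sp st g)))) false) false) fun _ => false)
    (fun m _ _ ih ih' st o => o.rec false fun l => l.rec false fun x l _ =>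
      cond (Nat.beq m x.2) (cond (ih (extend st x.1 m) none) (ih' st (some l)) false) false)

end BlockSearch

namespace BlockSearch

/-! ### Correctness -/

theorem anyOf_eq {α : Type} (p : α → Bool) (l : List α) : anyOf p l = l.any p := by
  induction l with
  | nil => rfl
  | cons x l ih =>
    change cond (p x) true (anyOf p l) = _
    rw [ih]; cases h : p x <;> simp [h]

theorem allOf_eq {α : Type} (p : α → Bool) (l : List α) : allOf p l = l.all p := by
  induction l with
  | nil => rfl
  | cons x l ih =>
    change cond (p x) (allOf p l) false = _
    rw [ih]; cases h : p x <;> simp [h]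

theorem filterBy_eq {α : Type} (p : α → Bool) (l : List α) : filterBy p l = l.filter p := by
  induction l with
  | nil => rfl
  | cons x l ih =>
    change cond (p x) (x :: filterBy p l) (filterBy p l) = _
    rw [ih]; cases h : p x <;> simp [h]

theorem mapBy_eq {α β : Type} (f : α → β) (l : List α) : mapBy f l = l.map f := by
  induction l with
  | nil => rfl
  | cons x l ih =>
    change f x :: mapBy f l = _
    rw [ih]; rfl

theorem append_eq {α : Type} (l l' : List α) : append l l' = l ++ l' := by
  induction l with
  | nil => rfl
  | cons x l ih =>
    change x :: append l l' = _
    rw [ih]; rfl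

theorem sameList_eq {l l' : List ℕ} (h : sameList l l' = true) : l = l' := by
  induction l generalizing l' with
  | nil => cases l' with
    | nil => rfl
    | cons y t => cases h
  | cons x l ih => cases l' with
    | nil => cases h
    | cons y t =>
      change cond (Nat.beq x y) (sameList l t) false = true at h
      cases hxy : Nat.beq x y with
      | false => rw [hxy] at h; cases h
      | true =>
        rw [hxy] at h
        rw [Nat.eq_of_beq_eq_true hxy, ih h]

theorem sameState_eq {s s' : State} (h : sameState s s' = true) : s = s' := by
  unfold sameState at h
  cases h1 : sameList s.T s'.T with
  | false => rw [h1] at h; cases h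
  | true =>
    cases h2 : sameList s.Q s'.Q with
    | false => rw [h1, h2] at h; cases h
    | true =>
      rw [h1, h2] at h
      have h3 : sameList s.P s'.P = true := h
      cases s; cases s'
      rw [State.mk.injEq]
      exact ⟨sameList_eq h1, sameList_eq h2, sameList_eq h3⟩

/-- The set with the bit mask `m`. -/
def pts (m : ℕ) : Finset (Fin 18) := univ.filter fun i => m.testBit i

theorem mem_pts {m : ℕ} {i : Fin 18} : i ∈ pts m ↔ m.testBit i = true := by simp [pts]

theorem pts_lor (a b : ℕ) : pts (Nat.lor a b) = pts a ∪ pts b := by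
  ext i
  simp [mem_pts]

theorem pts_pow (x : Fin 18) : pts (Nat.pow 2 x) = {x} := by
  ext i
  simp [mem_pts, Nat.testBit_two_pow, Fin.ext_iff, eq_comm]

theorem pts_zero : pts 0 = ∅ := by ext i; simp [mem_pts]

theorem bit_eq (m i : ℕ) : bit m i = (m.testBit i).toNat := by
  rw [Nat.toNat_testBit]
  change (m >>> i) &&& 1 = _
  simp [Nat.shiftRight_eq_div_pow]

theorem deg_eq (x : Fin 18) (l : List ℕ) : deg x l = (l.map pts).countP fun b => x ∈ b := by
  induction l with
  | nil => rfl
  | cons m l ih =>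
    change bit m x + deg x l = _
    rw [ih, bit_eq, List.map_cons, List.countP_cons, add_comm]
    cases h : m.testBit x <;> simp [h, mem_pts]

theorem spec_eq (m : ℕ) {d : ℕ} (hd : d ≤ 18) : spec d m = specials d (pts m) := by
  induction d with
  | zero => simp [specials]; rfl
  | succ d ih =>
    change bit m d + spec d m = _
    rw [ih (by omega), bit_eq]
    unfold specials
    have key : ((pts m).filter fun x : Fin 18 => (x : ℕ) < d + 1) =
        ((pts m).filter fun x : Fin 18 => (x : ℕ) < d) ∪
          ((pts m).filter fun x : Fin 18 => x = ⟨d, by omega⟩) := by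
      ext i; simp only [mem_filter, mem_union, Fin.ext_iff, Nat.lt_succ_iff_lt_or_eq]; tauto
    rw [key, card_union_of_disjoint, add_comm, filter_eq']
    · congr 1
      simp only [mem_pts]
      cases h : m.testBit d <;> simp
    · rw [Finset.disjoint_left]
      intro i hi hi'
      simp only [mem_filter, Fin.ext_iff] at hi hi'
      omega

theorem classSize_eq {d : ℕ} (hd : d ≤ 18) (j : ℕ) (l : List ℕ) :
    classSize d j l = (l.map pts).countP fun b => specials d b = j := by
  induction l with
  | nil => rfl
  | cons m l ih =>
    change cond (Nat.beq (spec d m) j) (classSize d j l + 1) (classSize d j l) = _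
    rw [ih, spec_eq m hd, List.map_cons, List.countP_cons]
    by_cases h : specials d (pts m) = j
    · simp [h]
    · have h' : Nat.beq (specials d (pts m)) j = false := by
        rwa [← Bool.not_eq_true, Nat.beq_eq]
      simp [h, h']

theorem nth_eq (l : List ℕ) (n : ℕ) : PairSearch.nth l n = l.getD n 0 := by
  induction l generalizing n with
  | nil => cases n <;> rfl
  | cons x l ih => cases n with
    | zero => rfl
    | succ n => exact (ih n).trans (by simp)

theorem two_eq_true_iff {x : ℕ} :
    two x = true ↔ ∃ i j, i ≠ j ∧ x.testBit i = true ∧ x.testBit j = true := by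
  have h1 : two x = true ↔ x &&& (x - 1) ≠ 0 := by
    unfold two
    change cond (Nat.beq (x &&& (x - 1)) 0) false true = true ↔ _
    cases h : Nat.beq (x &&& (x - 1)) 0 with
    | true => simp [Nat.eq_of_beq_eq_true h]
    | false => simp [Nat.ne_of_beq_eq_false h]
  rw [h1]
  by_cases hx : x = 0
  · simp [hx]
  rw [Ne, Nat.and_sub_one_eq_zero_iff_isPowerOfTwo hx]
  constructor
  · intro h
    by_contra hc
    push Not at hc
    obtain ⟨i, hi⟩ := Nat.exists_testBit_of_ne_zero hx
    refine h ⟨i, Nat.eq_of_testBit_eq fun j => ?_⟩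
    rw [Nat.testBit_two_pow]
    by_cases hij : i = j
    · simp [← hij, hi]
    · simpa [hij] using hc i j hij hi
  · rintro ⟨i, j, hij, hi, hj⟩ ⟨k, rfl⟩
    simp only [Nat.testBit_two_pow, decide_eq_true_eq] at hi hj
    omega

theorem clash_eq_true_iff {m : ℕ} (hm : m < 2 ^ 18) (l : List ℕ) :
    clash m l = true ↔ ∃ b ∈ l, ∃ i j, i ≠ j ∧ i ∈ pts m ∧ j ∈ pts m ∧ i ∈ pts b ∧ j ∈ pts b := by
  have key : ∀ i, m.testBit i = true → i < 18 := fun i h => by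
    by_contra hc
    rw [Nat.testBit_lt_two_pow (hm.trans_le (Nat.pow_le_pow_right (by norm_num) (by omega)))] at h
    cases h
  rw [clash, anyOf_eq, List.any_eq_true]
  refine exists_congr fun b => and_congr_right fun _ => ?_
  rw [two_eq_true_iff]
  have h : Nat.land m b = m &&& b := rfl
  simp only [h, Nat.testBit_and, Bool.and_eq_true, mem_pts]
  constructor
  · rintro ⟨i, j, hij, ⟨h1, h2⟩, h3, h4⟩
    exact ⟨⟨i, key i h1⟩, ⟨j, key j h3⟩, by simpa [Fin.ext_iff] using hij, h1, h3, h2, h4⟩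
  · rintro ⟨i, j, hij, h1, h2, h3, h4⟩
    exact ⟨i, j, by simpa [Fin.ext_iff] using hij, ⟨h1, h3⟩, h2, h4⟩

theorem andNot_eq_true_iff {a b : Bool} : andNot a b = true ↔ a = false ∧ b = true := by
  cases a <;> cases b <;> decide

theorem pow_lt (x : Fin 18) : Nat.pow 2 x < 2 ^ 18 := Nat.pow_lt_pow_right one_lt_two x.2

theorem lor_lt {a b : ℕ} (ha : a < 2 ^ 18) (hb : b < 2 ^ 18) : Nat.lor a b < 2 ^ 18 :=
  Nat.or_lt_two_pow ha hb

variable {sp : Spec} {B : Finset (Finset (Fin 18))} {st : State}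

/-- The blocks of the state `st` occur in `B`. -/
structure Holds (B : Finset (Finset (Fin 18))) (st : State) : Prop where
  T_mem : ∀ m ∈ st.T, pts m ∈ B ∧ (pts m).card = 3
  T_nodup : (st.T.map pts).Nodup
  Q_mem : ∀ m ∈ st.Q, pts m ∈ B ∧ (pts m).card = 4
  Q_nodup : (st.Q.map pts).Nodup
  P_mem : ∀ m ∈ st.P, ∃ q ∈ B, q.card = 4 ∧ pts m ⊆ q

/-- The set `m` can be added to the state `st`. -/
def Fits (B : Finset (Finset (Fin 18))) (st : State) (o : ℕ × ℕ) : Prop :=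
  (o.1 = 3 ∧ pts o.2 ∈ B ∧ (pts o.2).card = 3 ∧ pts o.2 ∉ st.T.map pts) ∨
  (o.1 = 4 ∧ pts o.2 ∈ B ∧ (pts o.2).card = 4 ∧ pts o.2 ∉ st.Q.map pts) ∨
  (o.1 = 2 ∧ ∃ q ∈ B, q.card = 4 ∧ pts o.2 ⊆ q)

theorem Holds.extend (h : Holds B st) {k m : ℕ} (hf : Fits B st (k, m)) :
    Holds B (extend st k m) := by
  obtain ⟨h1, h2, h3, h4, h5⟩ := h
  rcases hf with ⟨hk, hf, hc, hn⟩ | ⟨hk, hf, hc, hn⟩ | ⟨hk, hf⟩ <;> dsimp only at hk hf <;> subst hk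
  · exact ⟨List.forall_mem_cons.2 ⟨⟨hf, hc⟩, h1⟩, List.nodup_cons.2 ⟨hn, h2⟩, h3, h4, h5⟩
  · exact ⟨h1, h2, List.forall_mem_cons.2 ⟨⟨hf, hc⟩, h3⟩, List.nodup_cons.2 ⟨hn, h4⟩, h5⟩
  · exact ⟨h1, h2, h3, h4, List.forall_mem_cons.2 ⟨hf, h5⟩⟩

/-- No decomposition contains the blocks of the state `st`. -/
def Refuted (sp : Spec) (st : State) : Prop := ∀ B, IsModel sp B → ¬ Holds B st

theorem clash_eq_false {B : Finset (Finset (Fin 18))}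
    (hB : IsCliqueDecomposition (⊤ : SimpleGraph (Fin 18)) {3, 4} B) {c : Finset (Fin 18)}
    (hc : c ∈ B) {m : ℕ} (hm : m < 2 ^ 18) (hmc : pts m ⊆ c) {l : List ℕ}
    (hl : ∀ b ∈ l, ∃ q ∈ B, q ≠ c ∧ pts b ⊆ q) : clash m l = false := by
  rw [← Bool.not_eq_true, clash_eq_true_iff hm]
  rintro ⟨b, hb, i, j, hij, h1, h2, h3, h4⟩
  obtain ⟨q, hq, hne, hsub⟩ := hl b hb
  exact hne (hB.eq_of_mem hq hc hij (hsub h3) (hsub h4) (hmc h1) (hmc h2))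

theorem pairMask_lt (u v : Fin 18) : pairMask u v < 2 ^ 18 := lor_lt (pow_lt u) (pow_lt v)

theorem pts_pairMask (u v : Fin 18) : pts (pairMask u v) = {u, v} := by
  rw [pairMask, pts_lor, pts_pow, pts_pow]; rfl

theorem free_eq_true (hB : IsCliqueDecomposition (⊤ : SimpleGraph (Fin 18)) {3, 4} B)
    (h : Holds B st) {c : Finset (Fin 18)} (hc : c ∈ B) (hT : c ∉ st.T.map pts)
    (hQ : c ∉ st.Q.map pts) {u v : Fin 18} (hu : u ∈ c) (hv : v ∈ c) : free st u v = true := by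
  have hsub : pts (pairMask u v) ⊆ c := by
    rw [pts_pairMask]; simp [insert_subset_iff, hu, hv]
  rw [free, andNot_eq_true_iff, andNot_eq_true_iff]
  refine ⟨clash_eq_false hB hc (pairMask_lt u v) hsub fun b hb => ⟨_, (h.T_mem b hb).1, ?_, subset_rfl⟩,
    clash_eq_false hB hc (pairMask_lt u v) hsub fun b hb => ⟨_, (h.Q_mem b hb).1, ?_, subset_rfl⟩, rfl⟩
  · exact fun he => hT (he ▸ List.mem_map_of_mem hb)
  · exact fun he => hQ (he ▸ List.mem_map_of_mem hb)

theorem notMem_of_free {u v : Fin 18} (huv : u ≠ v) (h : free st u v = true)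
    {c : Finset (Fin 18)} (hu : u ∈ c) (hv : v ∈ c) : c ∉ st.T.map pts ∧ c ∉ st.Q.map pts := by
  rw [free, andNot_eq_true_iff, andNot_eq_true_iff] at h
  obtain ⟨h1, h2, -⟩ := h
  rw [← Bool.not_eq_true, clash_eq_true_iff (pairMask_lt u v), pts_pairMask] at h1 h2
  constructor <;> intro hc <;> obtain ⟨b, hb, rfl⟩ := List.mem_map.1 hc
  · exact h1 ⟨b, hb, u, v, huv, by simp, by simp, hu, hv⟩
  · exact h2 ⟨b, hb, u, v, huv, by simp, by simp, hu, hv⟩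

/-- A block of `B` not yet placed shows that the placed blocks do not exhaust its class. This
justifies both kinds of bound in the tests on options: triangles through a point, and blocks with a
given number of special points. -/
theorem countP_succ_le {α : Type} [DecidableEq α] {F : Finset α} {l : List α} {c : α}
    (hn : l.Nodup) (hl : ∀ b ∈ l, b ∈ F) (hc : c ∈ F) (hcl : c ∉ l) (p : α → Prop)
    [DecidablePred p] (hp : p c) : l.countP p + 1 ≤ (F.filter p).card := by
  have h1 : ((c :: l).filter p).toFinset ⊆ F.filter p := by
    intro x hx
    simp only [List.mem_toFinset, List.mem_filter, List.mem_cons, decide_eq_true_eq] at hx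
    rw [mem_filter]
    exact ⟨hx.1.elim (fun h => h ▸ hc) (hl x), hx.2⟩
  have h2 := card_le_card h1
  rw [List.toFinset_card_of_nodup ((List.nodup_cons.2 ⟨hcl, hn⟩).filter _),
    ← List.countP_eq_length_filter, List.countP_cons] at h2
  simpa [hp] using h2

end BlockSearch

namespace BlockSearch

variable {sp : Spec} {B : Finset (Finset (Fin 18))} {st : State}

/-! ### Symmetries -/

/-- If the two bits agree, the transposition changes nothing; if they differ, exchanging them is
flipping both. -/
theorem testBit_swapMask (a b : Fin 18) (m : ℕ) (i : Fin 18) :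
    (swapMask a b m).testBit i = m.testBit (Equiv.swap a b i : Fin 18) := by
  have hx : ∀ i : Fin 18, (m ^^^ pairMask a b).testBit i =
      (m.testBit i ^^ (decide (i = a) || decide (i = b))) := fun i => by
    have h : pairMask a b = 2 ^ (a : ℕ) ||| 2 ^ (b : ℕ) := rfl
    rw [h, Nat.testBit_xor, Nat.testBit_or, Nat.testBit_two_pow, Nat.testBit_two_pow]
    simp only [Fin.ext_iff, eq_comm]
  have hbeq : ∀ p q : Bool, Nat.beq p.toNat q.toNat = (p == q) := by decide
  change (cond _ m (m ^^^ pairMask a b)).testBit i = _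
  rw [bit_eq, bit_eq, hbeq]
  rcases eq_or_ne a b with rfl | hab
  · cases m.testBit a <;> simp
  · by_cases hia : i = a
    · subst hia
      rw [Equiv.swap_apply_left]
      cases h1 : m.testBit i <;> cases h2 : m.testBit b <;> simp [hx, h1]
    · by_cases hib : i = b
      · subst hib
        rw [Equiv.swap_apply_right]
        cases h1 : m.testBit a <;> cases h2 : m.testBit i <;> simp [hx, h2]
      · rw [Equiv.swap_apply_of_ne_of_ne hia hib]
        cases h1 : m.testBit a <;> cases h2 : m.testBit b <;> simp [hx, hia, hib]

theorem pts_swapMask (a b : Fin 18) (m : ℕ) :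
    pts (swapMask a b m) = (pts m).map (Equiv.swap a b).toEmbedding := by
  ext i
  rw [mem_map_equiv, mem_pts, mem_pts, testBit_swapMask, Equiv.symm_swap]

theorem exists_perm_of_validSwap {d : ℕ} (g : List (ℕ × ℕ)) (h : allOf (validSwap d) g = true) :
    ∃ σ : Equiv.Perm (Fin 18), (∀ x, ((σ x : Fin 18) : ℕ) < d ↔ (x : ℕ) < d) ∧
      ∀ m, pts (act g m) = (pts m).map σ.toEmbedding := by
  rw [allOf_eq] at h
  induction g with
  | nil => exact ⟨Equiv.refl _, by simp, fun m => by simp [act, Equiv.refl_toEmbedding]⟩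
  | cons s g ih =>
    rw [List.all_cons, Bool.and_eq_true] at h
    obtain ⟨σ, h1, h2⟩ := ih h.2
    obtain ⟨a, b⟩ := s
    have hs := h.1
    simp only [validSwap] at hs
    cases ha : Nat.blt a 18 with
    | false => rw [ha] at hs; cases hs
    | true =>
    cases hb : Nat.blt b 18 with
    | false => rw [ha, hb] at hs; cases hs
    | true =>
    rw [ha, hb, cond_true, cond_true] at hs
    rw [Nat.blt_eq] at ha hb
    have hab : a < d ↔ b < d := by
      cases hd : Nat.blt a d with
      | true =>
        rw [hd, cond_true, Nat.blt_eq] at hs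
        rw [Nat.blt_eq] at hd
        tauto
      | false =>
        rw [hd, cond_false, Nat.ble_eq] at hs
        rw [← Bool.not_eq_true, Nat.blt_eq] at hd
        omega
    refine ⟨(Equiv.swap ⟨a, ha⟩ ⟨b, hb⟩).trans σ, fun x => ?_, fun m => ?_⟩
    · rw [Equiv.trans_apply, h1]
      by_cases hxa : x = ⟨a, ha⟩
      · rw [hxa, Equiv.swap_apply_left]; exact hab.symm
      · by_cases hxb : x = ⟨b, hb⟩
        · rw [hxb, Equiv.swap_apply_right]; exact hab
        · rw [Equiv.swap_apply_of_ne_of_ne hxa hxb]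
    · change pts (act g (swapMask a b m)) = _
      rw [h2, pts_swapMask ⟨a, ha⟩ ⟨b, hb⟩, Finset.map_map]
      rfl

/-- The image of a family of sets under a permutation. -/
def image (σ : Equiv.Perm (Fin 18)) (B : Finset (Finset (Fin 18))) : Finset (Finset (Fin 18)) :=
  B.map (Finset.mapEmbedding σ.toEmbedding).toEmbedding

theorem mem_image {σ : Equiv.Perm (Fin 18)} {c : Finset (Fin 18)} :
    c ∈ image σ B ↔ ∃ b ∈ B, b.map σ.toEmbedding = c := by
  simp [image, Finset.mapEmbedding_apply]

theorem map_mem_image {σ : Equiv.Perm (Fin 18)} {b : Finset (Fin 18)} (hb : b ∈ B) :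
    b.map σ.toEmbedding ∈ image σ B := mem_image.2 ⟨b, hb, rfl⟩

theorem card_filter_image (σ : Equiv.Perm (Fin 18)) (p : Finset (Fin 18) → Prop) [DecidablePred p] :
    ((image σ B).filter p).card = (B.filter fun b => p (b.map σ.toEmbedding)).card := by
  rw [image, filter_map, card_map]
  rfl

theorem isCliqueDecomposition_image (σ : Equiv.Perm (Fin 18)) {K : Set ℕ}
    (h : IsCliqueDecomposition (⊤ : SimpleGraph (Fin 18)) K B) :
    IsCliqueDecomposition (⊤ : SimpleGraph (Fin 18)) K (image σ B) where
  isClique b _ := fun x _ y _ hxy => by simpa using hxy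
  card_mem b hb := by
    obtain ⟨c, hc, rfl⟩ := mem_image.1 hb
    rw [card_map]
    exact h.card_mem c hc
  existsUnique_block x y hxy := by
    have hne : σ.symm x ≠ σ.symm y := by simpa using hxy
    obtain ⟨b, hb, hxb, hyb⟩ := h.exists_mem hne
    refine ⟨b.map σ.toEmbedding, ⟨map_mem_image hb, mem_map_equiv.2 hxb, mem_map_equiv.2 hyb⟩, ?_⟩
    rintro c ⟨hc, hxc, hyc⟩
    obtain ⟨b', hb', rfl⟩ := mem_image.1 hc
    rw [h.eq_of_mem hb' hb hne (mem_map_equiv.1 hxc) (mem_map_equiv.1 hyc) hxb hyb]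

theorem specials_map {d : ℕ} {σ : Equiv.Perm (Fin 18)}
    (hσ : ∀ x, ((σ x : Fin 18) : ℕ) < d ↔ (x : ℕ) < d) (b : Finset (Fin 18)) :
    specials d (b.map σ.toEmbedding) = specials d b := by
  rw [specials, filter_map, card_map, specials]
  congr 1
  exact filter_congr fun x _ => hσ x

theorem isModel_image (h : IsModel sp B) {σ : Equiv.Perm (Fin 18)}
    (hσ : ∀ x, ((σ x : Fin 18) : ℕ) < sp.d ↔ (x : ℕ) < sp.d) : IsModel sp (image σ B) where
  isDecomposition := isCliqueDecomposition_image σ h.isDecomposition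
  card_triangles := by
    rw [card_filter_image]; simpa only [card_map] using h.card_triangles
  degree x := by
    rw [card_filter_image]
    simp only [card_map, mem_map_equiv]
    rw [h.degree]
    refine if_congr ?_ rfl rfl
    rw [← hσ (σ.symm x), Equiv.apply_symm_apply]
  triangles j := by
    rw [card_filter_image]
    simpa only [card_map, specials_map hσ] using h.triangles j
  quads j := by
    rw [card_filter_image]
    simpa only [card_map, specials_map hσ] using h.quads j

theorem subset_iff' {l l' : List ℕ} : subset l l' = true ↔ ∀ x ∈ l, x ∈ l' := by
  rw [subset, allOf_eq, List.all_eq_true]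
  refine forall₂_congr fun x _ => ?_
  rw [anyOf_eq, List.any_eq_true]
  constructor
  · rintro ⟨y, hy, h⟩; rwa [Nat.eq_of_beq_eq_true h]
  · exact fun h => ⟨x, h, Nat.beq_refl x⟩

/-- The new decomposition is the image of `B` under the permutation. A block that was not placed
stays so: if its image were a placed block, that block would also be the image of a placed one, and
permutations act injectively on sets. -/
theorem exists_symmetry {g : List (ℕ × ℕ)} (hg : validGen sp.d st g = true) (hm : IsModel sp B)
    (h : Holds B st) {k m : ℕ} (hf : Fits B st (k, m)) :
    ∃ B', IsModel sp B' ∧ Holds B' st ∧ Fits B' st (k, act g m) := by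
  unfold validGen at hg
  cases h1 : allOf (validSwap sp.d) g with
  | false => rw [h1] at hg; cases hg
  | true =>
  cases h2 : subset st.T (mapBy (act g) st.T) with
  | false => rw [h1, h2] at hg; cases hg
  | true =>
  cases h3 : subset st.Q (mapBy (act g) st.Q) with
  | false => rw [h1, h2, h3] at hg; cases hg
  | true =>
  rw [h1, h2, h3, cond_true, cond_true, cond_true] at hg
  rw [subset_iff', mapBy_eq] at h2 h3 hg
  obtain ⟨σ, hσ, hact⟩ := exists_perm_of_validSwap g h1
  have hinj : Function.Injective fun b : Finset (Fin 18) => b.map σ.toEmbedding :=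
    Finset.map_injective _
  have hnot : ∀ {l : List ℕ}, (∀ x ∈ l, x ∈ l.map (act g)) → pts m ∉ l.map pts →
      (pts m).map σ.toEmbedding ∉ l.map pts := by
    intro l hl hn hc
    obtain ⟨b, hb, he⟩ := List.mem_map.1 hc
    obtain ⟨b', hb', rfl⟩ := List.mem_map.1 (hl b hb)
    rw [hact] at he
    exact hn (List.mem_map.2 ⟨b', hb', hinj he⟩)
  refine ⟨image σ B, isModel_image hm hσ, ⟨fun b hb => ?_, h.T_nodup, fun b hb => ?_, h.Q_nodup,
    fun b hb => ?_⟩, ?_⟩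
  · obtain ⟨b, hb', rfl⟩ := List.mem_map.1 (h2 b hb)
    rw [hact, card_map]
    exact ⟨map_mem_image (h.T_mem b hb').1, (h.T_mem b hb').2⟩
  · obtain ⟨b, hb', rfl⟩ := List.mem_map.1 (h3 b hb)
    rw [hact, card_map]
    exact ⟨map_mem_image (h.Q_mem b hb').1, (h.Q_mem b hb').2⟩
  · obtain ⟨b, hb', rfl⟩ := List.mem_map.1 (hg b hb)
    rw [hact]
    obtain ⟨q, hq, hq4, hsub⟩ := h.P_mem b hb'
    exact ⟨_, map_mem_image hq, by rwa [card_map], map_subset_map.2 hsub⟩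
  · rcases hf with ⟨hk, hf, hc, hn⟩ | ⟨hk, hf, hc, hn⟩ | ⟨hk, q, hq, hq4, hsub⟩
    · refine Or.inl ⟨hk, ?_⟩
      rw [hact, card_map]
      exact ⟨map_mem_image hf, hc, hnot h2 hn⟩
    · refine Or.inr (Or.inl ⟨hk, ?_⟩)
      rw [hact, card_map]
      exact ⟨map_mem_image hf, hc, hnot h3 hn⟩
    · refine Or.inr (Or.inr ⟨hk, ?_⟩)
      rw [hact]
      exact ⟨_, map_mem_image hq, by rwa [card_map], map_subset_map.2 hsub⟩

/-! ### The options are exhaustive -/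

theorem full_testBit {d i : ℕ} {l : List ℕ} (h : (full d l).testBit i = true) :
    quota d i ≤ deg i l := by
  unfold full at h
  generalize 18 = n at h
  induction n with
  | zero => simp at h
  | succ n ih =>
    dsimp only at h
    cases hq : Nat.ble (quota d n) (deg n l) with
    | false => rw [hq] at h; exact ih h
    | true =>
      rw [hq, cond_true] at h
      have hl : ∀ a b : ℕ, Nat.lor a b = a ||| b := fun _ _ => rfl
      have hp : Nat.pow 2 n = 2 ^ n := rfl
      rw [hl, Nat.testBit_or, Bool.or_eq_true, hp, Nat.testBit_two_pow, decide_eq_true_eq] at h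
      rcases h with rfl | h
      · exact Nat.le_of_ble_eq_true hq
      · exact ih h

theorem mem_triangleOptions (hd : sp.d ≤ 18) (hm : IsModel sp B) (h : Holds B st) {l : List ℕ}
    {m : ℕ} (hml : m ∈ l) (hm18 : m < 2 ^ 18) (hb : pts m ∈ B) (hc : (pts m).card = 3)
    (hn : pts m ∉ st.T.map pts) :
    ∃ o ∈ triangleOptions sp st l, Fits B st o := by
  refine ⟨(3, m), ?_, Or.inl ⟨rfl, hb, hc, hn⟩⟩
  have hB := hm.isDecomposition
  have hT : ∀ b ∈ st.T.map pts, b ∈ B.filter fun b => b.card = 3 := by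
    intro b hb
    obtain ⟨x, hx, rfl⟩ := List.mem_map.1 hb
    exact mem_filter.2 (h.T_mem x hx)
  have hmB : pts m ∈ B.filter fun b => b.card = 3 := mem_filter.2 ⟨hb, hc⟩
  rw [triangleOptions, mapBy_eq, filterBy_eq, List.mem_map]
  refine ⟨m, List.mem_filter.2 ⟨hml, ?_⟩, rfl⟩
  rw [okTriangle, andNot_eq_true_iff, andNot_eq_true_iff, andNot_eq_true_iff]
  refine ⟨clash_eq_false hB hb hm18 subset_rfl fun b hb => ⟨_, (h.T_mem b hb).1, ?_, subset_rfl⟩,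
    clash_eq_false hB hb hm18 subset_rfl fun b hb => ⟨_, (h.Q_mem b hb).1, ?_, subset_rfl⟩,
    clash_eq_false hB hb hm18 subset_rfl fun b hb => ?_, ?_⟩
  · exact fun he => hn (he ▸ List.mem_map_of_mem hb)
  · intro he
    have := (h.Q_mem b hb).2
    rw [he] at this; omega
  · obtain ⟨q, hq, hq4, hs⟩ := h.P_mem b hb
    exact ⟨q, hq, fun he => by rw [he] at hq4; omega, hs⟩
  -- A saturated point in `m` would lie in one more triangle than `IsModel.degree` allows.
  · have h0 : Nat.beq (Nat.land m (full sp.d st.T)) 0 = true := by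
      rw [Nat.beq_eq]
      refine Nat.eq_of_testBit_eq fun i => ?_
      have hl : Nat.land m (full sp.d st.T) = m &&& full sp.d st.T := rfl
      rw [Nat.zero_testBit, hl, Nat.testBit_and, ← Bool.not_eq_true, Bool.and_eq_true]
      rintro ⟨h1, h2⟩
      have hi : i < 18 := by
        by_contra hc
        rw [Nat.testBit_lt_two_pow
          (hm18.trans_le (Nat.pow_le_pow_right (by norm_num) (by omega)))] at h1
        cases h1
      have h3 := full_testBit h2
      rw [deg_eq ⟨i, hi⟩] at h3
      have h4 := countP_succ_le h.T_nodup hT hmB hn (fun b => (⟨i, hi⟩ : Fin 18) ∈ b)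
        (mem_pts.2 h1)
      rw [filter_filter, hm.degree] at h4
      unfold quota at h3
      by_cases hid : i < sp.d
      · rw [if_pos hid] at h4
        have : Nat.blt i sp.d = true := by rwa [Nat.blt_eq]
        rw [this, cond_true] at h3
        omega
      · rw [if_neg hid] at h4
        have : Nat.blt i sp.d = false := by rw [← Bool.not_eq_true, Nat.blt_eq]; exact hid
        rw [this, cond_false] at h3
        omega
    rw [h0, cond_true, Nat.blt_eq, classSize_eq hd, spec_eq m hd, nth_eq, ← hm.triangles,
      ← filter_filter]
    exact countP_succ_le h.T_nodup hT hmB hn (fun b => specials sp.d b = specials sp.d (pts m)) rfl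

theorem mem_quadOptions (hd : sp.d ≤ 18) (hm : IsModel sp B) (h : Holds B st) {l : List ℕ}
    {m : ℕ} (hml : m ∈ l) (hm18 : m < 2 ^ 18) (hb : pts m ∈ B) (hc : (pts m).card = 4)
    (hn : pts m ∉ st.Q.map pts) :
    ∃ o ∈ quadOptions sp st l, Fits B st o := by
  refine ⟨(4, m), ?_, Or.inr (Or.inl ⟨rfl, hb, hc, hn⟩)⟩
  have hB := hm.isDecomposition
  have hQ : ∀ b ∈ st.Q.map pts, b ∈ B.filter fun b => b.card = 4 := by
    intro b hb
    obtain ⟨x, hx, rfl⟩ := List.mem_map.1 hb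
    exact mem_filter.2 (h.Q_mem x hx)
  have hmB : pts m ∈ B.filter fun b => b.card = 4 := mem_filter.2 ⟨hb, hc⟩
  rw [quadOptions, mapBy_eq, filterBy_eq, List.mem_map]
  refine ⟨m, List.mem_filter.2 ⟨hml, ?_⟩, rfl⟩
  rw [okQuad, andNot_eq_true_iff, andNot_eq_true_iff]
  refine ⟨clash_eq_false hB hb hm18 subset_rfl fun b hb => ⟨_, (h.T_mem b hb).1, ?_, subset_rfl⟩,
    clash_eq_false hB hb hm18 subset_rfl fun b hb => ⟨_, (h.Q_mem b hb).1, ?_, subset_rfl⟩, ?_⟩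
  · intro he
    have := (h.T_mem b hb).2
    rw [he] at this; omega
  · exact fun he => hn (he ▸ List.mem_map_of_mem hb)
  · rw [Nat.blt_eq, classSize_eq hd, spec_eq m hd, nth_eq, ← hm.quads, ← filter_filter]
    exact countP_succ_le h.Q_nodup hQ hmB hn (fun b => specials sp.d b = specials sp.d (pts m)) rfl

theorem mem_neighbours {u x : ℕ} {l : List ℕ} :
    x ∈ neighbours st u l ↔ x ∈ l ∧ u ≠ x ∧ free st u x = true := by
  rw [neighbours, filterBy_eq, List.mem_filter, andNot_eq_true_iff, ← Bool.not_eq_true, Nat.beq_eq]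

theorem mem_addOne {m x : ℕ} {l : List ℕ} (hx : x ∈ l) : Nat.lor m (Nat.pow 2 x) ∈ addOne m l := by
  rw [addOne, mapBy_eq]
  exact List.mem_map.2 ⟨x, hx, rfl⟩

theorem lor_right_comm (a b c : ℕ) : Nat.lor (Nat.lor a b) c = Nat.lor (Nat.lor a c) b :=
  Nat.or_right_comm a b c

/-- `addTwo` lists each unordered pair once, in the order of the list, so the two powers may have to
be interchanged. -/
theorem mem_addTwo {m x y : ℕ} {l : List ℕ} (hx : x ∈ l) (hy : y ∈ l) (hxy : x ≠ y) :
    Nat.lor (Nat.lor m (Nat.pow 2 x)) (Nat.pow 2 y) ∈ addTwo m l := by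
  induction l with
  | nil => cases hx
  | cons z l ih =>
    change _ ∈ append (addOne (Nat.lor m (Nat.pow 2 z)) l) (addTwo m l)
    rw [append_eq, List.mem_append]
    rcases List.mem_cons.1 hx with rfl | hx'
    · exact Or.inl (mem_addOne ((List.mem_cons.1 hy).resolve_left hxy.symm))
    · rcases List.mem_cons.1 hy with rfl | hy'
      · rw [lor_right_comm]
        exact Or.inl (mem_addOne hx')
      · exact Or.inr (ih hx' hy')

theorem mem_addThree {m x y z : ℕ} {l : List ℕ} (hx : x ∈ l) (hy : y ∈ l) (hz : z ∈ l)
    (hxy : x ≠ y) (hxz : x ≠ z) (hyz : y ≠ z) :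
    Nat.lor (Nat.lor (Nat.lor m (Nat.pow 2 x)) (Nat.pow 2 y)) (Nat.pow 2 z) ∈ addThree m l := by
  induction l with
  | nil => cases hx
  | cons w l ih =>
    change _ ∈ append (addTwo (Nat.lor m (Nat.pow 2 w)) l) (addThree m l)
    rw [append_eq, List.mem_append]
    rcases List.mem_cons.1 hx with rfl | hx'
    · exact Or.inl (mem_addTwo ((List.mem_cons.1 hy).resolve_left hxy.symm)
        ((List.mem_cons.1 hz).resolve_left hxz.symm) hyz)
    · rcases List.mem_cons.1 hy with rfl | hy'
      · rw [lor_right_comm m]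
        exact Or.inl (mem_addTwo hx' ((List.mem_cons.1 hz).resolve_left hyz.symm) hxz)
      · rcases List.mem_cons.1 hz with rfl | hz'
        · rw [lor_right_comm, lor_right_comm m]
          exact Or.inl (mem_addTwo hx' hy' hxy)
        · exact Or.inr (ih hx' hy' hz')

theorem mem_addMixed {m : ℕ} {l l' : List ℕ} {x y : ℕ} (hm : m ∈ addTwo 0 l) (hx : x ∈ l')
    (hy : y ∈ l') (hxy : x ≠ y) :
    Nat.lor (Nat.lor m (Nat.pow 2 x)) (Nat.pow 2 y) ∈ addMixed l l' := by
  unfold addMixed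
  generalize addTwo 0 l = k at hm ⊢
  induction k with
  | nil => cases hm
  | cons w k ih =>
    change _ ∈ append (addTwo w l') _
    rw [append_eq, List.mem_append]
    rcases List.mem_cons.1 hm with rfl | hm'
    · exact Or.inl (mem_addTwo hx hy hxy)
    · exact Or.inr (ih hm')

end BlockSearch

namespace BlockSearch

variable {sp : Spec} {B : Finset (Finset (Fin 18))} {st : State}

theorem mem_points (x : Fin 18) : (x : ℕ) ∈ points := List.mem_range.2 x.2

theorem card_insert_mask {x y : Fin 18} {b : Finset (Fin 18)} (hxy : x ≠ y) (hx : x ∈ b)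
    (hy : y ∈ b) : (b \ {x, y}).card = b.card - 2 := by
  rw [card_sdiff_of_subset (by simp [insert_subset_iff, hx, hy]), card_pair hxy]

theorem exists_eq_of_card_three {x y : Fin 18} {b : Finset (Fin 18)} (hb : b.card = 3)
    (hxy : x ≠ y) (hx : x ∈ b) (hy : y ∈ b) :
    ∃ z, z ∈ b ∧ x ≠ z ∧ y ≠ z ∧ b = {x, y} ∪ {z} := by
  obtain ⟨z, hz⟩ := card_eq_one.1 ((card_insert_mask hxy hx hy).trans (by rw [hb]))
  have hzm : z ∈ b \ {x, y} := by simp [hz]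
  simp only [mem_sdiff, mem_insert, mem_singleton, not_or] at hzm
  exact ⟨z, hzm.1, fun h => hzm.2.1 h.symm, fun h => hzm.2.2 h.symm, by
    rw [← hz, union_sdiff_of_subset (by simp [insert_subset_iff, hx, hy])]⟩

theorem exists_eq_of_card_four {x y : Fin 18} {b : Finset (Fin 18)} (hb : b.card = 4)
    (hxy : x ≠ y) (hx : x ∈ b) (hy : y ∈ b) :
    ∃ z w, z ∈ b ∧ w ∈ b ∧ z ≠ w ∧ x ≠ z ∧ y ≠ z ∧ x ≠ w ∧ y ≠ w ∧ b = ({x, y} ∪ {z}) ∪ {w} := by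
  obtain ⟨z, w, hzw, hz⟩ := card_eq_two.1 ((card_insert_mask hxy hx hy).trans (by rw [hb]))
  have hzm : z ∈ b \ {x, y} := by simp [hz]
  have hwm : w ∈ b \ {x, y} := by simp [hz]
  simp only [mem_sdiff, mem_insert, mem_singleton, not_or] at hzm hwm
  refine ⟨z, w, hzm.1, hwm.1, hzw, fun h => hzm.2.1 h.symm, fun h => hzm.2.2 h.symm,
    fun h => hwm.2.1 h.symm, fun h => hwm.2.2 h.symm, ?_⟩
  rw [union_assoc, ← insert_eq, ← hz, union_sdiff_of_subset (by simp [insert_subset_iff, hx, hy])]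

theorem notMem_of_card (h : Holds B st) {b : Finset (Fin 18)} :
    (b.card = 3 → b ∉ st.Q.map pts) ∧ (b.card = 4 → b ∉ st.T.map pts) := by
  constructor <;> intro hb hc <;> obtain ⟨m, hm, rfl⟩ := List.mem_map.1 hc
  · have := (h.Q_mem m hm).2
    omega
  · have := (h.T_mem m hm).2
    omega

/-- The converse counterpart of `countP_succ_le`: as long as fewer blocks of a class are placed than
exist, one remains to branch on. -/
theorem exists_fresh {F : Finset (Finset (Fin 18))} {l : List (Finset (Fin 18))}
    (p : Finset (Fin 18) → Prop) [DecidablePred p] (h : l.countP p < (F.filter p).card) :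
    ∃ b ∈ F, p b ∧ b ∉ l := by
  by_contra hc
  push Not at hc
  have hsub : F.filter p ⊆ (l.filter p).toFinset := by
    intro b hb
    obtain ⟨hb, hp⟩ := mem_filter.1 hb
    simp [hc b hb hp, hp]
  have := (card_le_card hsub).trans (List.toFinset_card_le _)
  rw [← List.countP_eq_length_filter] at this
  omega

theorem exists_triangle_option (hd : sp.d ≤ 18) (hm : IsModel sp B) (h : Holds B st)
    {u v : Fin 18} (huv : u ≠ v) {b : Finset (Fin 18)} (hb : b ∈ B) (hu : u ∈ b) (hv : v ∈ b)
    (hT : b ∉ st.T.map pts) (hQ : b ∉ st.Q.map pts) (hb3 : b.card = 3) :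
    ∃ o ∈ triangleOptions sp st
      (addOne (pairMask u v) (neighbours st u (neighbours st v points))), Fits B st o := by
  obtain ⟨z, hz, huz, hvz, hbz⟩ := exists_eq_of_card_three hb3 huv hu hv
  have hpts : pts (Nat.lor (pairMask u v) (Nat.pow 2 z)) = b := by
    rw [pts_lor, pts_pairMask, pts_pow, hbz]
  refine mem_triangleOptions hd hm h (mem_addOne (mem_neighbours.2 ⟨mem_neighbours.2
    ⟨mem_points z, ?_, ?_⟩, ?_, ?_⟩)) (lor_lt (pairMask_lt u v) (pow_lt z)) (by rwa [hpts])
    (by rwa [hpts]) (by rwa [hpts])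
  · exact fun he => hvz (Fin.ext he)
  · exact free_eq_true hm.isDecomposition h hb hT hQ hv hz
  · exact fun he => huz (Fin.ext he)
  · exact free_eq_true hm.isDecomposition h hb hT hQ hu hz

theorem exists_quad_option (hd : sp.d ≤ 18) (hm : IsModel sp B) (h : Holds B st)
    {u v : Fin 18} (huv : u ≠ v) {b : Finset (Fin 18)} (hb : b ∈ B) (hu : u ∈ b) (hv : v ∈ b)
    (hT : b ∉ st.T.map pts) (hQ : b ∉ st.Q.map pts) (hb4 : b.card = 4) :
    ∃ o ∈ quadOptions sp st
      (addTwo (pairMask u v) (neighbours st u (neighbours st v points))), Fits B st o := by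
  obtain ⟨z, w, hz, hw, hzw, huz, hvz, huw, hvw, hbz⟩ := exists_eq_of_card_four hb4 huv hu hv
  have hpts : pts (Nat.lor (Nat.lor (pairMask u v) (Nat.pow 2 z)) (Nat.pow 2 w)) = b := by
    rw [pts_lor, pts_lor, pts_pairMask, pts_pow, pts_pow, hbz]
  have key : ∀ z, z ∈ b → u ≠ z → v ≠ z → (z : ℕ) ∈ neighbours st u (neighbours st v points) :=
    fun z hz huz hvz => mem_neighbours.2 ⟨mem_neighbours.2
      ⟨mem_points z, fun he => hvz (Fin.ext he),
        free_eq_true hm.isDecomposition h hb hT hQ hv hz⟩, fun he => huz (Fin.ext he),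
      free_eq_true hm.isDecomposition h hb hT hQ hu hz⟩
  exact mem_quadOptions hd hm h (mem_addTwo (key z hz huz hvz) (key w hw huw hvw)
    fun he => hzw (Fin.ext he)) (lor_lt (lor_lt (pairMask_lt u v) (pow_lt z)) (pow_lt w))
    (by rwa [hpts]) (by rwa [hpts]) (by rwa [hpts])

theorem exists_of_applicable {u v : ℕ}
    (ha : cond (Nat.blt u v) (cond (Nat.blt v 18) (free st u v) false) false = true) :
    ∃ x y : Fin 18, u = x ∧ v = y ∧ x ≠ y ∧ free st x y = true := by
  cases h1 : Nat.blt u v with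
  | false => rw [h1] at ha; cases ha
  | true =>
    cases h2 : Nat.blt v 18 with
    | false => rw [h1, h2] at ha; cases ha
    | true =>
      rw [h1, h2] at ha
      rw [Nat.blt_eq] at h1 h2
      exact ⟨⟨u, h1.trans h2⟩, ⟨v, h2⟩, rfl, rfl, by simp [Fin.ext_iff, h1.ne], ha⟩

theorem exists_option (hd : sp.d ≤ 18) (hm : IsModel sp B) (h : Holds B st) {g : Goal}
    (ha : applicable sp st g = true) : ∃ o ∈ options sp st g, Fits B st o := by
  have hB := hm.isDecomposition
  cases g with
  | pair u v =>
    obtain ⟨u, v, rfl, rfl, huv, hf⟩ := exists_of_applicable ha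
    obtain ⟨b, hb, hu, hv⟩ := hB.exists_mem huv
    obtain ⟨hT, hQ⟩ := notMem_of_free huv hf hu hv
    simp only [options, append_eq, List.mem_append]
    rcases hB.card_eq hb with h3 | h4
    · obtain ⟨o, ho, hfo⟩ := exists_triangle_option hd hm h huv hb hu hv hT hQ h3
      exact ⟨o, Or.inl ho, hfo⟩
    · obtain ⟨o, ho, hfo⟩ := exists_quad_option hd hm h huv hb hu hv hT hQ h4
      exact ⟨o, Or.inr ho, hfo⟩
  | split u v =>
    obtain ⟨u, v, rfl, rfl, huv, hf⟩ := exists_of_applicable ha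
    obtain ⟨b, hb, hu, hv⟩ := hB.exists_mem huv
    obtain ⟨hT, hQ⟩ := notMem_of_free huv hf hu hv
    simp only [options, List.mem_cons]
    rcases hB.card_eq hb with h3 | h4
    · obtain ⟨o, ho, hfo⟩ := exists_triangle_option hd hm h huv hb hu hv hT hQ h3
      exact ⟨o, Or.inr ho, hfo⟩
    · refine ⟨_, Or.inl rfl, Or.inr (Or.inr ⟨rfl, b, hb, h4, ?_⟩)⟩
      rw [pts_pairMask]
      simp [insert_subset_iff, hu, hv]
  | triangle u =>
    simp only [applicable] at ha
    cases h1 : Nat.blt u 18 with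
    | false => rw [h1] at ha; cases ha
    | true =>
    rw [h1, cond_true, Nat.blt_eq] at ha
    rw [Nat.blt_eq] at h1
    obtain ⟨u, rfl⟩ : ∃ x : Fin 18, u = x := ⟨⟨u, h1⟩, rfl⟩
    have hdeg := hm.degree u
    rw [deg_eq] at ha
    have hq : quota sp.d u = if (u : ℕ) < sp.d then 4 else 1 := by
      unfold quota
      by_cases h : (u : ℕ) < sp.d
      · have : Nat.blt u sp.d = true := by rwa [Nat.blt_eq]
        rw [this, if_pos h, cond_true]
      · have : Nat.blt u sp.d = false := by rwa [← Bool.not_eq_true, Nat.blt_eq]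
        rw [this, if_neg h, cond_false]
    rw [hq, ← hdeg, ← filter_filter] at ha
    obtain ⟨b, hb, hub, hn⟩ := exists_fresh (fun b => u ∈ b) ha
    obtain ⟨hb, hb3⟩ := mem_filter.1 hb
    have hQ := (notMem_of_card h).1 hb3
    have h2 : (b.erase u).card = 2 := by rw [card_erase_of_mem hub, hb3]
    obtain ⟨y, z, hyz, hyz'⟩ := card_eq_two.1 h2
    have hy : y ∈ b.erase u := by simp [hyz']
    have hz : z ∈ b.erase u := by simp [hyz']
    rw [mem_erase] at hy hz
    have hpts : pts (Nat.lor (Nat.lor (Nat.pow 2 u) (Nat.pow 2 y)) (Nat.pow 2 z)) = b := by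
      rw [pts_lor, pts_lor, pts_pow, pts_pow, pts_pow, union_assoc, ← insert_eq y, ← hyz',
        ← insert_eq, insert_erase hub]
    have key : ∀ x, x ≠ u → x ∈ b → (x : ℕ) ∈ neighbours st u points := fun x hxu hxb =>
      mem_neighbours.2 ⟨mem_points x, fun he => hxu (Fin.ext he.symm),
        free_eq_true hB h hb hn hQ hub hxb⟩
    exact mem_triangleOptions hd hm h (mem_addTwo (key y hy.1 hy.2) (key z hz.1 hz.2)
      fun he => hyz (Fin.ext he)) (lor_lt (lor_lt (pow_lt u) (pow_lt y)) (pow_lt z))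
      (by rwa [hpts]) (by rwa [hpts]) (by rwa [hpts])
  | inner =>
    simp only [applicable, Nat.blt_eq, classSize_eq hd, nth_eq] at ha
    rw [← hm.triangles, ← filter_filter] at ha
    obtain ⟨b, hb, hs, hn⟩ := exists_fresh (fun b => specials sp.d b = 3) ha
    obtain ⟨hb, hb3⟩ := mem_filter.1 hb
    have hall : ∀ x ∈ b, (x : ℕ) ∈ List.range sp.d := by
      have : b.filter (fun x : Fin 18 => (x : ℕ) < sp.d) = b :=
        eq_of_subset_of_card_le (filter_subset _ _) (by rw [hb3]; exact hs.ge)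
      intro x hx
      rw [← this] at hx
      exact List.mem_range.2 (mem_filter.1 hx).2
    obtain ⟨x, y, z, hxy, hxz, hyz, rfl⟩ := card_eq_three.1 hb3
    have hpts : pts (Nat.lor (Nat.lor (Nat.lor 0 (Nat.pow 2 x)) (Nat.pow 2 y)) (Nat.pow 2 z)) =
        {x, y, z} := by
      rw [pts_lor, pts_lor, pts_lor, pts_pow, pts_pow, pts_pow, pts_zero, empty_union, union_assoc]
      rfl
    exact mem_triangleOptions hd hm h (mem_addThree (hall x (by simp)) (hall y (by simp))
      (hall z (by simp)) (fun he => hxy (Fin.ext he)) (fun he => hxz (Fin.ext he))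
      (fun he => hyz (Fin.ext he)))
      (lor_lt (lor_lt (lor_lt (by norm_num) (pow_lt x)) (pow_lt y)) (pow_lt z))
      (by rwa [hpts]) (by rwa [hpts]) (by rwa [hpts])
  | mixed =>
    simp only [applicable, Nat.blt_eq, classSize_eq hd, nth_eq] at ha
    rw [← hm.quads, ← filter_filter] at ha
    obtain ⟨b, hb, hs, hn⟩ := exists_fresh (fun b => specials sp.d b = 2) ha
    obtain ⟨hb, hb4⟩ := mem_filter.1 hb
    obtain ⟨x, y, hxy, hx⟩ := card_eq_two.1 hs
    have hs' : (b.filter fun x : Fin 18 => ¬ (x : ℕ) < sp.d).card = 2 := by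
      have := card_filter_add_card_filter_not (s := b) (fun x : Fin 18 => (x : ℕ) < sp.d)
      unfold specials at hs
      omega
    obtain ⟨z, w, hzw, hz⟩ := card_eq_two.1 hs'
    have key : ∀ v, v ∈ b.filter (fun x : Fin 18 => (x : ℕ) < sp.d) → (v : ℕ) ∈ List.range sp.d :=
      fun v hv => List.mem_range.2 (mem_filter.1 hv).2
    have key' : ∀ v, v ∈ b.filter (fun x : Fin 18 => ¬ (x : ℕ) < sp.d) →
        (v : ℕ) ∈ filterBy (fun x => Nat.ble sp.d x) points := fun v hv => by
      rw [filterBy_eq, List.mem_filter, Nat.ble_eq]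
      exact ⟨mem_points v, not_lt.1 (mem_filter.1 hv).2⟩
    have hpts : pts (Nat.lor (Nat.lor (Nat.lor (Nat.lor 0 (Nat.pow 2 x)) (Nat.pow 2 y))
        (Nat.pow 2 z)) (Nat.pow 2 w)) = b := by
      rw [pts_lor, pts_lor, pts_lor, pts_lor, pts_pow, pts_pow, pts_pow, pts_pow, pts_zero,
        empty_union, union_assoc, ← insert_eq, ← insert_eq, ← hx, ← hz]
      exact filter_union_filter_not_eq _ _
    exact mem_quadOptions hd hm h (mem_addMixed (mem_addTwo (key x (by simp [hx]))
      (key y (by simp [hx])) fun he => hxy (Fin.ext he)) (key' z (by rw [hz]; simp))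
      (key' w (by rw [hz]; simp)) fun he => hzw (Fin.ext he))
      (lor_lt (lor_lt (lor_lt (lor_lt (by norm_num) (pow_lt x)) (pow_lt y)) (pow_lt z)) (pow_lt w))
      (by rwa [hpts]) (by rwa [hpts]) (by rwa [hpts])

/-! ### Leaves -/

theorem exists_bitsOf (m : ℕ) : ∃ l : List (Fin 18), l.Nodup ∧ l.toFinset = pts m ∧
    bitsOf m = l.map Fin.val := by
  refine ⟨(List.finRange 18).filter fun i => m.testBit i, (List.nodup_finRange 18).filter _, ?_, ?_⟩
  · ext i; simp [mem_pts]
  · have hp : points = (List.finRange 18).map Fin.val := by decide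
    rw [bitsOf, filterBy_eq, hp, List.filter_map]
    congr 1
    refine List.filter_congr fun i _ => ?_
    rw [Function.comp_apply, bit_eq]
    cases m.testBit i <;> rfl

theorem consistent_placeTriangles (hB : IsCliqueDecomposition (⊤ : SimpleGraph (Fin 18)) {3, 4} B)
    {l : List ℕ} (hl : ∀ m ∈ l, pts m ∈ B ∧ (pts m).card = 3) :
    PairSearch.Consistent B (l.map pts) (placeTriangles l) := by
  induction l with
  | nil => exact PairSearch.consistent_start B
  | cons m l ih =>
    obtain ⟨hm, hc⟩ := hl m (by simp)
    have ih := ih fun x hx => hl x (by simp [hx])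
    obtain ⟨k, hk, hkm, hbits⟩ := exists_bitsOf m
    have hlen : k.length = 3 := by rw [← List.toFinset_card_of_nodup hk, hkm, hc]
    obtain ⟨a, b, c, rfl⟩ := List.length_eq_three.1 hlen
    have hpts : pts m = {a, b, c} := by rw [← hkm]; simp
    have hR : placeTriangles (m :: l) = PairSearch.placeTriangle (placeTriangles l)
        (PairSearch.mask (PairSearch.nth (bitsOf m) 0))
        (PairSearch.mask (PairSearch.nth (bitsOf m) 1))
        (PairSearch.mask (PairSearch.nth (bitsOf m) 2)) := rfl
    rw [hR, hbits, nth_eq, nth_eq, nth_eq]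
    simp only [List.map_cons, List.map_nil, List.getD_cons_zero, List.getD_cons_succ,
      PairSearch.mask_eq]
    rw [hpts] at hm hc ⊢
    exact ih.placeTriangle hB hm hc

theorem consistent_placeQuads (hB : IsCliqueDecomposition (⊤ : SimpleGraph (Fin 18)) {3, 4} B)
    {l : List ℕ} (hl : ∀ m ∈ l, pts m ∈ B ∧ (pts m).card = 4) {L : List (Finset (Fin 18))} {R : ℕ}
    (h : PairSearch.Consistent B L R) :
    PairSearch.Consistent B (l.map pts ++ L) (placeQuads R l) := by
  induction l with
  | nil => exact h
  | cons m l ih =>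
    obtain ⟨hm, hc⟩ := hl m (by simp)
    have ih := ih fun x hx => hl x (by simp [hx])
    obtain ⟨k, hk, hkm, hbits⟩ := exists_bitsOf m
    have hlen : k.length = 4 := by rw [← List.toFinset_card_of_nodup hk, hkm, hc]
    obtain ⟨a, b, c, d, rfl⟩ : ∃ a b c d, k = [a, b, c, d] := by
      match k, hlen with
      | [a, b, c, d], _ => exact ⟨a, b, c, d, rfl⟩
    have hpts : pts m = {a, b, c, d} := by rw [← hkm]; simp
    have hR : placeQuads R (m :: l) = PairSearch.placeQuad (placeQuads R l)
        (PairSearch.mask (PairSearch.nth (bitsOf m) 0))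
        (PairSearch.mask (PairSearch.nth (bitsOf m) 1))
        (PairSearch.mask (PairSearch.nth (bitsOf m) 2))
        (PairSearch.mask (PairSearch.nth (bitsOf m) 3)) := rfl
    rw [hR, hbits, nth_eq, nth_eq, nth_eq, nth_eq]
    simp only [List.map_cons, List.map_nil, List.getD_cons_zero, List.getD_cons_succ,
      PairSearch.mask_eq, List.cons_append]
    simp only [List.nodup_cons, List.mem_cons, not_or, List.not_mem_nil] at hk
    rw [hpts] at hm ⊢
    exact ih.placeQuad hB hm hk.1.1 hk.1.2.1 hk.1.2.2.1 hk.2.1.1 hk.2.1.2.1 hk.2.2.1.1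

/-- The placed triangles are distinct and as many as `B` has in total, hence they are all of them.
This is the hypothesis on triangles in `search_sound`. -/
theorem refuted_of_leafCheck (h : leafCheck sp st = true) : Refuted sp st := by
  intro B hm hh
  have hB := hm.isDecomposition
  unfold leafCheck at h
  cases hl : Nat.beq st.T.length sp.t with
  | false => rw [hl] at h; cases h
  | true =>
    rw [hl, cond_true] at h
    have hlen : st.T.length = sp.t := Nat.eq_of_beq_eq_true hl
    have hsub : (st.T.map pts).toFinset ⊆ B.filter fun b => b.card = 3 := by
      intro b hb
      obtain ⟨x, hx, rfl⟩ := List.mem_map.1 (List.mem_toFinset.1 hb)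
      exact mem_filter.2 (hh.T_mem x hx)
    have heq := eq_of_subset_of_card_le hsub (by
      rw [hm.card_triangles, List.toFinset_card_of_nodup hh.T_nodup, List.length_map, hlen])
    refine PairSearch.search_sound hB (L := st.Q.map pts ++ st.T.map pts) (fun b hb hb3 => ?_) 10000
      _ _ (fun b hb => hb) (consistent_placeQuads hB hh.Q_mem
        (consistent_placeTriangles hB hh.T_mem)) h
    have : b ∈ (st.T.map pts).toFinset := heq ▸ mem_filter.2 ⟨hb, hb3⟩
    exact List.mem_append_right _ (List.mem_toFinset.1 this)

/-! ### The certificate -/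

/-- Strong induction on the mask of the option that fits. A reducible option is carried by a
generator to a smaller one, which fits the image of the decomposition; hence the induction
hypothesis has to range over all models and not just the given one. -/
theorem refuted_of_survivors (hd : sp.d ≤ 18) {g : Goal} {gens : List (List (ℕ × ℕ))}
    (ha : applicable sp st g = true) (hg : allOf (validGen sp.d st) gens = true)
    (hs : ∀ o ∈ survivors gens (options sp st g), Refuted sp (extend st o.1 o.2)) :
    Refuted sp st := by
  have key : ∀ n, ∀ o ∈ options sp st g, o.2 = n → ∀ B, IsModel sp B → Holds B st →
      ¬ Fits B st o := by
    intro n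
    induction n using Nat.strong_induction_on with
    | _ n ih =>
    rintro ⟨k, m⟩ ho rfl B hm h hf
    cases hr : reducible gens (options sp st g) (k, m) with
    | false =>
      refine hs (k, m) ?_ B hm (h.extend hf)
      rw [survivors, filterBy_eq, List.mem_filter, andNot_eq_true_iff]
      exact ⟨ho, hr, rfl⟩
    | true =>
      rw [reducible, anyOf_eq, List.any_eq_true] at hr
      obtain ⟨s, hsg, hr⟩ := hr
      cases h1 : Nat.blt (act s m) m with
      | false => rw [h1] at hr; cases hr
      | true =>
        rw [h1, cond_true, memOption, anyOf_eq, List.any_eq_true] at hr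
        obtain ⟨⟨k', m'⟩, ho', hr⟩ := hr
        cases h2 : Nat.beq (act s m) m' with
        | false => rw [h2] at hr; cases hr
        | true =>
          rw [h2, cond_true] at hr
          obtain rfl : k = k' := Nat.eq_of_beq_eq_true hr
          obtain rfl : act s m = m' := Nat.eq_of_beq_eq_true h2
          rw [allOf_eq, List.all_eq_true] at hg
          obtain ⟨B', hm', h', hf'⟩ := exists_symmetry (hg s hsg) hm h hf
          rw [Nat.blt_eq] at h1
          exact ih (act s m) h1 _ ho' rfl B' hm' h' hf'
  intro B hm h
  obtain ⟨o, ho, hf⟩ := exists_option hd hm h ha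
  exact key _ o ho rfl B hm h hf

theorem check_sound_aux (hd : sp.d ≤ 18) {hyps : List State} (hh : ∀ s ∈ hyps, Refuted sp s)
    (c : Cert) : ∀ st, (check sp hyps c st none = true → Refuted sp st) ∧
      ∀ l, check sp hyps c st (some l) = true → ∀ o ∈ l, Refuted sp (extend st o.1 o.2) := by
  induction c with
  | leaf => exact fun st => ⟨refuted_of_leafCheck, fun l h => by cases h⟩
  | known =>
    refine fun st => ⟨fun h => ?_, fun l h => (by cases h)⟩
    change anyOf (sameState st) hyps = true at h
    rw [anyOf_eq, List.any_eq_true] at h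
    obtain ⟨s, hs, h⟩ := h
    rw [sameState_eq h]
    exact hh s hs
  | done =>
    refine fun st => ⟨fun h => (by cases h), fun l h => ?_⟩
    cases l with
    | nil => simp
    | cons x l => cases h
  | node g gens kids ih =>
    refine fun st => ⟨fun h => ?_, fun l h => (by cases h)⟩
    change cond (applicable sp st g) (cond (allOf (validGen sp.d st) gens)
      (check sp hyps kids st (some (survivors gens (options sp st g)))) false) false = true at h
    cases h1 : applicable sp st g with
    | false => rw [h1] at h; cases h
    | true =>
      cases h2 : allOf (validGen sp.d st) gens with
      | false => rw [h1, h2] at h; cases h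
      | true =>
        rw [h1, h2] at h
        exact refuted_of_survivors hd h1 h2 ((ih st).2 _ h)
  | kid m sub rest ih ih' =>
    refine fun st => ⟨fun h => (by cases h), fun l h => ?_⟩
    cases l with
    | nil => cases h
    | cons x l =>
      change cond (Nat.beq m x.2) (cond (check sp hyps sub (extend st x.1 m) none)
        (check sp hyps rest st (some l)) false) false = true at h
      cases h1 : Nat.beq m x.2 with
      | false => rw [h1] at h; cases h
      | true =>
        cases h2 : check sp hyps sub (extend st x.1 m) none with
        | false => rw [h1, h2] at h; cases h
        | true =>
          rw [h1, h2] at h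
          rw [Nat.eq_of_beq_eq_true h1] at h2
          exact List.forall_mem_cons.2 ⟨(ih _).1 h2, (ih' st).2 l h⟩

theorem refuted_of_check (hd : sp.d ≤ 18) {hyps : List State} (hh : ∀ s ∈ hyps, Refuted sp s)
    {c : Cert} (h : check sp hyps c st none = true) : Refuted sp st :=
  (check_sound_aux hd hh c st).1 h

theorem not_isModel_of_refuted (h : Refuted sp ⟨[], [], []⟩) (B : Finset (Finset (Fin 18))) :
    ¬ IsModel sp B :=
  fun hm => h B hm ⟨by simp, by simp, by simp, by simp, by simp⟩

end BlockSearch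

/-! ### The six distributions excluded by search. -/

namespace BlockSearch

set_option maxRecDepth 100000

/-- The case of 22 quadruples. The four triangles through the special point cover nine points, and
the other three triangles partition the remaining nine. -/
def one : Spec := ⟨1, 7, [3, 4, 0, 0], [19, 3, 0, 0, 0]⟩

def oneCert : Cert :=
  .node (.triangle 0) [[(1, 2)], [(2, 3)], [(2, 4)], [(2, 5)], [(2, 6)], [(2, 7)], [(2, 8)], [(2,
  9)], [(2, 10)], [(2, 11)], [(2, 12)], [(2, 13)], [(2, 14)], [(2, 15)], [(2, 16)], [(2, 17)]]
  (.kid 7 (.node (.triangle 0) [[(3, 4)], [(4, 5)], [(4, 6)], [(4, 7)], [(4, 8)], [(4, 9)], [(4,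
  10)], [(4, 11)], [(4, 12)], [(4, 13)], [(4, 14)], [(4, 15)], [(4, 16)], [(4, 17)]] (.kid 25
  (.node (.triangle 0) [[(5, 6)], [(6, 7)], [(6, 8)], [(6, 9)], [(6, 10)], [(6, 11)], [(6, 12)],
  [(6, 13)], [(6, 14)], [(6, 15)], [(6, 16)], [(6, 17)]] (.kid 97 (.node (.triangle 0) [[(7, 8)],
  [(8, 9)], [(8, 10)], [(8, 11)], [(8, 12)], [(8, 13)], [(8, 14)], [(8, 15)], [(8, 16)], [(8,
  17)]] (.kid 385 (.node (.triangle 9) [[(10, 11)], [(11, 12)], [(11, 13)], [(11, 14)], [(11,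
  15)], [(11, 16)], [(11, 17)]] (.kid 3584 (.node (.triangle 12) [[(13, 14)], [(14, 15)], [(14,
  16)], [(14, 17)]] (.kid 28672 (.node (.triangle 15) [] (.kid 229376 (.node (.pair 0 9) [[(12,
  13)], [(12, 14)], [(15, 16)], [(15, 17)]] (.kid 37377 (.node (.pair 3 12) [[(1, 2)], [(10, 11)],
  [(5, 7), (6, 8)], [(1, 5), (2, 6)], [(9, 15), (10, 16), (11, 17)]] (.kid 4138 (.node (.pair 7
  12) [[(10, 11)], [(3, 5), (4, 6)], [(1, 3), (2, 4)], [(9, 15), (10, 16), (11, 17)]] (.kid 4244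
  (.node (.pair 0 10) [[(13, 14)], [(16, 17)]] (.kid 74753 .leaf .done)) (.kid 5252 .leaf (.kid
  70784 (.node (.pair 8 12) [[(3, 5), (4, 6)], [(1, 3), (2, 4)], [(9, 15), (10, 16), (11, 17)]]
  (.kid 4372 .leaf (.kid 6404 .leaf (.kid 137472 .leaf .done)))) .done)))) (.kid 5130 (.node
  (.pair 12 17) [[(5, 6)], [(1, 3), (2, 4)], [(5, 7), (6, 8)]] (.kid 135188 (.node (.pair 11 12)
  [[(5, 6)], [(5, 7), (6, 8)]] (.kid 6304 .leaf (.kid 71712 .leaf .done))) (.kid 135204 (.node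
  (.pair 3 17) [[(7, 8)], [(13, 14)]] (.kid 131272 .leaf (.kid 131656 .leaf (.kid 133192 .leaf
  (.kid 139336 .leaf (.kid 131720 .leaf (.kid 133256 .leaf (.kid 139400 .leaf (.kid 139784 .leaf
  (.kid 141320 .leaf .done)))))))))) (.kid 137220 (.node (.pair 4 12) [[(5, 6)], [(5, 7), (6, 8)]]
  (.kid 4272 .leaf (.kid 69680 .leaf .done))) (.kid 135328 (.node (.pair 11 12) [[(1, 3), (2, 4)],
  [(5, 7), (6, 8)], [(1, 5), (2, 6), (3, 7), (4, 8), (9, 15), (10, 17), (11, 16)]] (.kid 6164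
  .leaf (.kid 6212 .leaf (.kid 71684 .leaf (.kid 6464 .leaf .done))))) (.kid 137248 (.node (.pair
  12 16) [[(7, 8)], [(1, 3), (2, 4)]] (.kid 69652 .leaf (.kid 69700 .leaf (.kid 69764 .leaf (.kid
  69824 .leaf .done))))) .done)))))) (.kid 70664 (.node (.pair 4 12) [[(1, 2)], [(5, 7), (6, 8)],
  [(1, 5), (2, 6)], [(9, 15), (10, 16), (11, 17)]] (.kid 4146 (.node (.pair 2 12) [[(7, 8)], [(9,
  15), (10, 16), (11, 17)]] (.kid 4292 .leaf (.kid 6212 .leaf (.kid 6276 .leaf (.kid 137220 .leaf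
  .done))))) (.kid 6162 (.node (.pair 2 12) [[(5, 6)], [(5, 7), (6, 8)]] (.kid 4260 .leaf (.kid
  135204 .leaf .done))) (.kid 137232 (.node (.pair 1 12) [[(5, 6)], [(7, 8)]] (.kid 4258 .leaf
  .done)) .done)))) .done)))) .done)) .done)) .done)) .done)) .done)) .done)) .done)) .done)

theorem one_check : check one [] oneCert ⟨[], [], []⟩ none = true := by
  decide +kernel

theorem not_isModel_one (B : Finset (Finset (Fin 18))) : ¬ IsModel one B :=
  not_isModel_of_refuted (refuted_of_check (by decide) (by simp) one_check) B

/-- The case of 21 quadruples. The three pairs of special points lie in three different triangles.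
-/
def three : Spec := ⟨3, 9, [0, 6, 3, 0], [12, 9, 0, 0, 0]⟩

def threeCert : Cert :=
  .node (.pair 0 1) [[(3, 4)], [(3, 5)], [(3, 6)], [(3, 7)], [(3, 8)], [(3, 9)], [(3, 10)], [(3,
  11)], [(3, 12)], [(3, 13)], [(3, 14)], [(3, 15)], [(3, 16)], [(3, 17)]] (.kid 11 (.node (.pair 0
  2) [[(4, 5)], [(4, 6)], [(4, 7)], [(4, 8)], [(4, 9)], [(4, 10)], [(4, 11)], [(4, 12)], [(4,
  13)], [(4, 14)], [(4, 15)], [(4, 16)], [(4, 17)]] (.kid 21 (.node (.pair 1 2) [[(5, 6)], [(5,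
  7)], [(5, 8)], [(5, 9)], [(5, 10)], [(5, 11)], [(5, 12)], [(5, 13)], [(5, 14)], [(5, 15)], [(5,
  16)], [(5, 17)]] (.kid 38 (.node (.triangle 0) [[(6, 7)], [(7, 8)], [(7, 9)], [(7, 10)], [(7,
  11)], [(7, 12)], [(7, 13)], [(7, 14)], [(7, 15)], [(7, 16)], [(7, 17)]] (.kid 193 (.node
  (.triangle 0) [[(8, 9)], [(9, 10)], [(9, 11)], [(9, 12)], [(9, 13)], [(9, 14)], [(9, 15)], [(9,
  16)], [(9, 17)]] (.kid 769 (.node (.triangle 1) [[(10, 11)], [(11, 12)], [(11, 13)], [(11, 14)],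
  [(11, 15)], [(11, 16)], [(11, 17)]] (.kid 3074 (.node (.triangle 1) [[(12, 13)], [(13, 14)],
  [(13, 15)], [(13, 16)], [(13, 17)]] (.kid 12290 (.node (.triangle 2) [[(14, 15)], [(15, 16)],
  [(15, 17)]] (.kid 49156 (.node (.triangle 2) [] (.kid 196612 (.node (.pair 0 13) [[(10, 11)],
  [(14, 15)], [(14, 16), (15, 17)], [(1, 2), (3, 4), (10, 16), (10, 13), (10, 14), (11, 17), (11,
  12), (11, 15)]] (.kid 9249 (.node (.pair 1 8) [[(6, 7)], [(14, 15)], [(14, 16), (15, 17)]] (.kid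
  338 (.node (.pair 0 11) [[(14, 15)], [(14, 16), (15, 17)]] (.kid 22529 .leaf (.kid 83969 .leaf
  .done))) (.kid 16658 (.node (.pair 1 15) [[(6, 7)], [(16, 17)]] (.kid 33346 .leaf (.kid 98370
  .leaf (.kid 98818 .leaf .done)))) (.kid 16706 (.node (.pair 0 15) [[(16, 17)], [(10, 13), (11,
  12)]] (.kid 38913 .leaf (.kid 100353 (.node (.pair 13 16) [[(6, 8), (7, 9)]] (.kid 73752 .leaf
  (.kid 73800 .leaf (.kid 73864 .leaf (.kid 90120 .leaf (.kid 73808 .leaf (.kid 73872 .leaf (.kid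
  90128 .leaf (.kid 74112 .leaf (.kid 74368 .leaf (.kid 90240 .leaf .done))))))))))) .done)))
  (.kid 82178 (.node (.pair 1 4) [[(6, 7)], [(14, 16), (15, 17)]] (.kid 594 .leaf (.kid 32850
  .leaf (.kid 33298 .leaf (.kid 163858 .leaf .done))))) .done))))) (.kid 24609 (.node (.pair 1 14)
  [[(6, 7)], [(16, 17)], [(6, 8), (7, 9)]] (.kid 16466 (.node (.pair 1 7) [[(8, 9)], [(16, 17)]]
  (.kid 33154 .leaf (.kid 65922 (.node (.pair 8 14) [[(10, 11)]] (.kid 17672 .leaf (.kid 20744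
  .leaf (.kid 147720 .leaf (.kid 21760 .leaf (.kid 148736 .leaf (.kid 151808 .leaf .done)))))))
  (.kid 98434 .leaf .done)))) (.kid 81938 (.node (.pair 1 15) [[(6, 7)], [(6, 8), (7, 9)]] (.kid
  33090 (.node (.pair 2 12) [[(10, 11)], [(6, 8), (7, 9)]] (.kid 4172 .leaf (.kid 4236 .leaf (.kid
  5132 .leaf (.kid 5188 .leaf (.kid 4484 .leaf (.kid 4740 .leaf (.kid 5252 .leaf .done))))))))
  (.kid 163906 .leaf .done))) (.kid 16706 (.node (.pair 0 15) [[(10, 11)], [(16, 17)]] (.kid 37889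
  .leaf (.kid 99329 (.node (.pair 13 16) [[(6, 8), (7, 9)]] (.kid 73752 .leaf (.kid 73800 .leaf
  (.kid 73864 .leaf (.kid 75784 .leaf (.kid 73808 .leaf (.kid 73872 .leaf (.kid 75792 .leaf (.kid
  75840 .leaf (.kid 74112 .leaf (.kid 74368 .leaf (.kid 75904 .leaf .done)))))))))))) (.kid 102401
  .leaf .done)))) (.kid 81986 (.node (.pair 0 17) [[(10, 11)]] (.kid 136193 (.node (.pair 10 14)
  [[(8, 9)]] (.kid 17432 .leaf (.kid 17544 .leaf (.kid 17672 .leaf (.kid 17552 .leaf (.kid 17680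
  .leaf (.kid 17792 .leaf .done))))))) (.kid 164865 (.node (.pair 1 15) [[(8, 9)]] (.kid 32914
  .leaf (.kid 33042 .leaf (.kid 33154 .leaf .done)))) (.kid 167937 .leaf .done)))) .done)))))
  (.kid 25601 (.node (.pair 2 13) [[(6, 7)], [(6, 8), (7, 9)]] (.kid 8268 (.node (.pair 1 6) [[(8,
  9)], [(16, 17)]] (.kid 338 .leaf (.kid 16466 .leaf (.kid 32850 .leaf (.kid 65618 .leaf (.kid
  16706 .leaf (.kid 33090 (.node (.pair 0 11) [[(16, 17)]] (.kid 6177 .leaf (.kid 34849 .leaf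
  (.kid 67617 .leaf (.kid 38913 .leaf (.kid 71681 .leaf (.kid 100353 .leaf .done))))))) (.kid
  65858 .leaf (.kid 81986 .leaf (.kid 98370 .leaf .done)))))))))) (.kid 10252 (.node (.pair 1 15)
  [[(6, 7)], [(16, 17)], [(6, 8), (7, 9)]] (.kid 32850 .leaf (.kid 98322 .leaf (.kid 33090 .leaf
  (.kid 98370 .leaf .done))))) (.kid 8516 (.node (.pair 1 15) [[(16, 17)], [(6, 8), (7, 9)]] (.kid
  32850 (.node (.pair 0 5) [[(16, 17)]] (.kid 6177 .leaf (.kid 34849 .leaf (.kid 67617 .leaf (.kid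
  36897 .leaf (.kid 69665 .leaf (.kid 98337 .leaf .done))))))) (.kid 32914 .leaf (.kid 98322 .leaf
  (.kid 98370 .leaf (.kid 33154 (.node (.pair 0 12) [[(16, 17)]] (.kid 6177 .leaf (.kid 36897
  .leaf (.kid 69665 .leaf (.kid 38913 .leaf (.kid 71681 .leaf (.kid 102401 .leaf .done)))))))
  (.kid 33410 (.node (.pair 1 14) [[(16, 17)], [(6, 8), (7, 9)]] (.kid 16466 .leaf (.kid 81938
  .leaf (.kid 81986 .leaf .done)))) (.kid 98434 .leaf .done)))))))) (.kid 10308 (.node (.pair 1 7)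
  [[(8, 9)], [(16, 17)], [(0, 2), (3, 5), (6, 14), (7, 15), (8, 16), (9, 17), (10, 11)]] (.kid 402
  .leaf (.kid 16530 .leaf (.kid 32914 (.node (.pair 1 6) [[(8, 9)], [(16, 17)], [(0, 2), (3, 5),
  (6, 14), (7, 15), (8, 16), (9, 17), (10, 11)]] (.kid 16706 .leaf (.kid 65858 .leaf .done)))
  (.kid 65682 (.node (.pair 2 7) [[(8, 9)]] (.kid 396 .leaf (.kid 1164 .leaf (.kid 4236 .leaf
  (.kid 1412 .leaf (.kid 4484 .leaf (.kid 5252 .leaf .done))))))) (.kid 16770 .leaf (.kid 33154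
  .leaf (.kid 65922 .leaf (.kid 82050 (.node (.pair 2 7) [[(8, 9)]] (.kid 396 .leaf (.kid 1164
  .leaf (.kid 4236 .leaf (.kid 1412 .leaf (.kid 4484 .leaf (.kid 5252 .leaf .done)))))))
  .done))))))))) .done))))) .done)))) .done)) .done)) .done)) .done)) .done)) .done)) .done))
  .done)) .done)

theorem three_check : check three [] threeCert ⟨[], [], []⟩ none = true := by
  decide +kernel

theorem not_isModel_three (B : Finset (Finset (Fin 18))) : ¬ IsModel three B :=
  not_isModel_of_refuted (refuted_of_check (by decide) (by simp) three_check) B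

/-- The first of three cases with 20 quadruples: of the ten pairs of special points, nine lie in
different triangles and one in a quadruple. -/
def fiveA : Spec := ⟨5, 11, [0, 2, 9, 0], [6, 13, 1, 0, 0]⟩

def fiveACert : Cert :=
  .node .mixed [[(0, 1)], [(1, 2)], [(1, 3)], [(1, 4)], [(5, 6)], [(6, 7)], [(6, 8)], [(6, 9)],
  [(6, 10)], [(6, 11)], [(6, 12)], [(6, 13)], [(6, 14)], [(6, 15)], [(6, 16)], [(6, 17)]] (.kid 99
  (.node (.pair 0 2) [[(7, 8)], [(7, 9)], [(7, 10)], [(7, 11)], [(7, 12)], [(7, 13)], [(7, 14)],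
  [(7, 15)], [(7, 16)], [(7, 17)]] (.kid 133 (.node (.pair 0 3) [[(8, 9)], [(8, 10)], [(8, 11)],
  [(8, 12)], [(8, 13)], [(8, 14)], [(8, 15)], [(8, 16)], [(8, 17)]] (.kid 265 (.node (.pair 0 4)
  [[(9, 10)], [(9, 11)], [(9, 12)], [(9, 13)], [(9, 14)], [(9, 15)], [(9, 16)], [(9, 17)]] (.kid
  529 (.node (.pair 1 2) [[(10, 11)], [(10, 12)], [(10, 13)], [(10, 14)], [(10, 15)], [(10, 16)],
  [(10, 17)]] (.kid 1030 (.node (.pair 1 3) [[(11, 12)], [(11, 13)], [(11, 14)], [(11, 15)], [(11,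
  16)], [(11, 17)]] (.kid 2058 (.node (.pair 1 4) [[(12, 13)], [(12, 14)], [(12, 15)], [(12, 16)],
  [(12, 17)]] (.kid 4114 (.node (.triangle 0) [[(13, 14)], [(14, 15)], [(14, 16)], [(14, 17)]]
  (.kid 24577 (.node (.triangle 1) [[(15, 16)], [(16, 17)]] (.kid 98306 (.node (.pair 2 3) [[(5,
  6)]] (.kid 44 (.node (.pair 2 4) [] (.kid 84 (.node (.pair 3 4) [] (.kid 131096 (.node (.pair 1
  17) [[(13, 14)], [(3, 4), (5, 6), (8, 9), (11, 12)]] (.kid 131458 .leaf (.kid 139394 (.node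
  (.pair 0 10) [[(15, 16)], [(3, 4), (5, 6), (8, 9), (11, 12)]] (.kid 7169 .leaf (.kid 35841 .leaf
  (.kid 134145 .leaf (.kid 164865 .leaf .done))))) (.kid 131842 .leaf (.kid 139522 (.node (.pair 0
  10) [[(15, 16)]] (.kid 7169 .leaf (.kid 35841 .leaf (.kid 134145 .leaf (.kid 37889 .leaf (.kid
  136193 .leaf (.kid 164865 .leaf .done))))))) .done))))) .done)) (.kid 131092 (.node (.pair 3 4)
  [] (.kid 88 (.node (.pair 1 17) [[(13, 14)], [(2, 4), (5, 6), (7, 9), (10, 12)]] (.kid 131458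
  .leaf (.kid 131714 .leaf (.kid 139394 (.node (.pair 0 10) [[(15, 16)]] (.kid 7169 .leaf (.kid
  35841 .leaf (.kid 134145 .leaf (.kid 37889 .leaf (.kid 136193 .leaf (.kid 164865 .leaf
  .done))))))) (.kid 139522 (.node (.pair 3 13) [[(15, 16)], [(2, 4), (5, 6), (7, 9), (10, 12)]]
  (.kid 8840 .leaf (.kid 9352 .leaf (.kid 41096 .leaf (.kid 9736 .leaf (.kid 13320 .leaf (.kid
  41992 .leaf .done))))))) .done))))) .done)) .done))) (.kid 131084 (.node (.pair 2 4) [[(5, 6)]]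
  (.kid 52 (.node (.pair 3 4) [] (.kid 88 (.node (.pair 1 17) [[(13, 14)], [(2, 3), (5, 6), (7,
  8), (10, 11)]] (.kid 131458 .leaf (.kid 131714 .leaf (.kid 139394 (.node (.pair 0 10) [[(15,
  16)]] (.kid 7169 .leaf (.kid 35841 .leaf (.kid 134145 .leaf (.kid 37889 .leaf (.kid 136193 .leaf
  (.kid 164865 .leaf .done))))))) (.kid 139778 (.node (.pair 4 13) [[(15, 16)], [(2, 3), (5, 6),
  (7, 8), (10, 11)]] (.kid 8592 .leaf (.kid 9360 .leaf (.kid 41104 .leaf (.kid 9488 .leaf (.kid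
  11280 .leaf (.kid 42000 .leaf .done))))))) .done))))) .done)) .done)) .done))) .done)) .done))
  .done)) .done)) .done)) .done)) .done)) .done)) .done)

theorem fiveA_check : check fiveA [] fiveACert ⟨[], [], []⟩ none = true := by
  decide +kernel

theorem not_isModel_fiveA (B : Finset (Finset (Fin 18))) : ¬ IsModel fiveA B :=
  not_isModel_of_refuted (refuted_of_check (by decide) (by simp) fiveA_check) B

/-- One triangle absorbs three of the ten pairs of special points, and seven further triangles
contain one each. -/
def fiveB : Spec := ⟨5, 11, [0, 3, 7, 1], [5, 15, 0, 0, 0]⟩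

def fiveBCert : Cert :=
  .node .inner [[(0, 1)], [(1, 2)], [(2, 3)], [(2, 4)]] (.kid 7 (.node (.pair 0 3) [[(5, 6)], [(5,
  7)], [(5, 8)], [(5, 9)], [(5, 10)], [(5, 11)], [(5, 12)], [(5, 13)], [(5, 14)], [(5, 15)], [(5,
  16)], [(5, 17)]] (.kid 41 (.node (.pair 0 4) [[(6, 7)], [(6, 8)], [(6, 9)], [(6, 10)], [(6,
  11)], [(6, 12)], [(6, 13)], [(6, 14)], [(6, 15)], [(6, 16)], [(6, 17)]] (.kid 81 (.node (.pair 1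
  3) [[(7, 8)], [(7, 9)], [(7, 10)], [(7, 11)], [(7, 12)], [(7, 13)], [(7, 14)], [(7, 15)], [(7,
  16)], [(7, 17)]] (.kid 138 (.node (.pair 1 4) [[(8, 9)], [(8, 10)], [(8, 11)], [(8, 12)], [(8,
  13)], [(8, 14)], [(8, 15)], [(8, 16)], [(8, 17)]] (.kid 274 (.node (.pair 2 3) [[(9, 10)], [(9,
  11)], [(9, 12)], [(9, 13)], [(9, 14)], [(9, 15)], [(9, 16)], [(9, 17)]] (.kid 524 (.node (.pair
  2 4) [[(10, 11)], [(10, 12)], [(10, 13)], [(10, 14)], [(10, 15)], [(10, 16)], [(10, 17)]] (.kid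
  1044 (.node (.pair 3 4) [[(11, 12)], [(11, 13)], [(11, 14)], [(11, 15)], [(11, 16)], [(11, 17)]]
  (.kid 2072 (.node (.triangle 0) [[(12, 13)], [(13, 14)], [(13, 15)], [(13, 16)], [(13, 17)]]
  (.kid 12289 (.node (.triangle 1) [[(14, 15)], [(15, 16)], [(15, 17)]] (.kid 49154 (.node
  (.triangle 2) [] (.kid 196612 (.node (.pair 3 12) [[(14, 15)], [(1, 2), (7, 9), (8, 10), (14,
  16), (15, 17)], [(0, 1), (5, 7), (6, 8), (12, 14), (13, 15)]] (.kid 4424 (.node (.pair 3 10)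
  [[(14, 15)], [(16, 17)]] (.kid 25608 .leaf (.kid 74760 .leaf (.kid 82952 .leaf .done)))) (.kid
  20552 (.node (.pair 3 10) [[(16, 17)]] (.kid 9480 .leaf (.kid 34056 .leaf (.kid 66824 .leaf
  (.kid 41992 .leaf (.kid 74760 .leaf (.kid 99336 (.node (.pair 8 11) [[(0, 2), (5, 9), (6, 10),
  (12, 16), (13, 17), (14, 15)]] (.kid 2433 .leaf (.kid 18689 .leaf (.kid 2340 .leaf (.kid 2372
  .leaf (.kid 6404 .leaf (.kid 10500 .leaf (.kid 18692 .leaf (.kid 2400 .leaf (.kid 2464 .leaf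
  (.kid 2848 .leaf (.kid 6432 .leaf (.kid 10528 .leaf (.kid 18720 .leaf (.kid 2496 .leaf (.kid
  2880 .leaf (.kid 3392 .leaf (.kid 10560 .leaf (.kid 6528 .leaf (.kid 10624 .leaf (.kid 18816
  .leaf (.kid 6912 .leaf (.kid 11008 .leaf (.kid 19200 .leaf (.kid 7424 .leaf (.kid 11520 .leaf
  (.kid 19712 .leaf (.kid 39168 .leaf (.kid 71936 .leaf (.kid 26880 .leaf (.kid 43264 .leaf (.kid
  76032 .leaf (.kid 141568 .leaf .done))))))))))))))))))))))))))))))))) .done))))))) (.kid 5384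
  (.node (.pair 3 6) [[(14, 15)], [(1, 2), (7, 9), (8, 10), (14, 16), (15, 17)]] (.kid 24648 .leaf
  (.kid 81992 (.node (.pair 5 12) [[(1, 2), (7, 9), (8, 10), (14, 16), (15, 17)]] (.kid 4194 .leaf
  (.kid 6178 .leaf (.kid 4260 .leaf (.kid 20516 .leaf (.kid 36900 .leaf (.kid 4272 .leaf (.kid
  20528 .leaf (.kid 36912 .leaf (.kid 4320 .leaf (.kid 6240 .leaf (.kid 36960 .leaf (.kid 4768
  .leaf (.kid 6304 .leaf (.kid 20640 .leaf (.kid 37024 .leaf (.kid 21024 .leaf (.kid 37408 .leaf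
  (.kid 22560 .leaf (.kid 38944 .leaf (.kid 102432 .leaf (.kid 167968 .leaf
  .done)))))))))))))))))))))) .done))) (.kid 21512 (.node (.pair 3 13) [[(16, 17)], [(0, 1), (5,
  7), (6, 8), (12, 14), (13, 15)]] (.kid 8520 .leaf (.kid 41032 .leaf (.kid 73800 .leaf (.kid
  73992 (.node (.pair 0 11) [[(1, 2), (7, 9), (8, 10), (12, 13), (14, 16), (15, 17)]] (.kid 2433
  .leaf (.kid 2689 .leaf (.kid 18561 .leaf (.kid 34945 .leaf (.kid 2817 .leaf (.kid 3329 .leaf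
  (.kid 18689 .leaf (.kid 35073 .leaf (.kid 18945 .leaf (.kid 35329 .leaf (.kid 35841 .leaf (.kid
  83969 .leaf (.kid 100353 .leaf (.kid 165889 .leaf .done))))))))))))))) (.kid 106504 (.node
  (.pair 4 17) [[(0, 1), (5, 7), (6, 8), (12, 14), (13, 15)]] (.kid 131248 .leaf (.kid 131632
  .leaf (.kid 135216 .leaf (.kid 139312 .leaf (.kid 135312 .leaf (.kid 139408 .leaf (.kid 135696
  .leaf (.kid 139792 .leaf (.kid 155664 .leaf .done)))))))))) .done)))))) (.kid 86024 (.node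
  (.pair 4 5) [[(1, 2), (7, 9), (8, 10), (14, 16), (15, 17)], [(0, 1), (5, 7), (6, 8), (12, 14),
  (13, 15)]] (.kid 688 .leaf (.kid 4272 .leaf (.kid 8368 .leaf (.kid 16944 (.node (.pair 1 11)
  [[(0, 2), (5, 9), (6, 10), (12, 16), (13, 17)]] (.kid 2146 .leaf (.kid 6178 .leaf (.kid 10274
  .leaf (.kid 2626 .leaf (.kid 3138 .leaf (.kid 6210 .leaf (.kid 10306 .leaf (.kid 6658 .leaf
  (.kid 10754 .leaf (.kid 7170 .leaf (.kid 11266 .leaf (.kid 75778 .leaf (.kid 141314 .leaf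
  .done)))))))))))))) (.kid 33328 .leaf (.kid 36912 .leaf (.kid 24624 .leaf (.kid 41008 .leaf
  (.kid 98352 .leaf (.kid 163888 .leaf .done))))))))))) .done)))))) .done)) .done)) .done))
  .done)) .done)) .done)) .done)) .done)) .done)) .done)) .done)

theorem fiveB_check : check fiveB [] fiveBCert ⟨[], [], []⟩ none = true := by
  decide +kernel

theorem not_isModel_fiveB (B : Finset (Finset (Fin 18))) : ¬ IsModel fiveB B :=
  not_isModel_of_refuted (refuted_of_check (by decide) (by simp) fiveB_check) B

/-- The ten pairs of special points lie in ten different triangles, and the eleventh triangle has no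
special point. -/
def fiveC : Spec := ⟨5, 11, [1, 0, 10, 0], [5, 15, 0, 0, 0]⟩

def fiveCCert : Cert :=
  .node (.pair 0 1) [[(5, 6)], [(5, 7)], [(5, 8)], [(5, 9)], [(5, 10)], [(5, 11)], [(5, 12)], [(5,
  13)], [(5, 14)], [(5, 15)], [(5, 16)], [(5, 17)]] (.kid 35 (.node (.pair 0 2) [[(6, 7)], [(6,
  8)], [(6, 9)], [(6, 10)], [(6, 11)], [(6, 12)], [(6, 13)], [(6, 14)], [(6, 15)], [(6, 16)], [(6,
  17)]] (.kid 69 (.node (.pair 0 3) [[(7, 8)], [(7, 9)], [(7, 10)], [(7, 11)], [(7, 12)], [(7,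
  13)], [(7, 14)], [(7, 15)], [(7, 16)], [(7, 17)]] (.kid 137 (.node (.pair 0 4) [[(8, 9)], [(8,
  10)], [(8, 11)], [(8, 12)], [(8, 13)], [(8, 14)], [(8, 15)], [(8, 16)], [(8, 17)]] (.kid 273
  (.node (.pair 1 2) [[(9, 10)], [(9, 11)], [(9, 12)], [(9, 13)], [(9, 14)], [(9, 15)], [(9, 16)],
  [(9, 17)]] (.kid 518 (.node (.pair 1 3) [[(10, 11)], [(10, 12)], [(10, 13)], [(10, 14)], [(10,
  15)], [(10, 16)], [(10, 17)]] (.kid 1034 (.node (.pair 1 4) [[(11, 12)], [(11, 13)], [(11, 14)],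
  [(11, 15)], [(11, 16)], [(11, 17)]] (.kid 2066 (.node (.pair 2 3) [[(12, 13)], [(12, 14)], [(12,
  15)], [(12, 16)], [(12, 17)]] (.kid 4108 (.node (.pair 2 4) [[(13, 14)], [(13, 15)], [(13, 16)],
  [(13, 17)]] (.kid 8212 (.node (.pair 3 4) [[(14, 15)], [(14, 16)], [(14, 17)]] (.kid 16408
  (.node (.triangle 15) [] (.kid 229376 (.node (.pair 1 15) [[(3, 4), (7, 8), (10, 11), (12, 13)],
  [(0, 3), (5, 10), (6, 12), (8, 14)], [(2, 4), (6, 8), (9, 11), (12, 14)], [(0, 2), (5, 9), (7,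
  12), (8, 13)]] (.kid 32962 (.node (.pair 1 12) [[(16, 17)], [(2, 3), (6, 7), (9, 10), (13, 14)]]
  (.kid 12546 .leaf (.kid 69890 (.node (.pair 0 16) [[(2, 3), (6, 7), (9, 10), (13, 14)]] (.kid
  67073 .leaf (.kid 68097 .leaf (.kid 74241 .leaf (.kid 74753 .leaf (.kid 75777 .leaf (.kid 90113
  .leaf .done))))))) (.kid 28674 .leaf (.kid 77826 .leaf .done))))) (.kid 37122 (.node (.pair 1
  17) [[(2, 3), (6, 7), (9, 10), (13, 14)], [(0, 2), (3, 4), (5, 9), (7, 13), (8, 12), (10, 11)]]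
  (.kid 131266 (.node (.pair 0 15) [[(2, 3), (6, 7), (9, 10), (13, 14)]] (.kid 34305 .leaf (.kid
  35329 .leaf (.kid 41473 .leaf (.kid 41985 .leaf (.kid 43009 .leaf (.kid 57345 .leaf .done)))))))
  (.kid 139394 (.node (.pair 3 11) [[(0, 2), (5, 9), (7, 12), (8, 13), (15, 17)]] (.kid 2152 .leaf
  (.kid 2344 .leaf (.kid 2600 .leaf (.kid 34856 .leaf (.kid 67624 .leaf (.kid 2376 .leaf (.kid
  34888 .leaf (.kid 67656 .leaf (.kid 2824 .leaf (.kid 10504 .leaf (.kid 67848 .leaf (.kid 35336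
  .leaf (.kid 43016 .leaf .done)))))))))))))) .done))) .done))) .done)) .done)) .done)) .done))
  .done)) .done)) .done)) .done)) .done)) .done)) .done)

theorem fiveC_check : check fiveC [] fiveCCert ⟨[], [], []⟩ none = true := by
  decide +kernel

theorem not_isModel_fiveC (B : Finset (Finset (Fin 18))) : ¬ IsModel fiveC B :=
  not_isModel_of_refuted (refuted_of_check (by decide) (by simp) fiveC_check) B

/-- The one distribution with 19 quadruples left to the search. The 21 pairs of special points split
as `11 + 2 * 3` in triangles and 4 in quadruples. -/
def seven : Spec := ⟨7, 13, [0, 0, 11, 2], [2, 13, 4, 0, 0]⟩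

/-- The tree for `seven` is cut into pieces, the states refuted separately serving as `known` leaves
elsewhere. Here and in `sevenState1` the two triangles of special points, `{0, 1, 2}` and `{0, 3,
4}` (masks 7 and 25), share a point. The mask 66 is the pair `{1, 6}`, left to some quadruple. -/
def sevenState0 : State :=
  ⟨[8212, 4108, 2082, 1042, 522, 321, 161, 25, 7], [], [66]⟩

def sevenCert0 : Cert :=
  .node (.split 2 5) [[(14, 15)], [(14, 16)], [(14, 17)]] (.kid 36 (.node (.triangle 2) [[(14,
  15)], [(14, 16)], [(14, 17)]] (.kid 16452 (.node (.triangle 3) [[(15, 16)], [(15, 17)], [(1, 2),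
  (5, 6), (7, 8), (9, 12), (10, 13), (11, 14)]] (.kid 32808 (.node (.split 3 6) [] (.kid 72 (.node
  (.split 4 5) [[(16, 17)]] (.kid 48 (.node (.triangle 4) [[(16, 17)]] (.kid 65616 (.node
  (.triangle 5) [] (.kid 131168 (.node (.pair 10 12) [[(1, 4), (2, 3), (5, 6), (7, 8), (9, 13),
  (11, 16), (14, 15)], [(1, 2), (3, 4), (5, 6), (7, 8), (9, 13), (10, 12), (11, 14), (15, 16)]]
  (.kid 5633 .leaf (.kid 7169 .leaf (.kid 136193 (.node (.pair 5 9) [[(1, 3), (2, 4), (10, 12),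
  (11, 15), (14, 16)]] (.kid 804 .leaf (.kid 1572 .leaf (.kid 16944 .leaf (.kid 1824 .leaf (.kid
  8992 .leaf (.kid 17184 .leaf (.kid 9760 .leaf (.kid 17952 .leaf (.kid 21024 .leaf (.kid 25120
  .leaf (.kid 82464 .leaf .done)))))))))))) (.kid 5664 .leaf (.kid 5312 .leaf (.kid 5696 (.node
  (.pair 5 8) [[(1, 3), (2, 4), (10, 12), (11, 15), (14, 16)]] (.kid 804 .leaf (.kid 1316 .leaf
  (.kid 16688 .leaf (.kid 8992 .leaf (.kid 17184 .leaf (.kid 9504 .leaf (.kid 17696 .leaf (.kid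
  20768 .leaf (.kid 24864 .leaf (.kid 82208 .leaf .done))))))))))) (.kid 7232 .leaf (.kid 5504
  (.node (.pair 5 9) [[(1, 3), (2, 4), (10, 12), (11, 15), (14, 16)]] (.kid 804 .leaf (.kid 1572
  .leaf (.kid 16944 .leaf (.kid 8992 .leaf (.kid 17184 .leaf (.kid 9760 .leaf (.kid 17952 .leaf
  (.kid 21024 .leaf (.kid 25120 .leaf (.kid 82464 .leaf .done))))))))))) (.kid 5760 .leaf (.kid
  7296 .leaf (.kid 136320 (.node (.pair 7 8) [[(1, 3), (2, 4), (10, 12), (11, 15), (14, 16)]]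
  (.kid 8578 .leaf (.kid 16770 .leaf (.kid 900 .leaf (.kid 2436 .leaf (.kid 2440 .leaf (.kid 16776
  .leaf (.kid 2448 .leaf (.kid 16784 .leaf (.kid 2944 .leaf (.kid 9088 .leaf (.kid 17280 .leaf
  (.kid 10624 .leaf (.kid 18816 .leaf (.kid 35200 .leaf (.kid 24960 .leaf (.kid 49536 .leaf (.kid
  82304 .leaf .done)))))))))))))))))) (.kid 5888 .leaf (.kid 7424 .leaf (.kid 7680 .leaf (.kid
  13824 .leaf (.kid 136704 .leaf (.kid 15360 .leaf (.kid 23552 .leaf (.kid 39936 .leaf (.kid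
  138240 .leaf (.kid 54272 .leaf .done)))))))))))))))))))))) .done)) .done)) (.kid 65584 (.node
  (.split 4 6) [] (.kid 80 (.node (.split 5 6) [] (.kid 96 (.node (.triangle 6) [] .done) .done))
  .done)) .done))) .done)) .done)) .done)) (.kid 16420 (.node (.split 2 6) [] (.kid 68 (.node
  (.split 3 5) [[(15, 16)], [(15, 17)]] (.kid 40 (.node (.triangle 3) [[(15, 16)], [(15, 17)]]
  (.kid 32840 (.node (.split 4 5) [[(16, 17)]] (.kid 48 (.node (.triangle 4) [[(16, 17)]] (.kid
  65616 (.node (.triangle 5) [] (.kid 131168 (.node (.pair 2 17) [[(3, 4), (9, 10), (12, 13), (15,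
  16)]] (.kid 131460 (.node (.pair 5 8) [[(3, 4), (9, 10), (12, 13), (15, 16)]] (.kid 816 .leaf
  (.kid 4400 .leaf (.kid 33072 .leaf (.kid 1824 .leaf (.kid 4896 .leaf (.kid 33568 .leaf (.kid
  5408 .leaf (.kid 34080 .leaf (.kid 12576 .leaf (.kid 37152 .leaf (.kid 41248 .leaf (.kid 98592
  .leaf .done))))))))))))) (.kid 131716 .leaf (.kid 133252 .leaf (.kid 163972 .leaf (.kid 131844
  .leaf (.kid 133380 (.node (.pair 5 8) [[(3, 4), (9, 10), (12, 13), (15, 16)]] (.kid 816 .leaf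
  (.kid 4400 .leaf (.kid 33072 .leaf (.kid 1824 .leaf (.kid 4896 .leaf (.kid 33568 .leaf (.kid
  5408 .leaf (.kid 34080 .leaf (.kid 12576 .leaf (.kid 37152 .leaf (.kid 41248 .leaf (.kid 98592
  .leaf .done))))))))))))) (.kid 164100 .leaf (.kid 132612 .leaf (.kid 133636 .leaf (.kid 164356
  .leaf (.kid 164868 .leaf (.kid 165892 .leaf (.kid 229380 (.node (.pair 1 7) [[(3, 4), (9, 10),
  (12, 13), (15, 16)]] (.kid 4290 .leaf (.kid 16578 .leaf (.kid 4482 .leaf (.kid 16770 .leaf (.kid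
  33154 .leaf (.kid 131458 .leaf (.kid 12418 .leaf (.kid 20610 .leaf (.kid 36994 .leaf (.kid
  135298 .leaf (.kid 41090 .leaf (.kid 49282 .leaf (.kid 147586 .leaf .done))))))))))))))
  .done)))))))))))))) .done)) .done)) (.kid 65584 (.node (.split 4 6) [] (.kid 80 (.node (.split 5
  6) [] (.kid 96 (.node (.triangle 6) [] .done) .done)) .done)) .done))) .done)) (.kid 32808
  (.node (.split 3 6) [] (.kid 72 (.node (.split 4 5) [] (.kid 48 (.node (.split 5 6) [] (.kid 96
  (.node (.triangle 4) [[(16, 17)]] (.kid 65616 (.node (.triangle 6) [] .done) .done)) .done))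
  .done)) .done)) .done))) .done)) .done))

theorem seven_check0 : check seven [] sevenCert0 sevenState0 none = true := by
  decide +kernel

theorem seven_refuted0 : Refuted seven sevenState0 :=
  refuted_of_check (by decide) (by simp) seven_check0

def sevenState1 : State :=
  ⟨[522, 321, 161, 25, 7], [], []⟩

def sevenCert1 : Cert :=
  .node (.split 1 4) [[(10, 11)], [(10, 12)], [(10, 13)], [(10, 14)], [(10, 15)], [(10, 16)],
  [(10, 17)]] (.kid 18 (.node (.triangle 1) [[(5, 6), (7, 8)], [(10, 11)], [(10, 12)], [(10, 13)],
  [(10, 14)], [(10, 15)], [(10, 16)], [(10, 17)]] (.kid 1058 (.node (.triangle 1) [[(11, 12)],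
  [(11, 13)], [(11, 14)], [(11, 15)], [(11, 16)], [(11, 17)]] (.kid 2114 (.node (.split 2 3)
  [[(12, 13)], [(12, 14)], [(12, 15)], [(12, 16)], [(12, 17)]] (.kid 12 (.node (.triangle 3)
  [[(12, 13)], [(12, 14)], [(12, 15)], [(12, 16)], [(12, 17)], [(5, 6), (7, 8), (10, 11)]] (.kid
  4136 (.node (.triangle 3) [[(13, 14)], [(13, 15)], [(13, 16)], [(13, 17)]] (.kid 8264 (.node
  (.split 2 4) [[(14, 15)], [(14, 16)], [(14, 17)]] (.kid 20 (.node (.triangle 2) [[(14, 15)],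
  [(14, 16)], [(14, 17)], [(5, 6), (7, 8), (10, 11), (12, 13)]] (.kid 16420 (.node (.split 4 5) []
  (.kid 48 (.node (.split 5 6) [] (.kid 96 (.node (.triangle 2) [[(15, 16)], [(15, 17)]] (.kid
  32836 (.node (.split 4 6) [] (.kid 80 (.node (.triangle 2) [] .done) .done)) .done)) .done))
  .done)) .done)) (.kid 16404 (.node (.triangle 2) [[(15, 16)], [(15, 17)], [(5, 6), (7, 8), (10,
  11), (12, 13)]] (.kid 32804 (.node (.split 4 5) [] (.kid 48 (.node (.split 5 6) [] (.kid 96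
  (.node (.triangle 2) [[(16, 17)]] (.kid 65604 (.node (.split 4 6) [] (.kid 80 (.node (.triangle
  4) [] .done) .done)) .done)) .done)) .done)) .done)) .done))) .done)) .done)) (.kid 4108 (.node
  (.triangle 3) [[(13, 14)], [(13, 15)], [(13, 16)], [(13, 17)], [(5, 6), (7, 8), (10, 11)]] (.kid
  8232 (.node (.split 3 6) [] (.kid 72 (.node (.split 2 4) [[(14, 15)], [(14, 16)], [(14, 17)]]
  (.kid 20 (.node (.split 2 5) [[(14, 15)], [(14, 16)], [(14, 17)]] (.kid 36 (.node (.triangle 2)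
  [[(14, 15)], [(14, 16)], [(14, 17)]] (.kid 16452 (.node (.triangle 2) [] .done) .done)) (.kid
  16420 (.node (.split 4 5) [] (.kid 48 (.node (.split 5 6) [] (.kid 96 (.node (.triangle 2)
  [[(15, 16)], [(15, 17)]] (.kid 32836 (.node (.triangle 4) [[(16, 17)]] (.kid 65616 (.node
  (.triangle 4) [] .done) .done)) .done)) .done)) .done)) .done))) (.kid 16404 (.node (.split 2 5)
  [[(15, 16)], [(15, 17)]] (.kid 36 (.node (.triangle 2) [[(15, 16)], [(15, 17)]] (.kid 32836
  (.node (.split 4 5) [[(16, 17)]] (.kid 48 (.node (.triangle 4) [[(16, 17)]] (.kid 65616 (.node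
  (.split 5 6) [] (.kid 96 (.node (.triangle 4) [] .done) .done)) .done)) (.kid 65584 (.node
  (.split 5 6) [] (.kid 96 (.node (.triangle 4) [] (.kid 131152 (.node (.pair 11 16) [[(1, 4), (2,
  3), (5, 6), (7, 8), (9, 14), (10, 17), (11, 16), (13, 15)]] (.kid 68097 .leaf (.kid 68609 .leaf
  (.kid 71681 .leaf (.kid 75777 .leaf (.kid 67716 .leaf (.kid 68100 .leaf (.kid 68612 .leaf (.kid
  75780 .leaf (.kid 67720 .leaf (.kid 68616 .leaf (.kid 67968 .leaf (.kid 68224 .leaf (.kid 68736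
  .leaf (.kid 71808 .leaf (.kid 75904 .leaf (.kid 68352 .leaf (.kid 68864 .leaf (.kid 76032 .leaf
  (.kid 69120 .leaf (.kid 72192 .leaf (.kid 76288 .leaf (.kid 84480 .leaf (.kid 72704 .leaf (.kid
  76800 .leaf (.kid 84992 .leaf (.kid 101376 .leaf (.kid 199680 .leaf (.kid 79872 .leaf (.kid
  92160 .leaf (.kid 108544 .leaf .done))))))))))))))))))))))))))))))) .done)) .done)) .done)))
  .done)) (.kid 32804 (.node (.split 2 6) [] (.kid 68 (.node (.split 4 5) [] (.kid 48 (.node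
  (.split 5 6) [] (.kid 96 (.node (.triangle 4) [[(16, 17)]] (.kid 65616 (.node (.triangle 4) []
  .done) .done)) .done)) .done)) .done)) .done))) .done))) .done)) .done)) .done))) .done))
  .done)) (.kid 1042 (.node (.triangle 1) [[(5, 6), (7, 8)], [(11, 12)], [(11, 13)], [(11, 14)],
  [(11, 15)], [(11, 16)], [(11, 17)]] (.kid 2082 (.node (.split 1 6) [] (.kid 66 (.node (.split 2
  3) [[(12, 13)], [(12, 14)], [(12, 15)], [(12, 16)], [(12, 17)]] (.kid 12 (.node (.split 2 4)
  [[(12, 13)], [(12, 14)], [(12, 15)], [(12, 16)], [(12, 17)]] (.kid 20 (.node (.split 2 5) [[(12,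
  13)], [(12, 14)], [(12, 15)], [(12, 16)], [(12, 17)]] (.kid 36 (.node (.triangle 2) [[(12, 13)],
  [(12, 14)], [(12, 15)], [(12, 16)], [(12, 17)]] (.kid 4164 (.node (.triangle 2) [] .done)
  .done)) (.kid 4132 (.node (.triangle 2) [[(13, 14)], [(13, 15)], [(13, 16)], [(13, 17)]] (.kid
  8260 (.node (.triangle 2) [] .done) .done)) .done))) (.kid 4116 (.node (.split 2 5) [[(13, 14)],
  [(13, 15)], [(13, 16)], [(13, 17)]] (.kid 36 (.node (.triangle 2) [[(13, 14)], [(13, 15)], [(13,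
  16)], [(13, 17)]] (.kid 8260 (.node (.triangle 2) [] .done) .done)) (.kid 8228 (.node (.triangle
  2) [[(14, 15)], [(14, 16)], [(14, 17)]] (.kid 16452 (.node (.split 3 5) [[(15, 16)], [(15, 17)]]
  (.kid 40 (.node (.triangle 3) [[(15, 16)], [(15, 17)]] (.kid 32840 (.node (.triangle 3) []
  .done) .done)) (.kid 32808 (.node (.split 4 5) [] (.kid 48 (.node (.split 5 6) [] (.kid 96
  (.node (.triangle 3) [[(16, 17)]] (.kid 65608 (.node (.triangle 4) [] (.kid 131152 (.node (.pair
  13 16) [[(1, 4), (2, 3), (5, 6), (7, 8), (9, 12), (11, 17), (13, 16), (14, 15)]] (.kid 74241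
  .leaf (.kid 74753 .leaf (.kid 75777 .leaf (.kid 90113 .leaf (.kid 73858 .leaf (.kid 90114 .leaf
  (.kid 73872 .leaf (.kid 74256 .leaf (.kid 75792 .leaf (.kid 90128 .leaf (.kid 74112 .leaf (.kid
  74368 .leaf (.kid 74880 .leaf (.kid 75904 .leaf (.kid 90240 .leaf (.kid 74496 .leaf (.kid 76032
  .leaf (.kid 90368 .leaf (.kid 75264 .leaf (.kid 76288 .leaf (.kid 78336 .leaf (.kid 90624 .leaf
  (.kid 76800 .leaf (.kid 91136 .leaf (.kid 79872 .leaf (.kid 92160 .leaf (.kid 108544 .leaf (.kid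
  206848 .leaf (.kid 94208 .leaf (.kid 122880 .leaf .done))))))))))))))))))))))))))))))) .done))
  .done)) .done)) .done)) .done))) .done)) .done))) .done))) (.kid 4108 (.node (.split 2 4) [[(13,
  14)], [(13, 15)], [(13, 16)], [(13, 17)]] (.kid 20 (.node (.split 2 5) [[(13, 14)], [(13, 15)],
  [(13, 16)], [(13, 17)]] (.kid 36 (.node (.triangle 2) [[(13, 14)], [(13, 15)], [(13, 16)], [(13,
  17)]] (.kid 8260 (.node (.triangle 2) [] .done) .done)) (.kid 8228 (.node (.triangle 2) [[(14,
  15)], [(14, 16)], [(14, 17)]] (.kid 16452 (.node (.split 3 5) [[(15, 16)], [(15, 17)]] (.kid 40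
  (.node (.triangle 3) [[(15, 16)], [(15, 17)]] (.kid 32840 (.node (.split 4 5) [[(16, 17)]] (.kid
  48 (.node (.triangle 4) [[(16, 17)]] (.kid 65616 (.node (.split 5 6) [] (.kid 96 (.node
  (.triangle 4) [] .done) .done)) .done)) (.kid 65584 (.node (.split 5 6) [] (.kid 96 (.node
  (.triangle 4) [] (.kid 131152 (.node (.pair 13 17) [[(1, 3), (2, 4), (5, 6), (7, 8), (10, 12),
  (11, 15), (13, 17), (14, 16)]] (.kid 139777 .leaf (.kid 140289 .leaf (.kid 141313 .leaf (.kid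
  155649 .leaf (.kid 139394 .leaf (.kid 155650 .leaf (.kid 139400 .leaf (.kid 140296 .leaf (.kid
  141320 .leaf (.kid 155656 .leaf (.kid 139648 .leaf (.kid 139904 .leaf (.kid 140416 .leaf (.kid
  141440 .leaf (.kid 155776 .leaf (.kid 140544 .leaf (.kid 141568 .leaf (.kid 155904 .leaf (.kid
  140800 .leaf (.kid 141824 .leaf (.kid 156160 .leaf (.kid 142336 .leaf (.kid 144384 .leaf (.kid
  156672 .leaf (.kid 145408 .leaf (.kid 157696 .leaf (.kid 174080 .leaf (.kid 159744 .leaf (.kid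
  188416 .leaf (.kid 221184 .leaf .done))))))))))))))))))))))))))))))) .done)) .done)) .done)))
  .done)) (.kid 32808 (.node (.split 3 6) [] (.kid 72 (.node (.split 4 5) [] (.kid 48 (.node
  (.split 5 6) [] (.kid 96 (.node (.triangle 4) [[(16, 17)]] (.kid 65616 (.node (.triangle 4) []
  .done) .done)) .done)) .done)) .done)) .done))) .done)) .done))) (.kid 8212 .known .done)))
  .done))) .done)) .done)) .done))

theorem seven_check1 : check seven [sevenState0] sevenCert1 sevenState1 none = true := by
  decide +kernel

theorem seven_refuted1 : Refuted seven sevenState1 :=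
  refuted_of_check (by decide) (by simpa using seven_refuted0) seven_check1

/-- Here and in `sevenState3` the two triangles of special points are disjoint: `{0, 1, 2}` and `{3,
4, 5}`, with masks 7 and 56. The mask 33 is the pair `{0, 5}`, left to some quadruple. -/
def sevenState2 : State :=
  ⟨[2066, 1034, 529, 265, 193, 56, 7], [], [33]⟩

def sevenCert2 : Cert :=
  .node (.split 1 5) [[(12, 13)], [(12, 14)], [(12, 15)], [(12, 16)], [(12, 17)]] (.kid 34 (.node
  (.triangle 1) [[(12, 13)], [(12, 14)], [(12, 15)], [(12, 16)], [(12, 17)]] (.kid 4162 (.node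
  (.split 2 3) [[(13, 14)], [(13, 15)], [(13, 16)], [(13, 17)]] (.kid 12 (.node (.triangle 3)
  [[(13, 14)], [(13, 15)], [(13, 16)], [(13, 17)]] (.kid 8264 (.node (.split 2 4) [[(14, 15)],
  [(14, 16)], [(14, 17)]] (.kid 20 (.node (.triangle 4) [[(14, 15)], [(14, 16)], [(14, 17)]] (.kid
  16464 (.node (.split 2 6) [] (.kid 68 (.node (.split 5 6) [] (.kid 96 (.node (.triangle 2)
  [[(15, 16)], [(15, 17)]] (.kid 32804 (.node (.triangle 2) [] .done) .done)) .done)) .done))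
  .done)) (.kid 16404 (.node (.split 4 6) [] (.kid 80 (.node (.split 2 5) [[(15, 16)], [(15, 17)]]
  (.kid 36 (.node (.triangle 2) [[(15, 16)], [(15, 17)]] (.kid 32836 (.node (.split 5 6) [] (.kid
  96 (.node (.triangle 2) [] .done) .done)) .done)) (.kid 32804 (.node (.triangle 2) [[(16, 17)]]
  (.kid 65604 (.node (.split 5 6) [] (.kid 96 (.node (.triangle 5) [] .done) .done)) .done))
  .done))) .done)) .done))) .done)) (.kid 8204 (.node (.split 3 6) [] (.kid 72 (.node (.split 2 4)
  [[(14, 15)], [(14, 16)], [(14, 17)]] (.kid 20 (.node (.triangle 4) [[(14, 15)], [(14, 16)],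
  [(14, 17)]] (.kid 16464 (.node (.split 2 5) [[(15, 16)], [(15, 17)]] (.kid 36 (.node (.triangle
  2) [[(15, 16)], [(15, 17)]] (.kid 32836 (.node (.split 5 6) [] (.kid 96 (.node (.triangle 2) []
  .done) .done)) .done)) (.kid 32804 (.node (.triangle 2) [[(16, 17)]] (.kid 65604 (.node (.split
  5 6) [] (.kid 96 (.node (.triangle 5) [] .done) .done)) .done)) .done))) .done)) (.kid 16404
  (.node (.split 4 6) [] (.kid 80 (.node (.split 2 5) [[(15, 16)], [(15, 17)]] (.kid 36 (.node
  (.triangle 2) [[(15, 16)], [(15, 17)]] (.kid 32836 (.node (.triangle 5) [[(16, 17)]] (.kid 65632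
  (.node (.triangle 5) [] .done) .done)) .done)) (.kid 32804 (.node (.split 2 6) [] (.kid 68
  (.node (.triangle 5) [[(16, 17)]] (.kid 65632 (.node (.triangle 5) [] .done) .done)) .done))
  .done))) .done)) .done))) .done)) .done))) .done)) (.kid 4130 (.node (.split 1 6) [] (.kid 66
  (.node (.split 2 3) [[(13, 14)], [(13, 15)], [(13, 16)], [(13, 17)]] (.kid 12 (.node (.triangle
  3) [[(13, 14)], [(13, 15)], [(13, 16)], [(13, 17)]] (.kid 8264 (.node (.split 2 4) [[(14, 15)],
  [(14, 16)], [(14, 17)]] (.kid 20 (.node (.triangle 4) [[(14, 15)], [(14, 16)], [(14, 17)]] (.kid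
  16464 (.node (.split 2 5) [[(15, 16)], [(15, 17)]] (.kid 36 (.node (.triangle 2) [[(15, 16)],
  [(15, 17)]] (.kid 32836 (.node (.split 5 6) [] (.kid 96 (.node (.triangle 2) [] .done) .done))
  .done)) (.kid 32804 (.node (.triangle 2) [[(16, 17)]] (.kid 65604 (.node (.split 5 6) [] (.kid
  96 (.node (.triangle 2) [] .done) .done)) .done)) .done))) .done)) (.kid 16404 (.node (.split 4
  6) [] (.kid 80 (.node (.triangle 6) [[(15, 16)], [(15, 17)], [(0, 3), (1, 4), (2, 5), (7, 13),
  (9, 10), (12, 14)]] (.kid 32836 (.node (.triangle 2) [[(16, 17)]] (.kid 65572 (.node (.triangle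
  5) [] (.kid 131168 (.node (.pair 8 16) [[(0, 3), (1, 4), (2, 5), (7, 13), (9, 10), (12, 14),
  (15, 17)], [(0, 5), (1, 4), (2, 3), (7, 17), (8, 16), (9, 12), (10, 14), (13, 15)]] (.kid 65858
  .leaf (.kid 65922 .leaf (.kid 66306 .leaf (.kid 65936 .leaf (.kid 66368 .leaf (.kid 67904 .leaf
  (.kid 66432 .leaf (.kid 66944 .leaf (.kid 67968 .leaf (.kid 70016 .leaf (.kid 74112 .leaf (.kid
  98688 .leaf (.kid 67328 .leaf (.kid 68352 .leaf (.kid 70400 .leaf (.kid 70912 .leaf (.kid 78080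
  .leaf (.kid 106752 .leaf .done))))))))))))))))))) .done)) .done)) .done)) .done)) .done)))
  .done)) (.kid 8204 (.node (.split 3 6) [] (.kid 72 (.node (.split 2 4) [[(14, 15)], [(14, 16)],
  [(14, 17)]] (.kid 20 (.node (.triangle 4) [[(14, 15)], [(14, 16)], [(14, 17)]] (.kid 16464
  (.node (.triangle 6) [[(15, 16)], [(15, 17)], [(0, 4), (1, 3), (2, 5), (7, 14), (8, 11), (12,
  13)]] (.kid 32836 (.node (.triangle 2) [[(16, 17)]] (.kid 65572 (.node (.triangle 5) [] (.kid
  131168 (.node (.pair 9 16) [[(0, 4), (1, 3), (2, 5), (7, 14), (8, 11), (12, 13), (15, 17)], [(0,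
  5), (1, 3), (2, 4), (7, 17), (8, 12), (9, 16), (11, 13), (14, 15)]] (.kid 66114 .leaf (.kid
  66178 .leaf (.kid 66306 .leaf (.kid 66184 .leaf (.kid 66368 .leaf (.kid 67136 .leaf (.kid 66432
  .leaf (.kid 67200 .leaf (.kid 68224 .leaf (.kid 70272 .leaf (.kid 74368 .leaf (.kid 82560 .leaf
  (.kid 98944 .leaf (.kid 67328 .leaf (.kid 68352 .leaf (.kid 70400 .leaf (.kid 72192 .leaf (.kid
  115200 .leaf .done))))))))))))))))))) .done)) .done)) .done)) .done)) (.kid 16404 (.node (.split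
  4 6) [] (.kid 80 (.node (.split 2 5) [[(15, 16)], [(15, 17)]] (.kid 36 (.node (.triangle 2)
  [[(15, 16)], [(15, 17)]] (.kid 32836 (.node (.triangle 5) [[(16, 17)]] (.kid 65632 (.node
  (.triangle 5) [] .done) .done)) .done)) (.kid 32804 (.node (.split 2 6) [] (.kid 68 (.node
  (.triangle 5) [[(16, 17)]] (.kid 65632 (.node (.triangle 6) [] .done) .done)) .done)) .done)))
  .done)) .done))) .done)) .done))) .done)) .done))

theorem seven_check2 : check seven [] sevenCert2 sevenState2 none = true := by
  decide +kernel

theorem seven_refuted2 : Refuted seven sevenState2 :=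
  refuted_of_check (by decide) (by simp) seven_check2

def sevenState3 : State :=
  ⟨[529, 265, 193, 56, 7], [], [33]⟩

def sevenCert3 : Cert :=
  .node (.split 1 3) [[(10, 11)], [(10, 12)], [(10, 13)], [(10, 14)], [(10, 15)], [(10, 16)],
  [(10, 17)]] (.kid 10 (.node (.split 1 4) [[(10, 11)], [(10, 12)], [(10, 13)], [(10, 14)], [(10,
  15)], [(10, 16)], [(10, 17)]] (.kid 18 (.node (.split 1 5) [[(10, 11)], [(10, 12)], [(10, 13)],
  [(10, 14)], [(10, 15)], [(10, 16)], [(10, 17)]] (.kid 34 (.node (.triangle 1) [[(10, 11)], [(10,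
  12)], [(10, 13)], [(10, 14)], [(10, 15)], [(10, 16)], [(10, 17)]] (.kid 1090 (.node (.triangle
  1) [] .done) .done)) (.kid 1058 (.node (.triangle 1) [[(11, 12)], [(11, 13)], [(11, 14)], [(11,
  15)], [(11, 16)], [(11, 17)]] (.kid 2114 (.node (.triangle 1) [] .done) .done)) .done))) (.kid
  1042 (.node (.split 1 5) [[(11, 12)], [(11, 13)], [(11, 14)], [(11, 15)], [(11, 16)], [(11,
  17)]] (.kid 34 (.node (.triangle 1) [[(11, 12)], [(11, 13)], [(11, 14)], [(11, 15)], [(11, 16)],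
  [(11, 17)]] (.kid 2114 (.node (.triangle 1) [] .done) .done)) (.kid 2082 (.node (.triangle 1)
  [[(12, 13)], [(12, 14)], [(12, 15)], [(12, 16)], [(12, 17)]] (.kid 4162 (.node (.split 2 3)
  [[(13, 14)], [(13, 15)], [(13, 16)], [(13, 17)]] (.kid 12 (.node (.triangle 3) [[(13, 14)],
  [(13, 15)], [(13, 16)], [(13, 17)]] (.kid 8264 (.node (.triangle 3) [] .done) .done)) (.kid 8204
  (.node (.triangle 3) [[(14, 15)], [(14, 16)], [(14, 17)]] (.kid 16456 (.node (.split 2 4) [[(15,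
  16)], [(15, 17)]] (.kid 20 (.node (.triangle 4) [[(15, 16)], [(15, 17)]] (.kid 32848 (.node
  (.split 2 6) [] (.kid 68 (.node (.split 5 6) [] (.kid 96 (.node (.triangle 2) [[(16, 17)]] (.kid
  65572 (.node (.triangle 2) [] .done) .done)) .done)) .done)) .done)) (.kid 32788 (.node (.split
  4 6) [] (.kid 80 (.node (.split 2 5) [[(16, 17)]] (.kid 36 (.node (.triangle 2) [[(16, 17)]]
  (.kid 65604 (.node (.split 5 6) [] (.kid 96 (.node (.triangle 5) [] .done) .done)) .done)) (.kid
  65572 (.node (.split 2 6) [] (.kid 68 (.node (.triangle 5) [] (.kid 131168 (.node (.pair 8 11)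
  [[(0, 3), (1, 5), (2, 4), (7, 14), (9, 13), (10, 16), (12, 17)], [(0, 1), (3, 5), (7, 12), (8,
  11), (9, 10), (13, 16), (14, 17)], [(0, 5), (1, 3), (2, 4), (7, 17), (8, 11), (9, 16), (10, 13),
  (12, 14)]] (.kid 2372 .leaf (.kid 2436 .leaf (.kid 2820 .leaf (.kid 2448 .leaf (.kid 2880 .leaf
  (.kid 35136 .leaf (.kid 2944 .leaf (.kid 3456 .leaf (.kid 6528 .leaf (.kid 10624 .leaf (.kid
  18816 .leaf (.kid 35200 .leaf (.kid 3840 .leaf (.kid 11008 .leaf (.kid 35584 .leaf (.kid 11520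
  .leaf (.kid 14592 .leaf (.kid 22784 .leaf .done))))))))))))))))))) .done)) .done)) .done)))
  .done)) .done))) .done)) .done))) .done)) .done))) .done))) (.kid 1034 (.node (.split 1 4)
  [[(11, 12)], [(11, 13)], [(11, 14)], [(11, 15)], [(11, 16)], [(11, 17)]] (.kid 18 (.node (.split
  1 5) [[(11, 12)], [(11, 13)], [(11, 14)], [(11, 15)], [(11, 16)], [(11, 17)]] (.kid 34 (.node
  (.triangle 1) [[(11, 12)], [(11, 13)], [(11, 14)], [(11, 15)], [(11, 16)], [(11, 17)]] (.kid
  2114 (.node (.triangle 1) [] .done) .done)) (.kid 2082 (.node (.triangle 1) [[(12, 13)], [(12,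
  14)], [(12, 15)], [(12, 16)], [(12, 17)]] (.kid 4162 (.node (.split 2 3) [[(13, 14)], [(13,
  15)], [(13, 16)], [(13, 17)]] (.kid 12 (.node (.triangle 3) [[(13, 14)], [(13, 15)], [(13, 16)],
  [(13, 17)]] (.kid 8264 (.node (.split 2 4) [[(14, 15)], [(14, 16)], [(14, 17)]] (.kid 20 (.node
  (.triangle 4) [[(14, 15)], [(14, 16)], [(14, 17)]] (.kid 16464 (.node (.split 2 6) [] (.kid 68
  (.node (.split 5 6) [] (.kid 96 (.node (.triangle 2) [[(15, 16)], [(15, 17)]] (.kid 32804 (.node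
  (.triangle 2) [] .done) .done)) .done)) .done)) .done)) (.kid 16404 (.node (.triangle 4) [[(15,
  16)], [(15, 17)]] (.kid 32848 (.node (.split 2 6) [] (.kid 68 (.node (.split 5 6) [] (.kid 96
  (.node (.triangle 2) [[(16, 17)]] (.kid 65572 (.node (.triangle 2) [] .done) .done)) .done))
  .done)) .done)) .done))) .done)) (.kid 8204 (.node (.split 3 6) [] (.kid 72 (.node (.split 2 4)
  [[(14, 15)], [(14, 16)], [(14, 17)]] (.kid 20 (.node (.triangle 4) [[(14, 15)], [(14, 16)],
  [(14, 17)]] (.kid 16464 (.node (.triangle 4) [] .done) .done)) (.kid 16404 (.node (.triangle 4)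
  [[(15, 16)], [(15, 17)]] (.kid 32848 (.node (.split 2 5) [[(16, 17)]] (.kid 36 (.node (.triangle
  2) [[(16, 17)]] (.kid 65604 (.node (.split 5 6) [] (.kid 96 (.node (.triangle 5) [] .done)
  .done)) .done)) (.kid 65572 (.node (.split 2 6) [] (.kid 68 (.node (.triangle 5) [] (.kid 131168
  (.node (.pair 9 11) [[(0, 4), (1, 5), (2, 3), (7, 15), (8, 14), (10, 16), (12, 17)], [(0, 1),
  (4, 5), (7, 12), (8, 10), (9, 11), (14, 16), (15, 17)], [(0, 5), (1, 4), (2, 3), (7, 17), (8,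
  16), (9, 11), (10, 14), (12, 15)]] (.kid 2628 .leaf (.kid 2692 .leaf (.kid 2820 .leaf (.kid 2696
  .leaf (.kid 2880 .leaf (.kid 10816 .leaf (.kid 2944 .leaf (.kid 3712 .leaf (.kid 6784 .leaf
  (.kid 10880 .leaf (.kid 19072 .leaf (.kid 35456 .leaf (.kid 3840 .leaf (.kid 11008 .leaf (.kid
  19200 .leaf (.kid 19968 .leaf (.kid 23040 .leaf (.kid 39424 .leaf .done)))))))))))))))))))
  .done)) .done)) .done))) .done)) .done))) .done)) .done))) .done)) .done))) (.kid 2066 .known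
  .done))) .done))

theorem seven_check3 : check seven [sevenState2] sevenCert3 sevenState3 none = true := by
  decide +kernel

theorem seven_refuted3 : Refuted seven sevenState3 :=
  refuted_of_check (by decide) (by simpa using seven_refuted2) seven_check3

/-- After `{0, 1, 2}` the second triangle of special points meets it in one point (branch 25) or not
at all (branch 56); these branches reach `sevenState1` and `sevenState3`. -/
def sevenCert : Cert :=
  .node .inner [[(0, 1)], [(1, 2)], [(2, 3)], [(2, 4)], [(2, 5)], [(2, 6)]] (.kid 7 (.node .inner
  [[(3, 4)], [(4, 5)], [(5, 6)], [(0, 1)], [(0, 2)]] (.kid 25 (.node (.triangle 0) [[(5, 6)], [(7,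
  8)], [(7, 9)], [(7, 10)], [(7, 11)], [(7, 12)], [(7, 13)], [(7, 14)], [(7, 15)], [(7, 16)], [(7,
  17)]] (.kid 161 (.node (.triangle 0) [[(8, 9)], [(8, 10)], [(8, 11)], [(8, 12)], [(8, 13)], [(8,
  14)], [(8, 15)], [(8, 16)], [(8, 17)]] (.kid 321 (.node (.split 1 3) [[(9, 10)], [(9, 11)], [(9,
  12)], [(9, 13)], [(9, 14)], [(9, 15)], [(9, 16)], [(9, 17)]] (.kid 10 (.node (.split 1 4) [[(9,
  10)], [(9, 11)], [(9, 12)], [(9, 13)], [(9, 14)], [(9, 15)], [(9, 16)], [(9, 17)]] (.kid 18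
  (.node (.triangle 1) [[(5, 6), (7, 8)], [(9, 10)], [(9, 11)], [(9, 12)], [(9, 13)], [(9, 14)],
  [(9, 15)], [(9, 16)], [(9, 17)]] (.kid 546 (.node (.triangle 1) [[(10, 11)], [(10, 12)], [(10,
  13)], [(10, 14)], [(10, 15)], [(10, 16)], [(10, 17)]] (.kid 1090 (.node (.triangle 1) [] .done)
  .done)) .done)) (.kid 530 (.node (.triangle 1) [[(5, 6), (7, 8)], [(10, 11)], [(10, 12)], [(10,
  13)], [(10, 14)], [(10, 15)], [(10, 16)], [(10, 17)]] (.kid 1058 (.node (.triangle 1) [[(11,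
  12)], [(11, 13)], [(11, 14)], [(11, 15)], [(11, 16)], [(11, 17)]] (.kid 2114 (.node (.split 2 3)
  [[(12, 13)], [(12, 14)], [(12, 15)], [(12, 16)], [(12, 17)]] (.kid 12 (.node (.triangle 3)
  [[(12, 13)], [(12, 14)], [(12, 15)], [(12, 16)], [(12, 17)], [(5, 6), (7, 8), (10, 11)]] (.kid
  4136 (.node (.triangle 3) [[(13, 14)], [(13, 15)], [(13, 16)], [(13, 17)]] (.kid 8264 (.node
  (.triangle 3) [] .done) .done)) .done)) (.kid 4108 (.node (.triangle 3) [[(13, 14)], [(13, 15)],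
  [(13, 16)], [(13, 17)], [(5, 6), (7, 8), (10, 11)]] (.kid 8232 (.node (.triangle 3) [[(14, 15)],
  [(14, 16)], [(14, 17)]] (.kid 16456 (.node (.split 2 4) [[(15, 16)], [(15, 17)]] (.kid 20 (.node
  (.triangle 2) [[(15, 16)], [(15, 17)], [(5, 6), (7, 8), (10, 11), (13, 14)]] (.kid 32804 (.node
  (.split 4 5) [] (.kid 48 (.node (.split 5 6) [] (.kid 96 (.node (.triangle 2) [[(16, 17)]] (.kid
  65604 (.node (.split 4 6) [] (.kid 80 (.node (.triangle 4) [] .done) .done)) .done)) .done))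
  .done)) .done)) (.kid 32788 (.node (.triangle 2) [[(16, 17)], [(5, 6), (7, 8), (10, 11), (13,
  14)]] (.kid 65572 (.node (.split 2 6) [] (.kid 68 (.node (.split 4 5) [] (.kid 48 (.node (.split
  5 6) [] (.kid 96 (.node (.triangle 4) [] (.kid 131152 (.node (.pair 10 14) [[(1, 3), (2, 4), (5,
  6), (7, 8), (9, 12), (10, 14), (11, 13), (16, 17)]] (.kid 17921 .leaf (.kid 19457 .leaf (.kid
  50177 .leaf (.kid 82945 .leaf (.kid 17540 .leaf (.kid 17924 .leaf (.kid 19460 .leaf (.kid 17552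
  .leaf (.kid 19472 .leaf (.kid 82960 .leaf (.kid 17792 .leaf (.kid 18048 .leaf (.kid 19584 .leaf
  (.kid 50304 .leaf (.kid 83072 .leaf (.kid 18176 .leaf (.kid 19712 .leaf (.kid 83200 .leaf (.kid
  19968 .leaf (.kid 22016 .leaf (.kid 50688 .leaf (.kid 83456 .leaf (.kid 23552 .leaf (.kid 27648
  .leaf (.kid 52224 .leaf (.kid 84992 .leaf (.kid 87040 .leaf (.kid 91136 .leaf (.kid 115712 .leaf
  (.kid 214016 .leaf .done))))))))))))))))))))))))))))))) .done)) .done)) .done)) .done)) .done))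
  .done))) .done)) .done)) .done))) .done)) .done)) .done))) (.kid 522 .known .done))) .done))
  .done)) (.kid 56 (.node (.triangle 6) [[(0, 1)], [(0, 2)], [(0, 3), (1, 4), (2, 5)], [(7, 8)],
  [(7, 9)], [(7, 10)], [(7, 11)], [(7, 12)], [(7, 13)], [(7, 14)], [(7, 15)], [(7, 16)], [(7,
  17)]] (.kid 193 (.node (.triangle 0) [[(3, 4)], [(3, 5)], [(8, 9)], [(8, 10)], [(8, 11)], [(8,
  12)], [(8, 13)], [(8, 14)], [(8, 15)], [(8, 16)], [(8, 17)]] (.kid 265 (.node (.triangle 0)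
  [[(4, 5)], [(9, 10)], [(9, 11)], [(9, 12)], [(9, 13)], [(9, 14)], [(9, 15)], [(9, 16)], [(9,
  17)]] (.kid 529 (.node (.split 0 5) [] (.kid 33 .known .done)) .done)) .done)) .done)) .done)))
  .done)

theorem seven_check : check seven [sevenState1, sevenState3] sevenCert ⟨[], [], []⟩ none = true := by
  decide +kernel

theorem not_isModel_seven (B : Finset (Finset (Fin 18))) : ¬ IsModel seven B :=
  not_isModel_of_refuted (refuted_of_check (by decide) (by simpa using ⟨seven_refuted1, seven_refuted3⟩) seven_check) B

end BlockSearch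

/-! ### Counting blocks by their special points. -/

section Counting

variable {B : Finset (Finset (Fin 18))}

/-- The number of blocks of size `k` that contain `x`. -/
def blockDegree (B : Finset (Finset (Fin 18))) (k : ℕ) (x : Fin 18) : ℕ :=
  (B.filter fun b => b.card = k ∧ x ∈ b).card

/-- The number of blocks of size `k` with `j` points in `S`. -/
def classCount (B : Finset (Finset (Fin 18))) (S : Finset (Fin 18)) (k j : ℕ) : ℕ :=
  (B.filter fun b => b.card = k ∧ (b ∩ S).card = j).card

theorem sum_card_inter_eq (F : Finset (Finset (Fin 18))) (A : Finset (Fin 18)) :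
    ∑ b ∈ F, (b ∩ A).card = ∑ x ∈ A, (F.filter fun b => x ∈ b).card := by
  simp only [inter_comm _ A, ← filter_mem_eq_inter, card_filter]
  exact sum_comm

/-- The blocks through `x`, with `x` removed, partition the other points. -/
theorem sum_card_inter_of_notMem (hB : IsCliqueDecomposition (⊤ : SimpleGraph (Fin 18)) {3, 4} B)
    {x : Fin 18} {A : Finset (Fin 18)} (hx : x ∉ A) :
    ∑ b ∈ B.filter (fun b => x ∈ b), (b ∩ A).card = A.card := by
  rw [sum_card_inter_eq, card_eq_sum_ones]
  refine sum_congr rfl fun y hy => ?_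
  have hxy : x ≠ y := fun h => hx (h ▸ hy)
  obtain ⟨b, hb, hxb, hyb⟩ := hB.exists_mem hxy
  rw [card_eq_one]
  refine ⟨b, ?_⟩
  ext c
  simp only [mem_filter, mem_singleton]
  constructor
  · rintro ⟨⟨hc, hxc⟩, hyc⟩
    exact hB.eq_of_mem hc hb hxy hxc hyc hxb hyb
  · rintro rfl
    exact ⟨⟨hb, hxb⟩, hyb⟩

/-- Both sides count ordered pairs of distinct points of `A`, each pair lying in one block. -/
theorem sum_card_inter_mul (hB : IsCliqueDecomposition (⊤ : SimpleGraph (Fin 18)) {3, 4} B)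
    (A : Finset (Fin 18)) :
    ∑ b ∈ B, (b ∩ A).card * ((b ∩ A).card - 1) = A.card * (A.card - 1) := by
  have h1 : ∑ x ∈ A, ∑ b ∈ B.filter (fun b => x ∈ b), ((b ∩ A).card - 1) =
      A.card * (A.card - 1) := by
    rw [sum_const_nat (m := A.card - 1)]
    intro x hx
    rw [← card_erase_of_mem hx, ← sum_card_inter_of_notMem hB (notMem_erase x A)]
    refine sum_congr rfl fun b hb => ?_
    rw [inter_erase, card_erase_of_mem (mem_inter.2 ⟨(mem_filter.1 hb).2, hx⟩)]
  rw [← h1]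
  simp only [sum_filter]
  rw [sum_comm]
  refine sum_congr rfl fun b _ => ?_
  rw [← sum_filter, sum_const, smul_eq_mul, filter_mem_eq_inter, inter_comm]

theorem sum_eq_triangles_add_quads
    (hB : IsCliqueDecomposition (⊤ : SimpleGraph (Fin 18)) {3, 4} B)
    (p : Finset (Fin 18) → Prop) [DecidablePred p] (f : Finset (Fin 18) → ℕ) :
    ∑ b ∈ B.filter p, f b = ∑ b ∈ B.filter (fun b => b.card = 3 ∧ p b), f b +
      ∑ b ∈ B.filter (fun b => b.card = 4 ∧ p b), f b := by
  rw [← sum_filter_add_sum_filter_not (B.filter p) (fun b => b.card = 3), filter_filter,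
    filter_filter]
  congr 1
  · exact sum_congr (filter_congr fun b _ => and_comm) fun _ _ => rfl
  · refine sum_congr (filter_congr fun b hb => ?_) fun _ _ => rfl
    have := hB.card_eq hb
    constructor
    · rintro ⟨h1, h2⟩; exact ⟨by omega, h1⟩
    · rintro ⟨h1, h2⟩; exact ⟨h2, by omega⟩

theorem sum_eq_triangles_add_quads_univ
    (hB : IsCliqueDecomposition (⊤ : SimpleGraph (Fin 18)) {3, 4} B) (f : Finset (Fin 18) → ℕ) :
    ∑ b ∈ B, f b = ∑ b ∈ B.filter (fun b => b.card = 3), f b +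
      ∑ b ∈ B.filter (fun b => b.card = 4), f b := by
  simpa using sum_eq_triangles_add_quads hB (fun _ => True) f

theorem sum_classes (S : Finset (Fin 18)) {k : ℕ} (hk : k < 5) (f : ℕ → ℕ) :
    ∑ b ∈ B.filter (fun b => b.card = k), f (b ∩ S).card =
      ∑ j ∈ range 5, classCount B S k j * f j := by
  rw [← sum_fiberwise_of_maps_to (t := range 5) (g := fun b => (b ∩ S).card)]
  · refine sum_congr rfl fun j _ => ?_
    rw [classCount, ← filter_filter, card_eq_sum_ones, sum_mul]
    refine sum_congr rfl fun b hb => ?_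
    rw [(mem_filter.1 hb).2, one_mul]
  · intro b hb
    have := card_le_card (inter_subset_left (s₁ := b) (s₂ := S))
    rw [mem_filter] at hb
    rw [mem_range]
    omega

theorem blockDegree_eq (hB : IsCliqueDecomposition (⊤ : SimpleGraph (Fin 18)) {3, 4} B)
    (x : Fin 18) : 2 * blockDegree B 3 x + 3 * blockDegree B 4 x = 17 := by
  have h := sum_card_inter_of_notMem hB (notMem_erase x univ)
  rw [card_erase_of_mem (mem_univ x), card_univ, Fintype.card_fin,
    sum_eq_triangles_add_quads hB] at h
  have key : ∀ k, ∀ b ∈ B.filter (fun b => b.card = k ∧ x ∈ b), (b ∩ univ.erase x).card = k - 1 := by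
    intro k b hb
    rw [mem_filter] at hb
    rw [inter_erase, inter_univ, card_erase_of_mem hb.2.2, hb.2.1]
  rw [sum_congr rfl (key 3), sum_congr rfl (key 4)] at h
  simp only [sum_const, smul_eq_mul] at h
  unfold blockDegree
  omega

/-- The points in more than one triangle. -/
def specialPoints (B : Finset (Finset (Fin 18))) : Finset (Fin 18) :=
  univ.filter fun x => blockDegree B 3 x ≠ 1

/-- The points in seven triangles. -/
def richPoints (B : Finset (Finset (Fin 18))) : Finset (Fin 18) :=
  univ.filter fun x => blockDegree B 3 x = 7

/-- The equation `2a + 3b = 17` has only the solutions `(1, 5)`, `(4, 3)`, `(7, 1)`. Written with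
indicators, since rich points are special too, they can be summed over points. -/
theorem blockDegree_facts (hB : IsCliqueDecomposition (⊤ : SimpleGraph (Fin 18)) {3, 4} B)
    (x : Fin 18) : blockDegree B 3 x = 1 + (if x ∈ specialPoints B then 3 else 0) +
        (if x ∈ richPoints B then 3 else 0) ∧
      blockDegree B 4 x + (if x ∈ specialPoints B then 2 else 0) +
        (if x ∈ richPoints B then 2 else 0) = 5 := by
  have := blockDegree_eq hB x
  have h1 : x ∈ specialPoints B ↔ blockDegree B 3 x ≠ 1 := by simp [specialPoints]
  have h2 : x ∈ richPoints B ↔ blockDegree B 3 x = 7 := by simp [richPoints]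
  split_ifs <;> simp_all <;> omega

theorem richPoints_subset : richPoints B ⊆ specialPoints B := by
  intro x hx
  simp_all [richPoints, specialPoints]

theorem sum_classCount {k : ℕ} (hk : k < 5) (S : Finset (Fin 18)) :
    numBlocks B k = ∑ j ∈ range 5, classCount B S k j := by
  have := sum_classes (B := B) S hk fun _ => 1
  simpa [numBlocks] using this

theorem sum_blockDegree (S : Finset (Fin 18)) {k : ℕ} (hk : k < 5) :
    ∑ x ∈ S, blockDegree B k x = ∑ j ∈ range 5, classCount B S k j * j := by
  rw [← sum_classes S hk fun j => j, sum_card_inter_eq]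
  simp only [filter_filter, blockDegree]

theorem classCount_three_four (S : Finset (Fin 18)) : classCount B S 3 4 = 0 := by
  rw [classCount, card_eq_zero, filter_eq_empty_iff]
  rintro b - ⟨h1, h2⟩
  have := card_le_card (inter_subset_left (s₁ := b) (s₂ := S))
  omega

/-- The equations between the numbers of blocks. -/
theorem counting (hB : IsCliqueDecomposition (⊤ : SimpleGraph (Fin 18)) {3, 4} B) :
    let c := classCount B (specialPoints B)
    let s := (specialPoints B).card
    let r := (richPoints B).card
    numBlocks B 3 + 2 * numBlocks B 4 = 51 ∧ 3 * numBlocks B 3 = 18 + 3 * s + 3 * r ∧ r ≤ s ∧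
    numBlocks B 3 = c 3 0 + c 3 1 + c 3 2 + c 3 3 ∧
    numBlocks B 4 = c 4 0 + c 4 1 + c 4 2 + c 4 3 + c 4 4 ∧
    c 3 1 + 2 * c 3 2 + 3 * c 3 3 = 4 * s + 3 * r ∧
    c 4 1 + 2 * c 4 2 + 3 * c 4 3 + 4 * c 4 4 + 2 * r = 3 * s ∧
    2 * c 3 2 + 6 * c 3 3 + 2 * c 4 2 + 6 * c 4 3 + 12 * c 4 4 = s * (s - 1) := by
  intro c s r
  have hsub := richPoints_subset (B := B)
  have hr : ∑ x ∈ specialPoints B, (if x ∈ richPoints B then 1 else 0) = r := by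
    rw [← card_filter, filter_mem_eq_inter, inter_eq_right.2 hsub]
  have hnum : ∀ k, numBlocks B k = (B.filter fun b => b.card = k).card := fun _ => rfl
  refine ⟨?_, ?_, card_le_card hsub, ?_, ?_, ?_, ?_, ?_⟩
  · have h := sum_card_inter_mul hB univ
    rw [sum_eq_triangles_add_quads_univ hB] at h
    simp only [inter_univ, card_univ, Fintype.card_fin] at h
    -- A triangle contains `3 * 2` ordered pairs, a quadruple `4 * 3`, and there are `18 * 17` in
    -- all.
    rw [sum_congr rfl (g := fun _ => 6) fun b hb => by rw [(mem_filter.1 hb).2],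
      sum_congr rfl (s₁ := B.filter fun b => b.card = 4) (g := fun _ => 12)
        fun b hb => by rw [(mem_filter.1 hb).2]] at h
    simp only [sum_const, smul_eq_mul, ← hnum] at h
    omega
  · have h := sum_card_inter_eq (B.filter fun b => b.card = 3) univ
    simp only [inter_univ, filter_filter] at h
    have hd : ∀ x, (B.filter fun b => b.card = 3 ∧ x ∈ b).card = _ := fun x =>
      (blockDegree_facts hB x).1
    rw [sum_congr rfl (g := fun _ => 3) fun b hb => (mem_filter.1 hb).2, sum_const, smul_eq_mul,
      ← hnum, sum_congr rfl fun x _ => hd x, sum_add_distrib, sum_add_distrib, sum_ite_mem, sum_ite_mem, univ_inter, univ_inter] at h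
    simp only [sum_const, smul_eq_mul, card_univ, Fintype.card_fin] at h
    omega
  · rw [sum_classCount (by norm_num) (specialPoints B)]
    simp [sum_range_succ, c, classCount_three_four]
  · rw [sum_classCount (by norm_num) (specialPoints B)]
    simp [sum_range_succ, c]
  · have h := sum_blockDegree (B := B) (specialPoints B) (k := 3) (by norm_num)
    have h' : ∑ x ∈ specialPoints B, blockDegree B 3 x = 4 * s + 3 * r := by
      rw [← hr, mul_sum, mul_comm 4, ← smul_eq_mul, ← sum_const, ← sum_add_distrib]
      refine sum_congr rfl fun x hx => ?_
      rw [(blockDegree_facts hB x).1, if_pos hx]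
      split_ifs <;> rfl
    rw [h'] at h
    rw [h]
    simp [sum_range_succ, c, classCount_three_four]
    ring
  · have h := sum_blockDegree (B := B) (specialPoints B) (k := 4) (by norm_num)
    have h' : ∑ x ∈ specialPoints B, blockDegree B 4 x + 2 * r = 3 * s := by
      rw [← hr, mul_sum, mul_comm 3, ← smul_eq_mul, ← sum_const, ← sum_add_distrib]
      refine sum_congr rfl fun x hx => ?_
      have := (blockDegree_facts hB x).2
      rw [if_pos hx] at this
      split_ifs at this ⊢ <;> omega
    rw [h] at h'
    rw [← h']
    simp [sum_range_succ, c]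
    ring
  · have h := sum_card_inter_mul hB (specialPoints B)
    rw [sum_eq_triangles_add_quads_univ hB] at h
    rw [sum_classes _ (by norm_num) (fun j => j * (j - 1)),
      sum_classes _ (by norm_num) (fun j => j * (j - 1))] at h
    rw [← h]
    simp [sum_range_succ, c, classCount_three_four]
    ring

/-- From `t = 6 + s + r = 51 - 2q ≤ 13` it follows that `s + r` is odd and at most 7; the remaining
equations are linear once `s` and `r` are fixed. The last three alternatives for `s = 7` are kept
coarse, in just the form that the local arguments refute. -/
theorem count_cases {s r t q t₀ t₁ t₂ t₃ q₀ q₁ q₂ q₃ q₄ : ℕ} (hq : 19 ≤ q) (h₁ : t + 2 * q = 51)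
    (h₂ : 3 * t = 18 + 3 * s + 3 * r) (h₃ : r ≤ s) (h₄ : t = t₀ + t₁ + t₂ + t₃)
    (h₅ : q = q₀ + q₁ + q₂ + q₃ + q₄) (h₆ : t₁ + 2 * t₂ + 3 * t₃ = 4 * s + 3 * r)
    (h₇ : q₁ + 2 * q₂ + 3 * q₃ + 4 * q₄ + 2 * r = 3 * s)
    (h₈ : 2 * t₂ + 6 * t₃ + 2 * q₂ + 6 * q₃ + 12 * q₄ = s * (s - 1)) :
    q₄ = 0 ∧ ((r = 1 ∧ s = 6 ∧ t₀ = 0 ∧ t₁ = 0) ∨ (r = 0 ∧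
      ((s = 1 ∧ t₀ = 3 ∧ t₁ = 4 ∧ t₂ = 0 ∧ t₃ = 0 ∧ q₀ = 19 ∧ q₁ = 3 ∧ q₂ = 0 ∧ q₃ = 0) ∨
      (s = 3 ∧ t₀ = 0 ∧ t₁ = 6 ∧ t₂ = 3 ∧ t₃ = 0 ∧ q₀ = 12 ∧ q₁ = 9 ∧ q₂ = 0 ∧ q₃ = 0) ∨
      (s = 5 ∧ t₀ = 0 ∧ t₁ = 2 ∧ t₂ = 9 ∧ t₃ = 0 ∧ q₀ = 6 ∧ q₁ = 13 ∧ q₂ = 1 ∧ q₃ = 0) ∨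
      (s = 5 ∧ t₀ = 0 ∧ t₁ = 3 ∧ t₂ = 7 ∧ t₃ = 1 ∧ q₀ = 5 ∧ q₁ = 15 ∧ q₂ = 0 ∧ q₃ = 0) ∨
      (s = 5 ∧ t₀ = 1 ∧ t₁ = 0 ∧ t₂ = 10 ∧ t₃ = 0 ∧ q₀ = 5 ∧ q₁ = 15 ∧ q₂ = 0 ∧ q₃ = 0) ∨
      (s = 7 ∧ t₀ = 0 ∧ t₁ = 0 ∧ t₂ = 11 ∧ t₃ = 2 ∧ q₀ = 2 ∧ q₁ = 13 ∧ q₂ = 4 ∧ q₃ = 0) ∨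
      (s = 7 ∧ t₀ = 0 ∧ 1 ≤ q₀ ∧ q₂ + q₃ ≤ 3) ∨
      (s = 7 ∧ t₀ = 0 ∧ q₀ = 0 ∧ 1 ≤ q₃) ∨
      (s = 7 ∧ t₀ = 0 ∧ t₁ = 2 ∧ t₃ = 4 ∧ q₀ = 0 ∧ q₂ = 2 ∧ q₃ = 0)))) := by
  have hs : s ≤ 7 := by omega
  have hr : r ≤ 3 := by omega
  have h₉ : q₄ = 0 := by
    interval_cases s <;> interval_cases r <;> omega
  have h₁₀ : (r = 1 ∧ s = 6) ∨ (r = 0 ∧ (s = 1 ∨ s = 3 ∨ s = 5 ∨ s = 7)) := by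
    interval_cases s <;> interval_cases r <;> omega
  subst h₉
  refine ⟨rfl, ?_⟩
  rcases h₁₀ with ⟨rfl, rfl⟩ | ⟨rfl, rfl | rfl | rfl | rfl⟩
  · left; omega
  · right; refine ⟨rfl, Or.inl ?_⟩; omega
  · right; refine ⟨rfl, Or.inr (Or.inl ?_)⟩; omega
  · right
    refine ⟨rfl, Or.inr (Or.inr ?_)⟩
    -- For fixed `t₀` and `t₁`, the numbers of triangles and of their incidences determine `t₂` and
    -- `t₃`.
    have h : (t₀ = 0 ∧ t₁ = 2) ∨ (t₀ = 0 ∧ t₁ = 3) ∨ (t₀ = 1 ∧ t₁ = 0) := by omega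
    rcases h with ⟨rfl, rfl⟩ | ⟨rfl, rfl⟩ | ⟨rfl, rfl⟩
    · left; omega
    · right; left; omega
    · right; right; left; omega
  · right
    refine ⟨rfl, Or.inr (Or.inr (Or.inr (Or.inr (Or.inr ?_))))⟩
    have h : (t₀ = 0 ∧ t₁ = 0) ∨ (t₀ = 0 ∧ t₁ = 1) ∨ (t₀ = 0 ∧ t₁ = 2) := by omega
    rcases h with ⟨rfl, rfl⟩ | ⟨rfl, rfl⟩ | ⟨rfl, rfl⟩
    · have h : q₃ = 0 ∨ q₃ = 1 := by omega
      rcases h with rfl | rfl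
      · left; omega
      · right; left; omega
    · have h : q₃ = 0 ∨ q₃ = 1 := by omega
      rcases h with rfl | rfl
      · right; left; omega
      · right; right; left; omega
    · right; right; right; omega

end Counting

/-! ### Local arguments around single points and blocks. -/

section Structure

variable {B : Finset (Finset (Fin 18))}

theorem blockDegree_of_notMem (hB : IsCliqueDecomposition (⊤ : SimpleGraph (Fin 18)) {3, 4} B)
    {x : Fin 18} (hx : x ∉ specialPoints B) : blockDegree B 3 x = 1 ∧ blockDegree B 4 x = 5 := by
  have h := blockDegree_facts hB x
  have hr : x ∉ richPoints B := fun h => hx (richPoints_subset h)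
  rw [if_neg hx, if_neg hr, if_neg hx, if_neg hr] at h
  omega

theorem ne_of_classCount_eq_zero {S : Finset (Fin 18)} {k j : ℕ} (h : classCount B S k j = 0)
    {b : Finset (Fin 18)} (hb : b ∈ B) (hk : b.card = k) : (b ∩ S).card ≠ j := fun hj => by
  rw [classCount, card_eq_zero, filter_eq_empty_iff] at h
  exact h hb ⟨hk, hj⟩

theorem card_inter_lt {b S : Finset (Fin 18)} {x : Fin 18} (hxb : x ∈ b) (hx : x ∉ S) :
    (b ∩ S).card < b.card :=
  card_lt_card ⟨inter_subset_left, fun h => hx (mem_inter.1 (h hxb)).2⟩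

theorem mem_filter_card {k : ℕ} {x : Fin 18} {b : Finset (Fin 18)} :
    b ∈ B.filter (fun b => b.card = k ∧ x ∈ b) ↔ b ∈ B ∧ b.card = k ∧ x ∈ b := mem_filter

/-- Every triangle has at least two special points, so each of the seven triangles through the rich
point contains another one. These would be seven different special points, but only five are
available. -/
theorem not_rich (hB : IsCliqueDecomposition (⊤ : SimpleGraph (Fin 18)) {3, 4} B)
    (hr : (richPoints B).card = 1) (hs : (specialPoints B).card = 6)
    (h0 : classCount B (specialPoints B) 3 0 = 0) (h1 : classCount B (specialPoints B) 3 1 = 0) :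
    False := by
  obtain ⟨w, hw⟩ := card_eq_one.1 hr
  have hwr : w ∈ richPoints B := by simp [hw]
  have hws := richPoints_subset hwr
  have h := sum_card_inter_of_notMem hB (notMem_erase w (specialPoints B))
  rw [card_erase_of_mem hws, hs, sum_eq_triangles_add_quads hB] at h
  have hd : blockDegree B 3 w = 7 := by simpa [richPoints] using hwr
  have := card_nsmul_le_sum (B.filter fun b => b.card = 3 ∧ w ∈ b)
    (fun b => (b ∩ (specialPoints B).erase w).card) 1 fun b hb => by
      rw [mem_filter_card] at hb
      have h2 := ne_of_classCount_eq_zero h0 hb.1 hb.2.1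
      have h3 := ne_of_classCount_eq_zero h1 hb.1 hb.2.1
      rw [inter_erase, card_erase_of_mem (mem_inter.2 ⟨hb.2.2, hws⟩)]
      omega
  rw [← blockDegree, hd, smul_eq_mul] at this
  omega

/-- The point `n` lies in one triangle and five quadruples, which share out the seven special
points. The triangle takes at most two and `q` none; if the other four quadruples took at most one
each, at most six points would be reached. -/
theorem exists_quad_of_notMem (hB : IsCliqueDecomposition (⊤ : SimpleGraph (Fin 18)) {3, 4} B)
    (hs : (specialPoints B).card = 7) {q : Finset (Fin 18)} (hq : q ∈ B) (hq4 : q.card = 4)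
    (hq0 : (q ∩ specialPoints B).card = 0) {n : Fin 18} (hn : n ∈ q) :
    ∃ b ∈ B, b.card = 4 ∧ n ∈ b ∧ 2 ≤ (b ∩ specialPoints B).card := by
  by_contra hc
  push Not at hc
  have hnS : n ∉ specialPoints B := fun h => by
    rw [card_eq_zero] at hq0
    exact notMem_empty n (hq0 ▸ mem_inter.2 ⟨hn, h⟩)
  obtain ⟨h3, h4⟩ := blockDegree_of_notMem hB hnS
  have h := sum_card_inter_of_notMem hB hnS
  rw [hs, sum_eq_triangles_add_quads hB] at h
  have h1 := sum_le_card_nsmul (B.filter fun b => b.card = 3 ∧ n ∈ b)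
    (fun b => (b ∩ specialPoints B).card) 2 fun b hb => by
      rw [mem_filter_card] at hb
      have := card_inter_lt hb.2.2 hnS
      omega
  rw [← blockDegree, h3] at h1
  have hqm : q ∈ B.filter fun b => b.card = 4 ∧ n ∈ b := mem_filter_card.2 ⟨hq, hq4, hn⟩
  rw [← add_sum_erase _ _ hqm, hq0] at h
  have h2 := sum_le_card_nsmul ((B.filter fun b => b.card = 4 ∧ n ∈ b).erase q)
    (fun b => (b ∩ specialPoints B).card) 1 fun b hb => by
      obtain ⟨hb1, hb2, hb3⟩ := mem_filter_card.1 (mem_of_mem_erase hb)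
      have := hc b hb1 hb2 hb3
      omega
  rw [card_erase_of_mem hqm, ← blockDegree, h4] at h2
  simp only [smul_eq_mul] at h1 h2
  omega

/-- Each of the four points of a quadruple without special points lies in a quadruple with at least
two of them. These four are distinct, because a block other than `q` meets `q` in at most one point.
-/
theorem four_le_of_quad (hB : IsCliqueDecomposition (⊤ : SimpleGraph (Fin 18)) {3, 4} B)
    (hs : (specialPoints B).card = 7) (h0 : 1 ≤ classCount B (specialPoints B) 4 0) :
    4 ≤ classCount B (specialPoints B) 4 2 + classCount B (specialPoints B) 4 3 +
      classCount B (specialPoints B) 4 4 := by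
  obtain ⟨q, hq⟩ := card_pos.1 h0
  obtain ⟨hq, hq4, hq0⟩ := mem_filter.1 hq
  have key : ∀ n, ∃ b, n ∈ q → b ∈ B ∧ b.card = 4 ∧ n ∈ b ∧ 2 ≤ (b ∩ specialPoints B).card :=
    fun n => by
      by_cases hn : n ∈ q
      · obtain ⟨b, hb⟩ := exists_quad_of_notMem hB hs hq hq4 hq0 hn
        exact ⟨b, fun _ => hb⟩
      -- A dummy value outside `q`, so that the choice function is total.
      · exact ⟨∅, fun h => absurd h hn⟩
  choose f hf using key
  have hle := card_le_card_of_injOn (s := q)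
    (t := (B.filter fun b => b.card = 4).filter fun b => 2 ≤ (b ∩ specialPoints B).card) f
    (fun n hn => by
      obtain ⟨h1, h2, -, h4⟩ := hf n hn
      simp [h1, h2, h4])
    (fun n hn m hm hnm => by
      by_contra hne
      obtain ⟨h1, -, h3, h4⟩ := hf n hn
      have h5 := (hf m hm).2.2.1
      rw [← hnm] at h5
      have := hB.eq_of_mem hq h1 hne hn hm h3 h5
      rw [← this, hq0] at h4
      omega)
  rw [hq4, card_filter, sum_classes (specialPoints B) (by norm_num)
    fun j => if 2 ≤ j then 1 else 0] at hle
  simpa [sum_range_succ] using hle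

/-- At the ordinary point of a quadruple with three special points, the triangle and the four other
quadruples contribute at least one special point each. This makes `3 + 1 + 4 = 8 > 7`. -/
theorem classCount_four_three (hB : IsCliqueDecomposition (⊤ : SimpleGraph (Fin 18)) {3, 4} B)
    (hs : (specialPoints B).card = 7) (ht : classCount B (specialPoints B) 3 0 = 0)
    (hq : classCount B (specialPoints B) 4 0 = 0) : classCount B (specialPoints B) 4 3 = 0 := by
  by_contra h0
  obtain ⟨q, hqm⟩ := card_pos.1 (Nat.pos_of_ne_zero h0)
  obtain ⟨hqB, hq4, hq3⟩ := mem_filter.1 hqm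
  obtain ⟨n, hn, hnS⟩ : ∃ n ∈ q, n ∉ specialPoints B := by
    by_contra hc
    push Not at hc
    rw [inter_eq_left.2 hc] at hq3
    omega
  obtain ⟨h3, h4⟩ := blockDegree_of_notMem hB hnS
  have h := sum_card_inter_of_notMem hB hnS
  rw [hs, sum_eq_triangles_add_quads hB] at h
  have h1 := card_nsmul_le_sum (B.filter fun b => b.card = 3 ∧ n ∈ b)
    (fun b => (b ∩ specialPoints B).card) 1 fun b hb => by
      rw [mem_filter_card] at hb
      exact Nat.one_le_iff_ne_zero.2 (ne_of_classCount_eq_zero ht hb.1 hb.2.1)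
  rw [← blockDegree, h3] at h1
  have hqm : q ∈ B.filter fun b => b.card = 4 ∧ n ∈ b := mem_filter_card.2 ⟨hqB, hq4, hn⟩
  rw [← add_sum_erase _ _ hqm, hq3] at h
  have h2 := card_nsmul_le_sum ((B.filter fun b => b.card = 4 ∧ n ∈ b).erase q)
    (fun b => (b ∩ specialPoints B).card) 1 fun b hb => by
      obtain ⟨hb1, hb2, -⟩ := mem_filter_card.1 (mem_of_mem_erase hb)
      exact Nat.one_le_iff_ne_zero.2 (ne_of_classCount_eq_zero hq hb1 hb2)
  rw [card_erase_of_mem hqm, ← blockDegree, h4] at h2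
  simp only [smul_eq_mul] at h1 h2
  omega

/-- Around a triangle with one special point, when quadruples have one or (just two of them) two
special points. -/
theorem card_inter_eq_three (hB : IsCliqueDecomposition (⊤ : SimpleGraph (Fin 18)) {3, 4} B)
    (hr : (richPoints B).card = 0) (hs : (specialPoints B).card = 7)
    (hq0 : classCount B (specialPoints B) 4 0 = 0) (hq2 : classCount B (specialPoints B) 4 2 = 2)
    (hq3 : classCount B (specialPoints B) 4 3 = 0) (hq4 : classCount B (specialPoints B) 4 4 = 0)
    {T : Finset (Fin 18)} (hT : T ∈ B) (hT3 : T.card = 3) {x : Fin 18} (hxT : x ∈ T)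
    (hTx : T ∩ specialPoints B = {x}) :
    ((B.filter fun b => b.card = 3 ∧ x ∈ b).erase T).card = 3 ∧
      ∀ b ∈ (B.filter fun b => b.card = 3 ∧ x ∈ b).erase T, (b ∩ specialPoints B).card = 3 := by
  set S := specialPoints B with hS
  have hxS : x ∈ S := (mem_inter.1 (hTx ▸ mem_singleton_self x)).2
  have hquad : ∀ b ∈ B, b.card = 4 → (b ∩ S).card = 1 ∨ (b ∩ S).card = 2 := fun b hb hb4 => by
    have h1 := ne_of_classCount_eq_zero hq0 hb hb4
    have h2 := ne_of_classCount_eq_zero hq3 hb hb4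
    have h3 := ne_of_classCount_eq_zero hq4 hb hb4
    have h4 := card_le_card (inter_subset_left (s₁ := b) (s₂ := S))
    omega
  -- An ordinary point of `T` sees only one special point in its triangle `T`; its five quadruples
  -- have to supply six, so one of them has two.
  have hnear : ∀ n ∈ T, n ≠ x → ∃ b ∈ B, b.card = 4 ∧ n ∈ b ∧ (b ∩ S).card = 2 := by
    intro n hn hnx
    have hnS : n ∉ S := fun h => hnx (by simpa [hTx] using mem_inter.2 ⟨hn, h⟩)
    by_contra hc
    push Not at hc
    obtain ⟨h3, h4⟩ := blockDegree_of_notMem hB hnS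
    have h := sum_card_inter_of_notMem hB hnS
    rw [hs, sum_eq_triangles_add_quads hB] at h
    have hTm : T ∈ B.filter fun b => b.card = 3 ∧ n ∈ b := mem_filter_card.2 ⟨hT, hT3, hn⟩
    have hE : (B.filter fun b => b.card = 3 ∧ n ∈ b).erase T = ∅ := by
      rw [← card_eq_zero, card_erase_of_mem hTm, ← blockDegree, h3]
    rw [← add_sum_erase _ _ hTm, hE, hTx, sum_empty, card_singleton] at h
    have h2 := sum_le_card_nsmul (B.filter fun b => b.card = 4 ∧ n ∈ b)
      (fun b => (b ∩ S).card) 1 fun b hb => by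
        obtain ⟨hb1, hb2, hb3⟩ := mem_filter_card.1 hb
        exact ((hquad b hb1 hb2).resolve_right (hc b hb1 hb2 hb3)).le
    rw [← blockDegree, h4, smul_eq_mul] at h2
    omega
  obtain ⟨n, m, hnm, he⟩ : ∃ n m, n ≠ m ∧ T.erase x = {n, m} := by
    rw [← card_eq_two, card_erase_of_mem hxT, hT3]
  have hn : n ∈ T.erase x := by simp [he]
  have hm : m ∈ T.erase x := by simp [he]
  rw [mem_erase] at hn hm
  obtain ⟨b₁, hb₁, hb₁4, hnb₁, hb₁2⟩ := hnear n hn.2 hn.1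
  obtain ⟨b₂, hb₂, hb₂4, hmb₂, hb₂2⟩ := hnear m hm.2 hm.1
  have hTne : ∀ b : Finset (Fin 18), b.card = 4 → T ≠ b := fun b hb h => by
    rw [h, hb] at hT3; omega
  have hb₁₂ : b₁ ≠ b₂ := fun h => hTne b₁ hb₁4 <|
    hB.eq_of_mem hT hb₁ hnm hn.2 hm.2 hnb₁ (h ▸ hmb₂)
  -- The quadruples found at the two ordinary points of `T` are thus the only ones with two special
  -- points. Neither contains `x`, since it would share two points with `T`.
  have htwo : (B.filter fun b => b.card = 4 ∧ (b ∩ S).card = 2) = {b₁, b₂} := by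
    symm
    apply eq_of_subset_of_card_le
    · simp [insert_subset_iff, hb₁, hb₁4, hb₁2, hb₂, hb₂4, hb₂2]
    · rw [card_pair hb₁₂]; exact hq2.le
  have hone : ∀ b ∈ B, b.card = 4 → x ∈ b → (b ∩ S).card = 1 := by
    intro b hb hb4 hxb
    refine (hquad b hb hb4).resolve_right fun h2 => ?_
    have : b ∈ ({b₁, b₂} : Finset (Finset (Fin 18))) := htwo ▸ mem_filter.2 ⟨hb, hb4, h2⟩
    rw [mem_insert, mem_singleton] at this
    rcases this with rfl | rfl
    · exact hTne b hb4 (hB.eq_of_mem hT hb hn.1 hn.2 hxT hnb₁ hxb)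
    · exact hTne b hb4 (hB.eq_of_mem hT hb hm.1 hm.2 hxT hmb₂ hxb)
  have hTm : T ∈ B.filter fun b => b.card = 3 ∧ x ∈ b := mem_filter_card.2 ⟨hT, hT3, hxT⟩
  have hdeg : blockDegree B 3 x = 4 := by
    have h := (blockDegree_facts hB x).1
    rw [card_eq_zero] at hr
    rw [if_pos (hS ▸ hxS), hr, if_neg (notMem_empty x)] at h
    exact h
  have hcard : ((B.filter fun b => b.card = 3 ∧ x ∈ b).erase T).card = 3 := by
    rw [card_erase_of_mem hTm, ← blockDegree, hdeg]
  -- The six special points other than `x` are not in quadruples through `x`, nor in `T`. The three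
  -- other triangles through `x` take at most two each, so exactly two.
  have h := sum_card_inter_of_notMem hB (notMem_erase x S)
  have hcardx : ∀ b : Finset (Fin 18), x ∈ b → (b ∩ S.erase x).card = (b ∩ S).card - 1 :=
    fun b hb => by rw [inter_erase, card_erase_of_mem (mem_inter.2 ⟨hb, hxS⟩)]
  rw [card_erase_of_mem hxS, hs, sum_eq_triangles_add_quads hB,
    sum_eq_zero (s := B.filter fun b => b.card = 4 ∧ x ∈ b) fun b hb => by
      obtain ⟨hb1, hb2, hb3⟩ := mem_filter_card.1 hb
      rw [hcardx b hb3, hone b hb1 hb2 hb3, Nat.sub_self], ← add_sum_erase _ _ hTm, hcardx T hxT, hTx,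
    card_singleton] at h
  refine ⟨hcard, fun b hb => ?_⟩
  have hb' := mem_filter_card.1 (mem_of_mem_erase hb)
  rw [← add_sum_erase _ _ hb, hcardx b hb'.2.2] at h
  have h2 := sum_le_card_nsmul (((B.filter fun b => b.card = 3 ∧ x ∈ b).erase T).erase b)
    (fun b => (b ∩ S.erase x).card) 2 fun c hc => by
      obtain ⟨hc1, hc2, hc3⟩ := mem_filter_card.1 (mem_of_mem_erase (mem_of_mem_erase hc))
      rw [hcardx c hc3]
      have := card_le_card (inter_subset_left (s₁ := c) (s₂ := S))
      omega
  rw [card_erase_of_mem hb, hcard, smul_eq_mul] at h2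
  have := card_le_card (inter_subset_left (s₁ := b) (s₂ := S))
  omega

/-- Each triangle with a single special point yields three triangles of special points through that
point. The two special points differ, so the two triples share at most one triangle, giving at least
five where only four exist. -/
theorem not_two_triangles (hB : IsCliqueDecomposition (⊤ : SimpleGraph (Fin 18)) {3, 4} B)
    (hr : (richPoints B).card = 0) (hs : (specialPoints B).card = 7)
    (ht1 : classCount B (specialPoints B) 3 1 = 2) (ht3 : classCount B (specialPoints B) 3 3 = 4)
    (hq0 : classCount B (specialPoints B) 4 0 = 0) (hq2 : classCount B (specialPoints B) 4 2 = 2)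
    (hq3 : classCount B (specialPoints B) 4 3 = 0)
    (hq4 : classCount B (specialPoints B) 4 4 = 0) : False := by
  obtain ⟨T, T', hTT, he⟩ := card_eq_two.1 ht1
  have hT : T ∈ B.filter fun b => b.card = 3 ∧ (b ∩ specialPoints B).card = 1 := by simp [he]
  have hT' : T' ∈ B.filter fun b => b.card = 3 ∧ (b ∩ specialPoints B).card = 1 := by simp [he]
  obtain ⟨hT, hT3, hT1⟩ := mem_filter.1 hT
  obtain ⟨hT', hT'3, hT'1⟩ := mem_filter.1 hT'
  obtain ⟨x, hx⟩ := card_eq_one.1 hT1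
  obtain ⟨y, hy⟩ := card_eq_one.1 hT'1
  have hxT : x ∈ T := (mem_inter.1 (hx ▸ mem_singleton_self x)).1
  have hyT : y ∈ T' := (mem_inter.1 (hy ▸ mem_singleton_self y)).1
  obtain ⟨h1, h2⟩ := card_inter_eq_three hB hr hs hq0 hq2 hq3 hq4 hT hT3 hxT hx
  obtain ⟨h3, h4⟩ := card_inter_eq_three hB hr hs hq0 hq2 hq3 hq4 hT' hT'3 hyT hy
  have hxy : x ≠ y := by
    rintro rfl
    have := h2 T' (mem_erase.2 ⟨hTT.symm, mem_filter_card.2 ⟨hT', hT'3, hyT⟩⟩)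
    omega
  set F := (B.filter fun b => b.card = 3 ∧ x ∈ b).erase T
  set F' := (B.filter fun b => b.card = 3 ∧ y ∈ b).erase T'
  have hinter : (F ∩ F').card ≤ 1 := by
    rw [card_le_one]
    intro a ha b hb
    rw [mem_inter] at ha hb
    have ha1 := mem_filter_card.1 (mem_of_mem_erase ha.1)
    have ha2 := mem_filter_card.1 (mem_of_mem_erase ha.2)
    have hb1 := mem_filter_card.1 (mem_of_mem_erase hb.1)
    have hb2 := mem_filter_card.1 (mem_of_mem_erase hb.2)
    exact hB.eq_of_mem ha1.1 hb1.1 hxy ha1.2.2 ha2.2.2 hb1.2.2 hb2.2.2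
  have hunion : (F ∪ F').card ≤ 4 := by
    rw [← ht3]
    refine card_le_card fun b hb => ?_
    rcases mem_union.1 hb with hb | hb
    · have hb1 := mem_filter_card.1 (mem_of_mem_erase hb)
      exact mem_filter.2 ⟨hb1.1, hb1.2.1, h2 b hb⟩
    · have hb1 := mem_filter_card.1 (mem_of_mem_erase hb)
      exact mem_filter.2 ⟨hb1.1, hb1.2.1, h4 b hb⟩
  have := card_union_add_card_inter F F'
  omega

/-! ### Relabelling the points -/

theorem exists_perm_lt (S : Finset (Fin 18)) :
    ∃ σ : Equiv.Perm (Fin 18), ∀ x, ((σ x : Fin 18) : ℕ) < S.card ↔ x ∈ S := by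
  have hle : S.card ≤ 18 := by simpa using card_le_univ S
  have hcard : Fintype.card {x // x ∈ S} = Fintype.card {x : Fin 18 // (x : ℕ) < S.card} := by
    rw [Fintype.card_coe, Fintype.card_subtype, Fin.card_filter_val_lt, min_eq_right hle]
  let e := Fintype.equivOfCardEq hcard
  refine ⟨e.extendSubtype, fun x => ?_⟩
  by_cases hx : x ∈ S
  · simpa [hx] using e.extendSubtype_mem x hx
  · simpa [hx] using e.extendSubtype_not_mem x hx

/-- Moves the special points to the front. Without rich points every special point lies in exactly
four triangles, as `IsModel.degree` demands. -/
theorem exists_isModel (hB : IsCliqueDecomposition (⊤ : SimpleGraph (Fin 18)) {3, 4} B)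
    (hr : (richPoints B).card = 0) {sp : Spec} (hd : (specialPoints B).card = sp.d)
    (ht : numBlocks B 3 = sp.t)
    (hτ : ∀ j, classCount B (specialPoints B) 3 j = sp.τ.getD j 0)
    (hρ : ∀ j, classCount B (specialPoints B) 4 j = sp.ρ.getD j 0) : ∃ B', IsModel sp B' := by
  obtain ⟨σ, hσ⟩ := exists_perm_lt (specialPoints B)
  rw [hd] at hσ
  have hsp : ∀ b : Finset (Fin 18),
      specials sp.d (b.map σ.toEmbedding) = (b ∩ specialPoints B).card := fun b => by
    rw [specials, filter_map, card_map, ← filter_mem_eq_inter]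
    congr 1
    exact filter_congr fun x _ => hσ x
  refine ⟨BlockSearch.image σ B, BlockSearch.isCliqueDecomposition_image σ hB, ?_, fun x => ?_,
    fun j => ?_, fun j => ?_⟩
  · rw [BlockSearch.card_filter_image]
    simp only [card_map]
    exact ht
  · rw [BlockSearch.card_filter_image]
    simp only [card_map, mem_map_equiv]
    have h := (blockDegree_facts hB (σ.symm x)).1
    rw [card_eq_zero] at hr
    rw [hr, if_neg (notMem_empty _)] at h
    refine h.trans ?_
    have hx := hσ (σ.symm x)
    rw [Equiv.apply_symm_apply] at hx
    by_cases hxS : σ.symm x ∈ specialPoints B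
    · rw [if_pos hxS, if_pos (hx.2 hxS)]
    · rw [if_neg hxS, if_neg fun h => hxS (hx.1 h)]
  · rw [BlockSearch.card_filter_image]
    simp only [card_map, hsp]
    exact hτ j
  · rw [BlockSearch.card_filter_image]
    simp only [card_map, hsp]
    exact hρ j

theorem classCount_eq_zero_of_lt (S : Finset (Fin 18)) {k j : ℕ} (h : k < j) :
    classCount B S k j = 0 := by
  rw [classCount, card_eq_zero, filter_eq_empty_iff]
  rintro b - ⟨h1, h2⟩
  have := card_le_card (inter_subset_left (s₁ := b) (s₂ := S))
  omega

theorem classCount_eq_getD (S : Finset (Fin 18)) {a₀ a₁ a₂ a₃ c₀ c₁ c₂ c₃ : ℕ}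
    (h₀ : classCount B S 3 0 = a₀) (h₁ : classCount B S 3 1 = a₁) (h₂ : classCount B S 3 2 = a₂)
    (h₃ : classCount B S 3 3 = a₃) (k₀ : classCount B S 4 0 = c₀) (k₁ : classCount B S 4 1 = c₁)
    (k₂ : classCount B S 4 2 = c₂) (k₃ : classCount B S 4 3 = c₃) (k₄ : classCount B S 4 4 = 0) :
    (∀ j, classCount B S 3 j = [a₀, a₁, a₂, a₃].getD j 0) ∧
      ∀ j, classCount B S 4 j = [c₀, c₁, c₂, c₃, 0].getD j 0 := by
  constructor
  · rintro (_ | _ | _ | _ | j) <;> simp [*, classCount_eq_zero_of_lt]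
  · rintro (_ | _ | _ | _ | _ | j) <;> simp [*, classCount_eq_zero_of_lt]

-- With at least 19 quadruples, one of the distributions of `count_cases` would occur; the search
-- excludes six of them and the local arguments the others.
open BlockSearch in
theorem numBlocks_four_le (hB : IsCliqueDecomposition (⊤ : SimpleGraph (Fin 18)) {3, 4} B) :
    numBlocks B 4 ≤ 18 := by
  by_contra hq
  obtain ⟨h₁, h₂, h₃, h₄, h₅, h₆, h₇, h₈⟩ := counting hB
  obtain ⟨hq4, hc⟩ := count_cases (by omega) h₁ h₂ h₃ h₄ h₅ h₆ h₇ h₈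
  rcases hc with ⟨hr, hs, h0, h1⟩ | ⟨hr, hc⟩
  · exact not_rich hB hr hs h0 h1
  have key : ∀ {sp : Spec}, (∀ B, ¬ IsModel sp B) → (specialPoints B).card = sp.d →
      numBlocks B 3 = sp.t → ¬ ((∀ j, classCount B (specialPoints B) 3 j = sp.τ.getD j 0) ∧
        ∀ j, classCount B (specialPoints B) 4 j = sp.ρ.getD j 0) := fun hn hd ht h =>
    let ⟨B', hB'⟩ := exists_isModel hB hr hd ht h.1 h.2
    hn B' hB'
  rcases hc with ⟨hs, a, b, c, d, e, f, g, h⟩ | ⟨hs, a, b, c, d, e, f, g, h⟩ |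
    ⟨hs, a, b, c, d, e, f, g, h⟩ | ⟨hs, a, b, c, d, e, f, g, h⟩ | ⟨hs, a, b, c, d, e, f, g, h⟩ |
    ⟨hs, a, b, c, d, e, f, g, h⟩ | ⟨hs, a, b, c⟩ | ⟨hs, a, b, c⟩ | ⟨hs, a, b, c, d, e, f⟩
  · exact key not_isModel_one hs (by rw [h₄, a, b, c, d]; rfl)
      (classCount_eq_getD _ a b c d e f g h hq4)
  · exact key not_isModel_three hs (by rw [h₄, a, b, c, d]; rfl)
      (classCount_eq_getD _ a b c d e f g h hq4)
  · exact key not_isModel_fiveA hs (by rw [h₄, a, b, c, d]; rfl)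
      (classCount_eq_getD _ a b c d e f g h hq4)
  · exact key not_isModel_fiveB hs (by rw [h₄, a, b, c, d]; rfl)
      (classCount_eq_getD _ a b c d e f g h hq4)
  · exact key not_isModel_fiveC hs (by rw [h₄, a, b, c, d]; rfl)
      (classCount_eq_getD _ a b c d e f g h hq4)
  · exact key not_isModel_seven hs (by rw [h₄, a, b, c, d]; rfl)
      (classCount_eq_getD _ a b c d e f g h hq4)
  · have := four_le_of_quad hB hs b
    omega
  · have := classCount_four_three hB hs a b
    omega
  · exact not_two_triangles hB hr hs b c d e f hq4

end Structure

/-! ### The extremal decomposition and the minimum. -/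

/-- A decomposition with 15 triangles and 18 quadruples. -/
def optimalList : List (List (Fin 18)) :=
  [[6, 9, 10, 12], [7, 10, 11, 13], [8, 9, 11, 14], [0, 7, 12, 14], [1, 8, 12, 13], [2, 6, 13,
  14], [6, 7, 16], [6, 8, 15], [7, 8, 17], [3, 8, 10, 16], [4, 6, 11, 17], [5, 7, 9, 15], [0, 3,
  6], [1, 4, 7], [2, 5, 8], [0, 4, 8], [1, 5, 6], [2, 3, 7], [0, 13, 15, 17], [1, 14, 15, 16], [2,
  12, 16, 17], [0, 5, 11, 16], [1, 3, 9, 17], [2, 4, 10, 15], [0, 1, 10], [0, 2, 9], [1, 2, 11],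
  [3, 11, 12, 15], [4, 9, 13, 16], [5, 10, 14, 17], [3, 4, 14], [3, 5, 13], [4, 5, 12]]

/-- The blocks form eleven orbits of length three under the permutation that rotates each of the
triples `(0 1 2)`, `(3 4 5)`, …, `(15 16 17)`. -/
def optimalBlocks : Finset (Finset (Fin 18)) := (optimalList.map List.toFinset).toFinset

theorem mem_optimalBlocks {b : Finset (Fin 18)} :
    b ∈ optimalBlocks ↔ ∃ l ∈ optimalList, l.toFinset = b := by
  rw [optimalBlocks, List.mem_toFinset, List.mem_map]

theorem card_optimalList : ∀ l ∈ optimalList, l.toFinset.card = 3 ∨ l.toFinset.card = 4 := by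
  decide +kernel

theorem length_filter_optimalList : ∀ x y : Fin 18, x ≠ y →
    (optimalList.filter fun l => x ∈ l ∧ y ∈ l).length = 1 := by
  decide +kernel

theorem numBlocks_optimalBlocks :
    numBlocks optimalBlocks 3 = 15 ∧ numBlocks optimalBlocks 4 = 18 ∧ optimalBlocks.card = 33 := by
  decide +kernel

theorem isCliqueDecomposition_optimalBlocks :
    IsCliqueDecomposition (⊤ : SimpleGraph (Fin 18)) {3, 4} optimalBlocks where
  isClique b _ := fun x _ y _ hxy => by simpa using hxy
  card_mem b hb := by
    obtain ⟨l, hl, rfl⟩ := mem_optimalBlocks.1 hb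
    simpa using card_optimalList l hl
  existsUnique_block x y hxy := by
    obtain ⟨l, hl⟩ := List.length_eq_one_iff.1 (length_filter_optimalList x y (by simpa using hxy))
    have key : ∀ k, (k ∈ optimalList ∧ x ∈ k ∧ y ∈ k) ↔ k = l := fun k => by
      rw [← List.mem_singleton, ← hl, List.mem_filter, decide_eq_true_eq]
    obtain ⟨h1, h2, h3⟩ := (key l).2 rfl
    refine ⟨l.toFinset, ⟨mem_optimalBlocks.2 ⟨l, h1, rfl⟩, by simpa using h2, by simpa using h3⟩, ?_⟩
    rintro b ⟨hb, hxb, hyb⟩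
    obtain ⟨k, hk, rfl⟩ := mem_optimalBlocks.1 hb
    rw [(key k).1 ⟨hk, by simpa using hxb, by simpa using hyb⟩]

theorem card_eq_add_numBlocks {B : Finset (Finset (Fin 18))}
    (hB : IsCliqueDecomposition (⊤ : SimpleGraph (Fin 18)) {3, 4} B) :
    B.card = numBlocks B 3 + numBlocks B 4 := by
  have := sum_eq_triangles_add_quads_univ hB fun _ => 1
  simpa [numBlocks] using this

theorem isLeast_decompositionSizes : IsLeast (decompositionSizes 18 {3, 4}) 33 := by
  refine ⟨⟨_, isCliqueDecomposition_optimalBlocks, numBlocks_optimalBlocks.2.2⟩, ?_⟩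
  rintro n ⟨B, hB, rfl⟩
  have h1 := numBlocks_four_le hB
  have h2 := (counting hB).1
  have h3 := card_eq_add_numBlocks hB
  omega

theorem minDecomposition_eq : minDecomposition 18 {3, 4} = 33 :=
  isLeast_decompositionSizes.csInf_eq

/-- `D(18, {3, 4}) = 33`; the minimum is attained by a decomposition with 15 triangles and 18 copies
of `K_4`, and every decomposition attaining it has these numbers of blocks. -/
theorem mainTheorem1 :
    IsLeast (decompositionSizes 18 {3, 4}) 33 ∧
    minDecomposition 18 {3, 4} = 33 ∧
    (∃ B : Finset (Finset (Fin 18)),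
      IsCliqueDecomposition (⊤ : SimpleGraph (Fin 18)) {3, 4} B ∧
        B.card = minDecomposition 18 {3, 4} ∧ numBlocks B 3 = 15 ∧ numBlocks B 4 = 18) ∧
    (∀ B : Finset (Finset (Fin 18)),
      IsCliqueDecomposition (⊤ : SimpleGraph (Fin 18)) {3, 4} B →
        B.card = minDecomposition 18 {3, 4} → numBlocks B 3 = 15 ∧ numBlocks B 4 = 18) := by
  refine ⟨isLeast_decompositionSizes, minDecomposition_eq,
    ⟨_, isCliqueDecomposition_optimalBlocks, ?_, numBlocks_optimalBlocks.1,
      numBlocks_optimalBlocks.2.1⟩, fun B hB hcard => ?_⟩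
  · rw [minDecomposition_eq]
    exact numBlocks_optimalBlocks.2.2
  · rw [minDecomposition_eq] at hcard
    -- The equations `t + 2q = 51` and `t + q = 33` have a unique solution.
    have h2 := (counting hB).1
    have h3 := card_eq_add_numBlocks hB
    omega
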